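/- **Setting.** Let $E^{c},E^{i}$ be Polish spaces with probability measures $\nu^c,\nu^i$, let $\lambda,T\in(0,\infty)$, and put $E=E^c\times E^i$, $\nu=\lambda(\nu^c\otimes\nu^i)$. A type is a vector $t=(x_0^t,r^t,\kappa^t,\sigma^t,\sigma^{0t},\eta^t,\zeta^t,\alpha^t,\theta^t)$ with $x_0^t>0$, $r^t,\kappa^t\in\mathbb R$, $\sigma^t,\sigma^{0t}\ge 0$, measurable $\eta^t,\zeta^t:E\to\mathbb R$, $\alpha^t\in(0,\infty)\setminus\{1\}$, $\theta^t\in[0,1]$. Let $\mathbf T$ be a set of types with a $\sigma$-field that makes all components measurable, $(t,e)\mapsto\eta^t(e),\zeta^t(e)$ jointly, and let $\mathbb T$ be a probability measure on $\mathbf T$. For a type $t$ with finitely many signals let $\mu^t=\nu\circ(\zeta^t)^{-1}$. For a signal $z\neq0$ with $\mu^t(\{z\})>0$ let $\underline\eta^t(z),\overline\eta^t(z)\in[-\infty,\infty]$ be the essential infimum and supremum of $\eta^t$ under $\nu(\cdot\mid\zeta^t=z)$; let $\underline\eta^t(0),\overline\eta^t(0)$ be those under $\nu(\cdot\cap\{\zeta^t=0,\eta^t\ne0\})$.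 Assume: * for $\mathbb T$-a.e. $t$: $\nu(\eta^t<-1)=0$; $\zeta^t$ takes finitely many values; $\underline\eta^t(z)<0<\overline\eta^t(z)$ for $\mu^t$-a.e. $z\ne0$; * $|r^t|+|\kappa^t|+\sigma^t+\sigma^{0t}+\alpha^t$ is $\mathbb T$-essentially bounded and $\log x_0^t\in L^1(\mathbb T)$; * there is $c_0>0$ such that for $\mathbb T$-a.e. $t$: $\overline\eta^t(z)\ge c_0$ and $\underline\eta^t(z)\le-c_0$ for $z=0$ and for $\mu^t$-a.e. $z$; * if $\mathbb T$ is carried by a finite set of types, $\int_E(1+\eta^t)^p\,d\nu<\infty$ for all $p>0$ and $\mathbb T$-a.e. $t$; otherwise $\eta^t(e)$ is $\mathbb T\otimes\nu$-essentially bounded above. Let $a,b:\mathbf T\to(0,1]$ be measurable, and constant if $\mathbb T$ is not carried by a finite set. An admissible signal-driven strategy is a jointly measurable $\pi:\mathbf T\times\mathbb R\to\mathbb R$ such that for $\mathbb T$-a.e. $t$ $$\pi^t(z)\in\Big[-\frac{1-a^t}{\overline\eta^t(z)},\,-\frac{1-b^t}{\underline\eta^t(z)}\Big]\qquad\text{for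 } z=0 \text{ and for } \mu^t\text{-a.e. } z\qquad(1/\infty:=0).$$ *Mean field wealth.* On a probability space $(\Omega,\mathfrak A,\mathbb P)$ let $W,W^0$ be standard Brownian motions and $N$ a Poisson random measure on $[0,\infty)\times E$ with intensity $dt\otimes\nu$, all independent. Lift them to $\bar\Omega=\mathbf T\times\Omega$ with $\bar{\mathbb P}=\mathbb T\otimes\mathbb P$, and let $\tau(t,\omega)=t$. Let $\bar{\mathcal F}_t$ be generated by $\tau$, by $W_s,W^0_s,N([0,s]\times A)$ for $s\le t$ and measurable $A\subseteq E$, and by the $\bar{\mathbb P}$-null events. Let $\mathcal F^0_t$ be generated by $W^0_s,N([0,s]\times A\times E^i)$ for $s\le t$ and measurable $A\subseteq E^c$, and by the null events. A wealth process of $\pi$ is an $\bar{\mathcal F}$-adapted process $X^\pi$ on $[0,T]$ with almost surely càdlàg paths solving $X^\pi_0=x_0^\tau$, $$\frac{dX^\pi_t}{X^\pi_{t-}}=\big(r^\tau+\pi^\tau(0)(\kappa^\tau-r^\tau)\big)dt+\sigma^\tau\pi^\tau(0)\,dW_t+\sigma^{0\tau}\pi^\tau(0)\,dW^0_t+\int_E\eta^\tau(e)\,\pi^\tau(\zeta^\tau(e))\,N(dt,de).$$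 *Many investors.* On a probability space let $t^0,t^1,\dots$ be i.i.d. types with law $\mathbb T$, let $W^0$ and $\hat W^0,\hat W^1,\dots$ be standard Brownian motions, $W^0$ being common and $\hat W^j$ idiosyncratic to investor $j$, and let $N$ be a Poisson random measure on $[0,\infty)\times E^c\times(E^i)^{\mathbb N}$ with intensity $dt\otimes\lambda\big(\nu^c\otimes\bigotimes_{j\in\mathbb N}\nu^i\big)$, all independent. Investor $j$ uses $\pi^{t^j}$. Her wealth $X^j$ solves the same equation on $[0,T]$ with type $t^j$, with Brownian motions $\hat W^j,W^0$, and with jump and signal maps $\eta^{t^j}(e^c,e^{i,j})$ and $\zeta^{t^j}(e^c,e^{i,j})$. It is adapted to the filtration generated by all types at time $0$, all the drivers and the null events. For $n\ge i$ put $\bar X^{-i,n}_t=\prod_{j\le n,\,j\ne i}(X^j_t)^{1/n}$. **Lemma.** Let $\pi$ be an admissible signal-driven strategy. Then $r^t+\pi^t(0)(\kappa^t-r^t)-\frac12\big((\sigma^t)^2+(\sigma^{0t})^2\big)(\pi^t(0))^2$ and $\sigma^{0t}\pi^t(0)$ are $\mathbb T$-integrable, and, for $\nu^c$-a.e. $e^c$,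 the function $\log\big(1+\pi^t(\zeta^t(e^c,e^i))\eta^t(e^c,e^i)\big)$ is $\mathbb T\otimes\nu^i$-integrable. Put $$\bar x_0=\exp\int\log x_0^t\,\mathbb T(dt),\qquad \overline{\sigma^0\pi}=\int\sigma^{0t}\pi^t(0)\,\mathbb T(dt),$$ $$\overline{\tau\pi}=\int\Big(r^t+\pi^t(0)(\kappa^t-r^t)-\tfrac12\big((\sigma^t)^2+(\sigma^{0t})^2\big)(\pi^t(0))^2\Big)\mathbb T(dt),$$ $$\overline{1+(\pi\circ\zeta)\eta}(e^c)=\exp\int_{\mathbf T\times E^i}\log\big(1+\pi^t(\zeta^t(e^c,e^i))\eta^t(e^c,e^i)\big)\,(\mathbb T\otimes\nu^i)(dt,de^i).$$ 1. For every wealth process $X^\pi$ of $\pi$ and every $t\in[0,T]$, almost surely $X^\pi_t>0$, $\log X^\pi_t$ is $\bar{\mathbb P}$-integrable, and almost surely $$\exp\bar{\mathbb E}\big[\log X^\pi_t\,\big|\,\mathcal F^0_T\big]=\bar x_0\exp\Big\{\overline{\tau\pi}\,t+\overline{\sigma^0\pi}\,W^0_t+\int_{[0,t]\times E^c}\log\big(\overline{1+(\pi\circ\zeta)\eta}(e^c)\big)\,N(ds,de^c,E^i)\Big\}.$$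 2. This coincides with the large population limit: in the setting with many investors, for every $i$ and every $t\in[0,T]$, almost surely, $\bar X^{-i,n}_t$ converges as $n\to\infty$ to the right-hand side of the same formula, evaluated at the common noise $W^0$ and $N(ds,de^c,(E^i)^{\mathbb N})$ of that setting. -/

import Mathlib

open MeasureTheory ProbabilityTheory Filter Topology Set
open scoped NNReal ENNReal

noncomputable section

namespace MeanFieldJumpSignals

/-! ### Driving noise -/

/-- Lebesgue measure `dt` on the time axis `[0,∞)`. -/
def timeMeasure : Measure ℝ≥0 :=
  Measure.comap (fun t : ℝ≥0 => (t : ℝ)) volume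

/-- `N` is a Poisson random measure on `S` with intensity measure `m`: a random countable sum of
point masses, Poisson distributed on sets of finite intensity and independent on disjoint sets. -/
structure IsPoissonRandomMeasure {Ω S : Type*} [MeasurableSpace Ω] [MeasurableSpace S]
    (P : Measure Ω) (m : Measure S) (N : Ω → Measure S) : Prop where
  measurable : Measurable N
  point_process : ∀ᵐ ω ∂P, ∃ (I : Set ℕ) (p : ℕ → S),
    N ω = Measure.sum (fun k : I => Measure.dirac (p k))
  law : ∀ A : Set S, MeasurableSet A → m A < ∞ →
    P.map (fun ω => N ω A) = (poissonMeasure (m A).toNNReal).map (fun n : ℕ => (n : ℝ≥0∞))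
  indep : ∀ (k : ℕ) (A : Fin k → Set S), (∀ i, MeasurableSet (A i)) →
    Pairwise (fun i j => Disjoint (A i) (A j)) → iIndepFun (fun i ω => N ω (A i)) P

/-- A standard Brownian motion all of whose time marginals are measurable. -/
structure IsBM {Ω : Type*} [MeasurableSpace Ω] (P : Measure Ω) (B : ℝ≥0 → Ω → ℝ) : Prop where
  measurable : ∀ t, Measurable (B t)
  brownian : IsBrownianReal B P

/-- The `σ`-field generated by a whole real-valued process. -/
@[reducible]
def processSigma {Ω : Type*} (B : ℝ≥0 → Ω → ℝ) : MeasurableSpace Ω :=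
  MeasurableSpace.comap (fun ω t => B t ω) inferInstance

/-- The `σ`-field generated by a whole random measure. -/
@[reducible]
def randomMeasureSigma {Ω S : Type*} [MeasurableSpace S] (N : Ω → Measure S) :
    MeasurableSpace Ω :=
  MeasurableSpace.comap N inferInstance

/-- The `σ`-field generated by the negligible events of `P`. -/
@[reducible]
def nullSigma {Ω : Type*} [MeasurableSpace Ω] (P : Measure Ω) : MeasurableSpace Ω :=
  MeasurableSpace.generateFrom {A | MeasurableSet A ∧ P A = 0}

/-- The information at time `t`: initial information `G`, the processes `B i` up to time `t`, the
counts `N ([0,s] × A)` for `s ≤ t` and measurable `A`, and the `P`-negligible events. -/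
@[reducible]
def informationAt {Ω S ι : Type*} (G : MeasurableSpace Ω) [MeasurableSpace Ω] [MeasurableSpace S]
    (P : Measure Ω) (B : ι → ℝ≥0 → Ω → ℝ) (N : Ω → Measure (ℝ≥0 × S)) (t : ℝ≥0) :
    MeasurableSpace Ω :=
  G ⊔ (⨆ i, ⨆ s : Iic t, MeasurableSpace.comap (B i s) inferInstance)
    ⊔ (⨆ s : Iic t, ⨆ A : {A : Set S // MeasurableSet A},
        MeasurableSpace.comap (fun ω => N ω (Iic (s : ℝ≥0) ×ˢ (A : Set S))) inferInstance)
    ⊔ nullSigma P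

/-- Common part `N(ds, deᶜ, Eⁱ)` of a random measure on `[0,∞) × (Eᶜ × Eⁱ)`. -/
def commonPart {Ω Ec Ei : Type*} [MeasurableSpace Ec] [MeasurableSpace Ei]
    (N : Ω → Measure (ℝ≥0 × (Ec × Ei))) (ω : Ω) : Measure (ℝ≥0 × Ec) :=
  (N ω).map (fun p => (p.1, p.2.1))

/-! ### Itô integral with respect to a Brownian motion -/

/-- A simple process `∑_{i<n} ξᵢ 1_{(tᵢ, tᵢ₊₁]}` with `ξᵢ` known at time `tᵢ`. -/
structure SimpleProcess {Ω : Type*} (F : ℝ≥0 → MeasurableSpace Ω) where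
  n : ℕ
  time : ℕ → ℝ≥0
  mono : Monotone time
  coef : ℕ → Ω → ℝ
  measurable_coef : ∀ i, Measurable[F (time i)] (coef i)

def SimpleProcess.value {Ω : Type*} {F : ℝ≥0 → MeasurableSpace Ω} (H : SimpleProcess F)
    (s : ℝ≥0) (ω : Ω) : ℝ :=
  ∑ i ∈ Finset.range H.n,
    (Ioc (H.time i) (H.time (i + 1))).indicator (fun _ => H.coef i ω) s

def SimpleProcess.integral {Ω : Type*} {F : ℝ≥0 → MeasurableSpace Ω} (H : SimpleProcess F)
    (B : ℝ≥0 → Ω → ℝ) (t : ℝ≥0) (ω : Ω) : ℝ :=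
  ∑ i ∈ Finset.range H.n,
    H.coef i ω * (B (min (H.time (i + 1)) t) ω - B (min (H.time i) t) ω)

/-- `∫₀ᵀ |Hⁿ - H|² ds → 0` in probability. -/
def ApproximatesInL2 {Ω : Type*} [MeasurableSpace Ω] (P : Measure Ω)
    {F : ℝ≥0 → MeasurableSpace Ω} (T : ℝ≥0) (Hn : ℕ → SimpleProcess F) (H : ℝ≥0 → Ω → ℝ) : Prop :=
  ∀ ε : ℝ≥0∞, 0 < ε → Tendsto (fun n => P {ω | ε ≤
    ∫⁻ s in Iic T, ENNReal.ofReal (((Hn n).value s ω - H s ω) ^ 2) ∂timeMeasure}) atTop (𝓝 0)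

/-- `I` is the Itô integral process `∫₀ᵗ H dB`, `t ∈ [0,T]`: the integrand is approximated by simple
processes, and the integrals of every approximating sequence of simple processes converge to `I`
uniformly on `[0,T]` in probability. -/
structure IsItoIntegral {Ω : Type*} [MeasurableSpace Ω] (P : Measure Ω)
    (F : ℝ≥0 → MeasurableSpace Ω) (T : ℝ≥0) (H : ℝ≥0 → Ω → ℝ) (B : ℝ≥0 → Ω → ℝ)
    (I : ℝ≥0 → Ω → ℝ) : Prop where
  exists_approx : ∃ Hn : ℕ → SimpleProcess F, ApproximatesInL2 P T Hn H
  tendsto : ∀ Hn : ℕ → SimpleProcess F, ApproximatesInL2 P T Hn H →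
    ∀ ε : ℝ, 0 < ε → Tendsto (fun n => P {ω | ∃ t ≤ T, ε ≤ |(Hn n).integral B t ω - I t ω|})
      atTop (𝓝 0)

/-! ### Wealth dynamics -/

/-- Left limit `X_{s-}` of a path (with `X_{0-} = X_0`). -/
def leftValue {Ω : Type*} (X : ℝ≥0 → Ω → ℝ) (s : ℝ≥0) (ω : Ω) : ℝ :=
  Function.leftLim (fun u => X u ω) s

/-- `X` solves on `[0,T]` the wealth equation with `X_0 = x₀` and
`dX / X₋ = (r + φ(0)(κ - r)) dt + σ φ(0) dW + σ₀ φ(0) dW⁰ + ∫ η(e) φ(ζ(e)) N(dt,de)`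
for a signal-driven position `φ`; the parameters may depend on the scenario. -/
structure IsWealthProcess {Ω E : Type*} [MeasurableSpace Ω] [MeasurableSpace E] (P : Measure Ω)
    (F : ℝ≥0 → MeasurableSpace Ω) (T : ℝ≥0) (W W₀ : ℝ≥0 → Ω → ℝ) (N : Ω → Measure (ℝ≥0 × E))
    (x₀ r κ σ σ₀ : Ω → ℝ) (η ζ : Ω → E → ℝ) (φ : Ω → ℝ → ℝ) (X : ℝ≥0 → Ω → ℝ) : Prop where
  adapted : ∀ t ≤ T, Measurable[F t] (X t)
  cadlag : ∀ᵐ ω ∂P, ∀ t ≤ T,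
    (t < T → ContinuousWithinAt (fun u => X u ω) (Ici t) t) ∧
      ∃ l : ℝ, Tendsto (fun u => X u ω) (𝓝[<] t) (𝓝 l)
  dynamics : ∃ I I₀ : ℝ≥0 → Ω → ℝ,
    IsItoIntegral P F T (fun s ω => leftValue X s ω * (σ ω * φ ω 0)) W I ∧
    IsItoIntegral P F T (fun s ω => leftValue X s ω * (σ₀ ω * φ ω 0)) W₀ I₀ ∧
    ∀ᵐ ω ∂P, ∀ t ≤ T,
      X t ω = x₀ ω
        + (∫ s in Iic t, leftValue X s ω * (r ω + φ ω 0 * (κ ω - r ω)) ∂timeMeasure)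
        + I t ω + I₀ t ω
        + ∫ p in Iic t ×ˢ univ, leftValue X p.1 ω * (η ω p.2 * φ ω (ζ ω p.2)) ∂(N ω)

/-! ### Investor types -/

/-- Type vectors `(x₀, r, κ, σ, σ⁰, η, ζ, α, θ)`. -/
structure InvestorType (E : Type*) [MeasurableSpace E] where
  x₀ : ℝ
  r : ℝ
  κ : ℝ
  σ : ℝ
  σ₀ : ℝ
  η : E → ℝ
  ζ : E → ℝ
  α : ℝ
  θ : ℝ
  x₀_pos : 0 < x₀
  σ_nonneg : 0 ≤ σ
  σ₀_nonneg : 0 ≤ σ₀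
  measurable_η : Measurable η
  measurable_ζ : Measurable ζ
  α_pos : 0 < α
  α_ne_one : α ≠ 1
  θ_mem : θ ∈ Icc (0 : ℝ) 1

/-- The `σ`-field on the set `Ty` of types makes all components measurable, the jump and signal maps
being jointly measurable in the type and the mark. -/
structure MeasurableTypes {E : Type*} [MeasurableSpace E] (Ty : Set (InvestorType E))
    [MeasurableSpace Ty] : Prop where
  x₀ : Measurable (fun t : Ty => t.1.x₀)
  r : Measurable (fun t : Ty => t.1.r)
  κ : Measurable (fun t : Ty => t.1.κ)
  σ : Measurable (fun t : Ty => t.1.σ)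
  σ₀ : Measurable (fun t : Ty => t.1.σ₀)
  η : Measurable (fun p : Ty × E => p.1.1.η p.2)
  ζ : Measurable (fun p : Ty × E => p.1.1.ζ p.2)
  α : Measurable (fun t : Ty => t.1.α)
  θ : Measurable (fun t : Ty => t.1.θ)

/-- Only finitely many distinct types can occur. -/
def FinitelyManyTypes {E : Type*} [MeasurableSpace E] {Ty : Set (InvestorType E)}
    [MeasurableSpace Ty] (TT : Measure Ty) : Prop :=
  ∃ S : Set Ty, S.Finite ∧ ∀ᵐ t ∂TT, t ∈ S

/-- Distribution of the mark given the signal `z`: for `z ≠ 0` the conditional distribution of `ν`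
given `ζ = z` (the disintegration kernel for a signal with finitely many values), for `z = 0` the
measure `ν` restricted to the unsignaled jumps. -/
def markLaw {E : Type*} [MeasurableSpace E] (ν : Measure E) (t : InvestorType E) (z : ℝ) :
    Measure E :=
  open Classical in
  if z = 0 then ν.restrict {e | t.ζ e = 0 ∧ t.η e ≠ 0} else ProbabilityTheory.cond ν {e | t.ζ e = z}

/-- Tight lower jump bound given the signal `z`. -/
def lowerJump {E : Type*} [MeasurableSpace E] (ν : Measure E) (t : InvestorType E) (z : ℝ) :
    EReal :=
  essInf (fun e => (t.η e : EReal)) (markLaw ν t z)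

/-- Tight upper jump bound given the signal `z`. -/
def upperJump {E : Type*} [MeasurableSpace E] (ν : Measure E) (t : InvestorType E) (z : ℝ) :
    EReal :=
  essSup (fun e => (t.η e : EReal)) (markLaw ν t z)

/-- The signal frequency `μ = ν ∘ ζ⁻¹`. -/
def signalLaw {E : Type*} [MeasurableSpace E] (ν : Measure E) (t : InvestorType E) : Measure ℝ :=
  ν.map t.ζ

/-- The standing assumptions on the distribution `TT` of types. -/
structure StandingAssumption {E : Type*} [MeasurableSpace E] (ν : Measure E)
    {Ty : Set (InvestorType E)} [MeasurableSpace Ty] (TT : Measure Ty) : Prop where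
  nonneg_price : ∀ᵐ t ∂TT, ν {e | t.1.η e < -1} = 0
  no_arbitrage : ∀ᵐ t ∂TT, ∀ᵐ z ∂(signalLaw ν t.1), z ≠ 0 →
    lowerJump ν t.1 z < 0 ∧ 0 < upperJump ν t.1 z
  finite_signals : ∀ᵐ t ∂TT, (range t.1.ζ).Finite
  bounded_parameters : ∃ C : ℝ, ∀ᵐ t ∂TT, |t.1.r| + |t.1.κ| + t.1.σ + t.1.σ₀ + t.1.α ≤ C
  integrable_log_x₀ : Integrable (fun t : Ty => Real.log t.1.x₀) TT
  jump_bounds : ∃ c₀ : ℝ, 0 < c₀ ∧ ∀ᵐ t ∂TT,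
    ((c₀ : EReal) ≤ upperJump ν t.1 0 ∧ lowerJump ν t.1 0 ≤ ((-c₀ : ℝ) : EReal)) ∧
    ∀ᵐ z ∂(signalLaw ν t.1),
      (c₀ : EReal) ≤ upperJump ν t.1 z ∧ lowerJump ν t.1 z ≤ ((-c₀ : ℝ) : EReal)
  moments : FinitelyManyTypes TT → ∀ᵐ t ∂TT, ∀ p : ℝ, 0 < p →
    Integrable (fun e => (1 + t.1.η e) ^ p) ν
  bounded_jumps : ¬ FinitelyManyTypes TT → ∃ C : ℝ, ∀ᵐ p ∂(TT.prod ν), p.1.1.η p.2 ≤ C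

/-! ### Admissible signal-driven strategies -/

/-- The safety margins `a, b` in the position bounds: they may depend on the type when only finitely
many types can occur and are constants otherwise. -/
structure SafetyMargins {E : Type*} [MeasurableSpace E] {Ty : Set (InvestorType E)}
    [MeasurableSpace Ty] (TT : Measure Ty) (a b : Ty → ℝ) : Prop where
  measurable_a : Measurable a
  measurable_b : Measurable b
  a_mem : ∀ t, a t ∈ Ioc (0 : ℝ) 1
  b_mem : ∀ t, b t ∈ Ioc (0 : ℝ) 1
  const : ¬ FinitelyManyTypes TT → ∃ a₀ b₀ : ℝ, ∀ t, a t = a₀ ∧ b t = b₀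

/-- The interval `[-(1-a)/η̄(z), -(1-b)/η̲(z)]` (with `1/∞ = 0`). -/
def positions {E : Type*} [MeasurableSpace E] (ν : Measure E) (t : InvestorType E) (a b z : ℝ) :
    Set ℝ :=
  {x | -(((1 - a : ℝ) : EReal) / upperJump ν t z) ≤ (x : EReal) ∧
    (x : EReal) ≤ -(((1 - b : ℝ) : EReal) / lowerJump ν t z)}

/-- `π` is an admissible signal-driven strategy: jointly measurable in type and signal, with
position `π t z` in the prescribed interval for the default signal `0` and every other possible
signal. -/
structure AdmissibleSignalDriven {E : Type*} [MeasurableSpace E] (ν : Measure E)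
    {Ty : Set (InvestorType E)} [MeasurableSpace Ty] (TT : Measure Ty) (a b : Ty → ℝ)
    (π : Ty → ℝ → ℝ) : Prop where
  measurable : Measurable (fun p : Ty × ℝ => π p.1 p.2)
  mem_positions : ∀ᵐ t ∂TT, π t 0 ∈ positions ν t.1 (a t) (b t) 0 ∧
    ∀ᵐ z ∂(signalLaw ν t.1), π t z ∈ positions ν t.1 (a t) (b t) z

/-! ### The closed form of the mean wealth -/

section ClosedForm

variable {Ec Ei : Type*} [MeasurableSpace Ec] [MeasurableSpace Ei]
  {Ty : Set (InvestorType (Ec × Ei))} [MeasurableSpace Ty]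

/-- `λ (νᶜ ⊗ νⁱ)`. -/
def jumpIntensity {A B : Type*} [MeasurableSpace A] [MeasurableSpace B] (lam : ℝ≥0)
    (νc : Measure A) (νi : Measure B) : Measure (A × B) :=
  lam • νc.prod νi

/-- Geometric mean `x̄₀` of the initial wealth. -/
def meanInitialWealth (TT : Measure Ty) : ℝ :=
  Real.exp (∫ t, Real.log t.1.x₀ ∂TT)

/-- Logarithmic drift of an investor of type `t`. -/
def logDrift (π : Ty → ℝ → ℝ) (t : Ty) : ℝ :=
  t.1.r + π t 0 * (t.1.κ - t.1.r) - 1 / 2 * (t.1.σ ^ 2 + t.1.σ₀ ^ 2) * (π t 0) ^ 2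

/-- Logarithmic return of an investor of type `t` from a jump with mark `e`. -/
def logJump (π : Ty → ℝ → ℝ) (t : Ty) (e : Ec × Ei) : ℝ :=
  Real.log (1 + π t (t.1.ζ e) * t.1.η e)

/-- Geometric mean of the gross jump returns for a common mark `eᶜ`. -/
def meanJump (TT : Measure Ty) (νi : Measure Ei) (π : Ty → ℝ → ℝ) (ec : Ec) : ℝ :=
  Real.exp (∫ p : Ty × Ei, logJump π p.1 (ec, p.2) ∂(TT.prod νi))

/-- The mean wealth at time `t` as a function of the value `w` of the common Brownian motion
at `t` and the common part `Nc` of the jump measure. -/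
def meanWealth (TT : Measure Ty) (νi : Measure Ei) (π : Ty → ℝ → ℝ) (t : ℝ≥0) (w : ℝ)
    (Nc : Measure (ℝ≥0 × Ec)) : ℝ :=
  meanInitialWealth TT * Real.exp
    ((∫ u, logDrift π u ∂TT) * t + (∫ u : Ty, u.1.σ₀ * π u 0 ∂TT) * w
      + ∫ p in Iic t ×ˢ univ, Real.log (meanJump TT νi π p.2) ∂Nc)

end ClosedForm

/-! ### The mean field setting -/

/-- Independent drivers `W`, `W⁰` and `N` on the original probability space. -/
structure IsNoise {Ω E : Type*} [MeasurableSpace Ω] [MeasurableSpace E] (P : Measure Ω)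
    (ν : Measure E) (W W₀ : ℝ≥0 → Ω → ℝ) (N : Ω → Measure (ℝ≥0 × E)) : Prop where
  bm : IsBM P W
  bm₀ : IsBM P W₀
  poisson : IsPoissonRandomMeasure P (timeMeasure.prod ν) N
  indep : iIndep ![processSigma W, processSigma W₀, randomMeasureSigma N] P

section MeanField

variable {Ω Ec Ei : Type*} [MeasurableSpace Ω] [MeasurableSpace Ec] [MeasurableSpace Ei]
  {Ty : Set (InvestorType (Ec × Ei))} [MeasurableSpace Ty]

/-- The full information of the representative investor on `Ty × Ω`. -/
@[reducible]
def fullInfo (TT : Measure Ty) (P : Measure Ω) (W W₀ : ℝ≥0 → Ω → ℝ)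
    (N : Ω → Measure (ℝ≥0 × (Ec × Ei))) : ℝ≥0 → MeasurableSpace (Ty × Ω) :=
  informationAt (MeasurableSpace.comap Prod.fst inferInstance) (TT.prod P)
    (fun (i : Fin 2) s ω => (![W, W₀] i) s ω.2) (fun ω => N ω.2)

/-- The common noise filtration on `Ty × Ω`. -/
@[reducible]
def commonInfo (TT : Measure Ty) (P : Measure Ω) (W₀ : ℝ≥0 → Ω → ℝ)
    (N : Ω → Measure (ℝ≥0 × (Ec × Ei))) : ℝ≥0 → MeasurableSpace (Ty × Ω) :=
  informationAt ⊥ (TT.prod P) (fun (_ : Unit) s ω => W₀ s ω.2) (fun ω => commonPart N ω.2)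

/-- `X` is the wealth process on `Ty × Ω` of the representative investor using `π`. -/
def IsRepresentativeWealth (TT : Measure Ty) (P : Measure Ω) (T : ℝ≥0) (W W₀ : ℝ≥0 → Ω → ℝ)
    (N : Ω → Measure (ℝ≥0 × (Ec × Ei))) (π : Ty → ℝ → ℝ) (X : ℝ≥0 → Ty × Ω → ℝ) : Prop :=
  IsWealthProcess (TT.prod P) (fullInfo TT P W W₀ N) T (fun s ω => W s ω.2) (fun s ω => W₀ s ω.2)
    (fun ω => N ω.2) (fun ω => ω.1.1.x₀) (fun ω => ω.1.1.r) (fun ω => ω.1.1.κ) (fun ω => ω.1.1.σ)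
    (fun ω => ω.1.1.σ₀) (fun ω => ω.1.1.η) (fun ω => ω.1.1.ζ) (fun ω => π ω.1) X

end MeanField

/-! ### The multi-agent setting with i.i.d. types -/

section MultiAgent

variable {Ω Ec Ei : Type*} [MeasurableSpace Ω] [MeasurableSpace Ec] [MeasurableSpace Ei]
  {Ty : Set (InvestorType (Ec × Ei))} [MeasurableSpace Ty]

/-- Noise of infinitely many investors: i.i.d. types `τ j` with law `TT`, idiosyncratic Brownian
motions `W j`, a common Brownian motion `W₀`, and a Poisson random measure with marks
`(eᶜ, (eⁱ_j)_j)` and intensity `λ (νᶜ ⊗ ⨂_j νⁱ)`; all of them independent. -/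
structure IsPopulationNoise (P : Measure Ω) (lam : ℝ≥0) (νc : Measure Ec) (νi : Measure Ei)
    (TT : Measure Ty) (τ : ℕ → Ω → Ty) (W : ℕ → ℝ≥0 → Ω → ℝ) (W₀ : ℝ≥0 → Ω → ℝ)
    (N : Ω → Measure (ℝ≥0 × (Ec × (ℕ → Ei)))) : Prop where
  measurable_type : ∀ j, Measurable (τ j)
  law_type : ∀ j, P.map (τ j) = TT
  indep_type : iIndepFun τ P
  bm : ∀ j, IsBM P (W j)
  indep_bm : iIndep (fun j => processSigma (W j)) P
  bm₀ : IsBM P W₀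
  poisson : IsPoissonRandomMeasure P (timeMeasure.prod
    (jumpIntensity lam νc (Measure.infinitePi (fun _ : ℕ => νi)))) N
  indep : iIndep ![⨆ j, MeasurableSpace.comap (τ j) inferInstance, ⨆ j, processSigma (W j),
    processSigma W₀, randomMeasureSigma N] P

/-- The information in the multi-agent setting: all types are known from the start. -/
@[reducible]
def populationInfo (P : Measure Ω) (τ : ℕ → Ω → Ty) (W : ℕ → ℝ≥0 → Ω → ℝ) (W₀ : ℝ≥0 → Ω → ℝ)
    (N : Ω → Measure (ℝ≥0 × (Ec × (ℕ → Ei)))) : ℝ≥0 → MeasurableSpace Ω :=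
  informationAt (⨆ j, MeasurableSpace.comap (τ j) inferInstance) P
    (fun i : Option ℕ => i.elim W₀ W) N

/-- `X` is the wealth process of investor `j`, who uses the strategy `π` of her type and is affected
by a mark `(eᶜ, (eⁱ_k)_k)` only through `(eᶜ, eⁱ_j)`. -/
def IsInvestorWealth (P : Measure Ω) (T : ℝ≥0) (τ : ℕ → Ω → Ty) (W : ℕ → ℝ≥0 → Ω → ℝ)
    (W₀ : ℝ≥0 → Ω → ℝ) (N : Ω → Measure (ℝ≥0 × (Ec × (ℕ → Ei)))) (π : Ty → ℝ → ℝ) (j : ℕ)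
    (X : ℝ≥0 → Ω → ℝ) : Prop :=
  IsWealthProcess P (populationInfo P τ W W₀ N) T (W j) W₀ N
    (fun ω => (τ j ω).1.x₀) (fun ω => (τ j ω).1.r) (fun ω => (τ j ω).1.κ) (fun ω => (τ j ω).1.σ)
    (fun ω => (τ j ω).1.σ₀) (fun ω e => (τ j ω).1.η (e.1, e.2 j))
    (fun ω e => (τ j ω).1.ζ (e.1, e.2 j)) (fun ω => π (τ j ω)) X

/-- Geometric average at time `t` of the wealth of the `n` peers of investor `i` among the
investors `0, …, n` (for `i ≤ n`). -/
def peerAverage (X : ℕ → ℝ≥0 → Ω → ℝ) (i n : ℕ) (t : ℝ≥0) (ω : Ω) : ℝ :=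
  (∏ j ∈ (Finset.range (n + 1)).erase i, X j t ω) ^ ((1 : ℝ) / n)

end MultiAgent

end MeanFieldJumpSignals

end

/-! The wealth equation is linear, so a wealth process must be a stochastic exponential: almost
surely, for all `t ≤ T`, `log X_t` is `log x₀`, plus the logarithmic drift times `t`, plus `σ π(0)
W_t + σ⁰ π(0) W⁰_t`, plus the sum of `log (1 + π(ζ) η)` over the jumps up to `t`
(`IsWealthProcess.log_eq`). In the mean field each summand is averaged conditionally on the common
noise; in the population each is averaged by the law of large numbers. The two averages agree.

Explicit solution. Instead of Itô's formula, an Euler scheme on dyadic grids is used. Let `M = A t +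
B W + B₀ W⁰`, with coefficients known at time `0`, and `c = B² + B₀²`. Squared increments of `M` sum
up to `c t`, so the Euler products `E` of `1 + ΔM` tend to `exp (M - c t / 2)`
(`eulerProd_log_tendsto`). Dividing the Riemann-sum approximation of the path by `E`
(`div_euler_eq`) leaves the discounted jumps and two error sums, in which `δ / E` is multiplied by
`ΔM` or by a term of order `ΔM²`; here `δ` is the uniformly small gap between the stochastic
integrals and their Riemann sums. The quadratic sum vanishes because the sums of squares stay
bounded. The linear one cannot be bounded path by path, since `M` in general has infinite variation.
It vanishes because an adapted version of `δ / E`, added to the integrand, yields another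
approximating sequence of the same Itô integral. In the limit the discounted path is `x₀` plus its
discounted jumps, and induction over the finitely many jumps turns this into a product
(`prod_formula`). Admissibility keeps `1 + π(ζ) η` above `min a b > 0`, whence positivity.

Conditional mean. Up to null events, an event of the common information is described by the path of
`W⁰` and the common part of `N`. On such an event `W` integrates to zero by independence. For the
jumps, Mecke's formula shows that the mean of a sum of `f` over the points, on an event determined
by a projection of the points, depends on `f` only through the projected density
(`IsPoissonRandomMeasure.setLIntegral_congr`). Hence `f` may be replaced by its average over the
idiosyncratic mark.

Population. The pairs of type and idiosyncratic Brownian value obey a strong law. For almost every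
common mark the logarithmic jump returns do too, under i.i.d. types and idiosyncratic marks. The
exceptional set of type sequences and marks is null; as the types are independent of `N`, almost
surely no point of `N` falls into it (`IsPoissonRandomMeasure.ae_null_of_indepFun`), and only
finitely many points matter up to `T`. -/

namespace MeanFieldJumpSignals

/-! ### Dyadic grids -/

/-- The `j`-th point of the dyadic grid of level `n` on `[0,T]`. -/
noncomputable def grid (T : ℝ≥0) (n j : ℕ) : ℝ≥0 := T * j / 2 ^ n

/-- Increment of a path over the `i`-th cell of the dyadic grid of level `n`. -/
noncomputable def incr (M : ℝ≥0 → ℝ) (T : ℝ≥0) (n i : ℕ) : ℝ :=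
  M (grid T n (i + 1)) - M (grid T n i)

/-- Sum of squared increments over the first `j` cells. -/
noncomputable def sqSum (M : ℝ≥0 → ℝ) (T : ℝ≥0) (n j : ℕ) : ℝ :=
  ∑ i ∈ Finset.range j, incr M T n i ^ 2

/-- Euler scheme of `dE = E dM`, `E₀ = 1`. -/
noncomputable def eulerProd (M : ℝ≥0 → ℝ) (T : ℝ≥0) (n j : ℕ) : ℝ :=
  ∏ i ∈ Finset.range j, (1 + incr M T n i)

/-- Left-point Riemann sum of `∫ x dM` over the first `j` cells. -/
noncomputable def riemannSum (x M : ℝ≥0 → ℝ) (T : ℝ≥0) (n j : ℕ) : ℝ :=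
  ∑ i ∈ Finset.range j, x (grid T n i) * incr M T n i

theorem coe_grid (T : ℝ≥0) (n j : ℕ) : ((grid T n j : ℝ≥0) : ℝ) = T * j / 2 ^ n := by
  simp [grid]

@[simp] theorem grid_zero (T : ℝ≥0) (n : ℕ) : grid T n 0 = 0 := by simp [grid]

theorem grid_top (T : ℝ≥0) (n : ℕ) : grid T n (2 ^ n) = T := by
  simp [grid]

theorem grid_mono (T : ℝ≥0) (n : ℕ) : Monotone (grid T n) := by
  intro i j hij
  unfold grid
  gcongr

theorem grid_le (T : ℝ≥0) {n j : ℕ} (hj : j ≤ 2 ^ n) : grid T n j ≤ T :=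
  (grid_mono T n hj).trans (grid_top T n).le

theorem coe_grid_succ (T : ℝ≥0) (n j : ℕ) :
    ((grid T n (j + 1) : ℝ≥0) : ℝ) = grid T n j + T / 2 ^ n := by
  simp only [coe_grid]; push_cast; ring

theorem grid_refine (T : ℝ≥0) (m n k : ℕ) : grid T (m + n) (k * 2 ^ n) = grid T m k := by
  apply NNReal.coe_injective
  simp only [coe_grid]
  push_cast
  rw [pow_add]
  field_simp

theorem tendsto_mesh (T : ℝ≥0) : Tendsto (fun n : ℕ => (T : ℝ) / 2 ^ n) atTop (𝓝 0) := by
  have h : Tendsto (fun n : ℕ => (T : ℝ) * (1 / 2 : ℝ) ^ n) atTop (𝓝 ((T : ℝ) * 0)) :=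
    (tendsto_pow_atTop_nhds_zero_of_lt_one (by norm_num) (by norm_num)).const_mul _
  simpa [div_eq_mul_inv] using h

/-- Left-open cells match the intervals of a simple process; their left end points approach `s`
strictly from below and so detect left limits. -/
theorem exists_grid_Ioc {T : ℝ≥0} {s : ℝ≥0} (hs : 0 < s) (hsT : s ≤ T) (n : ℕ) :
    ∃ i < 2 ^ n, grid T n i < s ∧ s ≤ grid T n (i + 1) := by
  have hex : ∃ j, s ≤ grid T n (j + 1) := by
    refine ⟨2 ^ n, hsT.trans ?_⟩
    exact (grid_top T n).symm.le.trans (grid_mono T n (Nat.le_succ _))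
  classical
  refine ⟨Nat.find hex, ?_, ?_, Nat.find_spec hex⟩
  · by_contra hlt
    have h1 : 2 ^ n - 1 < Nat.find hex := by
      have := Nat.one_le_two_pow (n := n); omega
    refine Nat.find_min hex h1 ?_
    rw [Nat.sub_add_cancel Nat.one_le_two_pow, grid_top]
    exact hsT
  · rcases Nat.eq_zero_or_pos (Nat.find hex) with h0 | h0
    · rw [h0]; simpa using hs
    · have := Nat.find_min hex (Nat.sub_lt h0 one_pos)
      rw [Nat.sub_add_cancel (show 1 ≤ Nat.find hex from h0)] at this
      exact not_le.1 this

/-- With right-open cells the right end points lie strictly above `s` and approach it, as an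
argument by right-continuity requires. -/
theorem exists_grid_Ico {T : ℝ≥0} {s : ℝ≥0} (hsT : s < T) (n : ℕ) :
    ∃ i < 2 ^ n, grid T n i ≤ s ∧ s < grid T n (i + 1) := by
  have hex : ∃ j, s < grid T n (j + 1) := by
    refine ⟨2 ^ n, hsT.trans_le ?_⟩
    exact (grid_top T n).symm.le.trans (grid_mono T n (Nat.le_succ _))
  classical
  refine ⟨Nat.find hex, ?_, ?_, Nat.find_spec hex⟩
  · by_contra hlt
    have h1 : 2 ^ n - 1 < Nat.find hex := by
      have := Nat.one_le_two_pow (n := n); omega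
    refine Nat.find_min hex h1 ?_
    rw [Nat.sub_add_cancel Nat.one_le_two_pow, grid_top]
    exact hsT
  · rcases Nat.eq_zero_or_pos (Nat.find hex) with h0 | h0
    · rw [h0]; simp
    · have := Nat.find_min hex (Nat.sub_lt h0 one_pos)
      rw [Nat.sub_add_cancel (show 1 ≤ Nat.find hex from h0)] at this
      exact not_lt.1 this

theorem grid_cell_unique {T : ℝ≥0} {s : ℝ≥0} {n i j : ℕ}
    (hi : grid T n i < s) (hi' : s ≤ grid T n (i + 1))
    (hj : grid T n j < s) (hj' : s ≤ grid T n (j + 1)) : i = j := by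
  by_contra hne
  rcases lt_or_gt_of_ne hne with h | h
  · exact absurd (hi'.trans (grid_mono T n h)) (not_le.2 hj)
  · exact absurd (hj'.trans (grid_mono T n h)) (not_le.2 hi)

/-! ### Convergence of the Euler scheme -/

/-- The squared increments of `M` along the dyadic grids sum up to `c` times the elapsed time. -/
def HasDyadicQV (M : ℝ≥0 → ℝ) (T : ℝ≥0) (c : ℝ) : Prop :=
  ∀ m k, k ≤ 2 ^ m →
    Tendsto (fun n => sqSum M T (m + n) (k * 2 ^ n)) atTop (𝓝 (c * grid T m k))

theorem sqSum_mono (M : ℝ≥0 → ℝ) (T : ℝ≥0) (n : ℕ) : Monotone (sqSum M T n) := by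
  intro i j hij
  exact Finset.sum_le_sum_of_subset_of_nonneg (Finset.range_mono hij) fun _ _ _ => sq_nonneg _

/-- Monotone functions converging at the points of a grid to a continuous limit converge uniformly:
a fine index is squeezed between two neighbouring points of a coarse grid. -/
theorem HasDyadicQV.uniform {M : ℝ≥0 → ℝ} {T : ℝ≥0} {c : ℝ} (h : HasDyadicQV M T c) (hc : 0 ≤ c)
    {ε : ℝ} (hε : 0 < ε) :
    ∀ᶠ n in atTop, ∀ j ≤ 2 ^ n, |sqSum M T n j - c * grid T n j| < ε := by
  -- The coarse level is chosen so that the limit grows by less than `ε / 2` over one coarse cell.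
  obtain ⟨m, hm⟩ : ∃ m : ℕ, c * (T / 2 ^ m) < ε / 2 := by
    have h1 : Tendsto (fun n : ℕ => c * ((T : ℝ) / 2 ^ n)) atTop (𝓝 (c * 0)) :=
      (tendsto_mesh T).const_mul c
    rw [mul_zero] at h1
    exact (h1.eventually (gt_mem_nhds (half_pos hε))).exists
  have h2 : ∀ᶠ n in atTop, ∀ k ∈ Finset.range (2 ^ m + 1),
      |sqSum M T (m + n) (k * 2 ^ n) - c * grid T m k| < ε / 2 := by
    rw [Filter.eventually_all_finset]
    intro k hk
    have := h m k (by simpa [Nat.lt_succ_iff] using hk)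
    have h3 := (tendsto_iff_norm_sub_tendsto_zero.1 this).eventually (gt_mem_nhds (half_pos hε))
    simpa using h3
  obtain ⟨n₀, hn₀⟩ := eventually_atTop.1 h2
  refine eventually_atTop.2 ⟨m + n₀, fun N hN j hj => ?_⟩
  obtain ⟨n, rfl⟩ : ∃ n, N = m + n := ⟨N - m, by omega⟩
  have hn := hn₀ n (by omega)
  set k := j / 2 ^ n with hk
  have hkj : k * 2 ^ n ≤ j := Nat.div_mul_le_self j _
  have hjk : j ≤ (k + 1) * 2 ^ n := by
    rw [mul_comm]; exact (Nat.lt_mul_div_succ j (by positivity)).le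
  have hk2 : k ≤ 2 ^ m := by
    rw [hk, pow_add] at *
    exact Nat.div_le_of_le_mul (by rw [mul_comm]; exact hj)
  have hlow := abs_lt.1 (hn k (by simp; omega))
  have g1 : (grid T m k : ℝ) ≤ grid T (m + n) j := by
    rw [← grid_refine T m n k]; exact_mod_cast grid_mono T _ hkj
  have s1 := sqSum_mono M T (m + n) hkj
  rcases hk2.lt_or_eq with hlt | heq
  · have hup := abs_lt.1 (hn (k + 1) (by simp; omega))
    have g2 : (grid T (m + n) j : ℝ) ≤ grid T m (k + 1) := by
      rw [← grid_refine T m n (k + 1)]; exact_mod_cast grid_mono T _ hjk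
    have s2 := sqSum_mono M T (m + n) hjk
    have g3 := coe_grid_succ T m k
    have e1 := mul_le_mul_of_nonneg_left g1 hc
    have e2 := mul_le_mul_of_nonneg_left g2 hc
    rw [g3] at e2 hup
    rw [mul_add] at e2 hup
    rw [abs_lt]; constructor <;> linarith
  · have hj' : j = k * 2 ^ n := by
      refine le_antisymm ?_ hkj
      rw [heq, ← pow_add]; exact hj
    have := hn k (by simp; omega)
    rw [← grid_refine T m n k, ← hj'] at this
    linarith

theorem eventually_incr_lt {M : ℝ≥0 → ℝ} (hM : Continuous M) (T : ℝ≥0) {ε : ℝ} (hε : 0 < ε) :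
    ∀ᶠ n in atTop, ∀ s ≤ T, ∀ u ≤ T, dist s u ≤ (T : ℝ) / 2 ^ n → |M s - M u| < ε := by
  have hcomp : IsCompact (Icc 0 T) := isCompact_Icc
  have huc := hcomp.uniformContinuousOn_of_continuous hM.continuousOn
  obtain ⟨δ, hδ, h⟩ := Metric.uniformContinuousOn_iff.1 huc ε hε
  filter_upwards [(tendsto_mesh T).eventually (gt_mem_nhds hδ)] with n hn s hs u hu hsu
  exact h s ⟨zero_le, hs⟩ u ⟨zero_le, hu⟩ (hsu.trans_lt hn)

theorem dist_grid_succ (T : ℝ≥0) (n i : ℕ) :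
    dist (grid T n (i + 1)) (grid T n i) ≤ (T : ℝ) / 2 ^ n := by
  rw [NNReal.dist_eq, coe_grid_succ, add_sub_cancel_left, abs_of_nonneg (by positivity)]

theorem eventually_incr_grid_lt {M : ℝ≥0 → ℝ} (hM : Continuous M) (T : ℝ≥0) {ε : ℝ} (hε : 0 < ε) :
    ∀ᶠ n in atTop, ∀ i < 2 ^ n, |incr M T n i| < ε := by
  filter_upwards [eventually_incr_lt hM T hε] with n hn i hi
  exact hn _ (grid_le T hi) _ (grid_le T hi.le) (dist_grid_succ T n i)

theorem abs_log_one_add_sub_le {x : ℝ} (hx : |x| ≤ 1 / 2) :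
    |Real.log (1 + x) - x + x ^ 2 / 2| ≤ 2 * |x| * x ^ 2 := by
  have h := Real.abs_log_sub_add_sum_range_le (x := -x) (by rw [abs_neg]; linarith) 2
  simp only [Finset.sum_range_succ, Finset.sum_range_zero, abs_neg] at h
  norm_num at h
  have e : -x + x ^ 2 / 2 + Real.log (1 + x) = Real.log (1 + x) - x + x ^ 2 / 2 := by ring
  rw [e] at h
  refine h.trans ?_
  have h3 : |x| ^ 3 = |x| * x ^ 2 := by rw [pow_succ, sq_abs]; ring
  rw [h3, div_le_iff₀ (by linarith)]
  have : 0 ≤ |x| * x ^ 2 := by positivity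
  nlinarith

theorem sum_incr (M : ℝ≥0 → ℝ) (T : ℝ≥0) (n j : ℕ) :
    ∑ i ∈ Finset.range j, incr M T n i = M (grid T n j) - M 0 := by
  unfold incr
  rw [Finset.sum_range_sub (fun i => M (grid T n i)), grid_zero]

/-- Expand `log (1 + x)` to second order. The increments telescope, half the sum of squares tends to
`c t / 2`, and the cubic remainder is at most the largest increment times the bounded sum of
squares. -/
theorem eulerProd_log_tendsto {M : ℝ≥0 → ℝ} (hM : Continuous M) (hM0 : M 0 = 0) {T : ℝ≥0} {c : ℝ}
    (hc : 0 ≤ c) (hQ : HasDyadicQV M T c) {ε : ℝ} (hε : 0 < ε) :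
    ∀ᶠ n in atTop, (∀ i < 2 ^ n, |incr M T n i| ≤ 1 / 2) ∧ ∀ j ≤ 2 ^ n, 0 < eulerProd M T n j ∧
      |Real.log (eulerProd M T n j) - (M (grid T n j) - c / 2 * grid T n j)| < ε := by
  -- `C` bounds every partial sum of squares once its distance to the limit is below `1`.
  set C := c * T + 1 with hC
  have hCpos : 0 < C := by positivity
  filter_upwards [hQ.uniform hc (ε := min 1 ε) (by positivity),
    eventually_incr_grid_lt hM T (ε := min (1 / 2) (ε / (4 * C))) (by positivity)] with n hn hi
  refine ⟨fun i h => (hi i h).le.trans (min_le_left _ _), fun j hj => ?_⟩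
  have hhalf : ∀ i ∈ Finset.range j, |incr M T n i| ≤ 1 / 2 := fun i h =>
    (hi i ((Finset.mem_range.1 h).trans_le hj)).le.trans (min_le_left _ _)
  have hpos : ∀ i ∈ Finset.range j, 0 < 1 + incr M T n i := fun i h => by
    have := abs_le.1 (hhalf i h); linarith
  refine ⟨Finset.prod_pos hpos, ?_⟩
  have hlog : Real.log (eulerProd M T n j)
      = ∑ i ∈ Finset.range j, Real.log (1 + incr M T n i) :=
    Real.log_prod fun i h => (hpos i h).ne'
  have hsum : |∑ i ∈ Finset.range j,
      (Real.log (1 + incr M T n i) - incr M T n i + incr M T n i ^ 2 / 2)|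
      ≤ 2 * (ε / (4 * C)) * sqSum M T n j := by
    refine (Finset.abs_sum_le_sum_abs _ _).trans ?_
    unfold sqSum
    rw [Finset.mul_sum]
    refine Finset.sum_le_sum fun i h => (abs_log_one_add_sub_le (hhalf i h)).trans ?_
    have := (hi i ((Finset.mem_range.1 h).trans_le hj)).le.trans (min_le_right _ _)
    gcongr
  have hq := abs_lt.1 (hn j hj)
  have hg : (grid T n j : ℝ) ≤ T := by exact_mod_cast grid_le T hj
  have hqC : sqSum M T n j ≤ C := by
    have := min_le_left 1 ε
    have := mul_le_mul_of_nonneg_left hg hc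
    linarith
  have hsum' : 2 * (ε / (4 * C)) * sqSum M T n j ≤ ε / 2 := by
    calc 2 * (ε / (4 * C)) * sqSum M T n j ≤ 2 * (ε / (4 * C)) * C := by gcongr
      _ = ε / 2 := by field_simp; norm_num
  have hdec : Real.log (eulerProd M T n j) - (M (grid T n j) - c / 2 * grid T n j)
      = (∑ i ∈ Finset.range j,
        (Real.log (1 + incr M T n i) - incr M T n i + incr M T n i ^ 2 / 2))
        - (sqSum M T n j - c * grid T n j) / 2 := by
    rw [Finset.sum_add_distrib, Finset.sum_sub_distrib, sum_incr, hM0, ← hlog, ← Finset.sum_div]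
    unfold sqSum
    ring
  rw [hdec]
  have := min_le_right 1 ε
  have h1 := abs_le.1 (hsum.trans hsum')
  rw [abs_lt]
  constructor <;> linarith

/-! ### The discrete linear equation -/

/-- Discrete variation of constants. The increments of `y` use `x` and not `y` as integrand, and the
resulting error `(x - y) d / (1 + d)` is split by `d / (1 + d) = d - d² / (1 + d)`: the two parts
vanish in the limit for different reasons. -/
theorem div_euler_eq {E d x y J : ℕ → ℝ} (hE0 : E 0 = 1) (hE : ∀ i, E (i + 1) = E i * (1 + d i))
    (hy : ∀ i, y (i + 1) = y i + x i * d i + (J (i + 1) - J i)) {j : ℕ}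
    (hd : ∀ i < j, 0 < 1 + d i) :
    y j / E j = y 0 + (∑ i ∈ Finset.range j, (J (i + 1) - J i) / E (i + 1))
      + (∑ i ∈ Finset.range j, (x i - y i) / E i * d i)
      - ∑ i ∈ Finset.range j, (x i - y i) / E i * (d i ^ 2 / (1 + d i)) := by
  have hEpos : ∀ i ≤ j, 0 < E i := by
    intro i
    induction i with
    | zero => intro _; rw [hE0]; exact one_pos
    | succ k ih => intro hk; rw [hE]; exact mul_pos (ih (by omega)) (hd k (by omega))
  induction j with
  | zero => simp [hE0]
  | succ k ih =>
    have hk := ih (fun i hi => hd i (by omega)) (fun i hi => hEpos i (by omega))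
    rw [Finset.sum_range_succ, Finset.sum_range_succ, Finset.sum_range_succ]
    have h1 : y (k + 1) / E (k + 1) = y k / E k + (J (k + 1) - J k) / E (k + 1)
        + (x k - y k) / E k * d k - (x k - y k) / E k * (d k ^ 2 / (1 + d k)) := by
      have e1 := (hEpos k (by omega)).ne'
      have e2 := (hd k (by omega)).ne'
      rw [hE, hy]
      field_simp
      ring
    rw [h1, hk]
    ring

/-- The continuous log-return `M - ½ c t`. -/
noncomputable def logReturn (M : ℝ≥0 → ℝ) (c : ℝ) (t : ℝ≥0) : ℝ := M t - c / 2 * t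

theorem continuous_logReturn {M : ℝ≥0 → ℝ} (hM : Continuous M) (c : ℝ) :
    Continuous (logReturn M c) := by
  unfold logReturn; fun_prop

/-- The index may move with the level, so that this covers both a fixed time and the ends of the
shrinking cells around a jump. -/
theorem inv_eulerProd_tendsto {M : ℝ≥0 → ℝ} (hM : Continuous M) (hM0 : M 0 = 0) {T : ℝ≥0} {c : ℝ}
    (hc : 0 ≤ c) (hQ : HasDyadicQV M T c) {ns : ℕ → ℕ} (hns : Tendsto ns atTop atTop)
    {j : ℕ → ℕ} (hj : ∀ l, j l ≤ 2 ^ ns l) {s : ℝ≥0}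
    (hs : Tendsto (fun l => grid T (ns l) (j l)) atTop (𝓝 s)) :
    Tendsto (fun l => (eulerProd M T (ns l) (j l))⁻¹) atTop
      (𝓝 (Real.exp (-logReturn M c s))) := by
  have h1 : Tendsto (fun l => Real.log (eulerProd M T (ns l) (j l))
      - logReturn M c (grid T (ns l) (j l))) atTop (𝓝 0) := by
    rw [Metric.tendsto_nhds]
    intro ε hε
    filter_upwards [hns.eventually (eulerProd_log_tendsto hM hM0 hc hQ hε)] with l hl
    rw [Real.dist_0_eq_abs]
    exact (hl.2 _ (hj l)).2
  have h2 := ((continuous_logReturn hM c).tendsto s).comp hs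
  have h3 : Tendsto (fun l => Real.log (eulerProd M T (ns l) (j l))) atTop
      (𝓝 (logReturn M c s)) := by
    have := h1.add h2
    simpa using this
  refine ((Real.continuous_exp.tendsto _).comp h3.neg).congr' ?_
  filter_upwards [hns.eventually (eulerProd_log_tendsto hM hM0 hc hQ one_pos)] with l hl
  simp only [Function.comp]
  rw [Real.exp_neg, Real.exp_log (hl.2 _ (hj l)).1]

/-- The limit `exp (logReturn M c)` is bounded away from zero on the compact interval, hence so are
the Euler products, uniformly in the index. -/
theorem div_eulerProd_small {M : ℝ≥0 → ℝ} (hM : Continuous M) (hM0 : M 0 = 0) {T : ℝ≥0} {c : ℝ}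
    (hc : 0 ≤ c) (hQ : HasDyadicQV M T c) {ns : ℕ → ℕ} (hns : Tendsto ns atTop atTop)
    {δ : ℕ → ℕ → ℝ} (hδ : ∀ ε > 0, ∀ᶠ l in atTop, ∀ j ≤ 2 ^ ns l, |δ l j| < ε)
    {ε : ℝ} (hε : 0 < ε) :
    ∀ᶠ l in atTop, ∀ j ≤ 2 ^ ns l, |δ l j / eulerProd M T (ns l) j| < ε := by
  obtain ⟨B, hB⟩ : ∃ B, ∀ t ∈ Icc 0 T, |logReturn M c t| ≤ B := by
    obtain ⟨B, hB⟩ := (isCompact_Icc (a := (0 : ℝ≥0)) (b := T)).exists_bound_of_continuousOn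
      (continuous_logReturn hM c).continuousOn
    exact ⟨B, fun t ht => by simpa using hB t ht⟩
  filter_upwards [hδ (ε / Real.exp (B + 1)) (by positivity),
    hns.eventually (eulerProd_log_tendsto hM hM0 hc hQ one_pos)] with l h1 h2 j hj
  obtain ⟨hpos, hlog⟩ := h2.2 j hj
  have hL := abs_le.1 (hB (grid T (ns l) j) ⟨zero_le, grid_le T hj⟩)
  unfold logReturn at hL
  have hlog' := abs_lt.1 hlog
  have hinv : (eulerProd M T (ns l) j)⁻¹ ≤ Real.exp (B + 1) := by
    rw [← Real.exp_log (inv_pos.2 hpos), Real.log_inv]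
    exact Real.exp_le_exp.2 (by linarith)
  rw [div_eq_mul_inv, abs_mul, abs_of_pos (inv_pos.2 hpos)]
  calc |δ l j| * (eulerProd M T (ns l) j)⁻¹ ≤ |δ l j| * Real.exp (B + 1) := by gcongr
    _ < ε / Real.exp (B + 1) * Real.exp (B + 1) := by gcongr; exact h1 j hj
    _ = ε := by field_simp

/-- A single jump changes the step function only in the cell containing it, so only one summand
survives. -/
theorem sum_jump_div {T : ℝ≥0} {n : ℕ} (E : ℕ → ℝ) {s : ℝ≥0} {i₀ : ℕ}
    (h1 : grid T n i₀ < s) (h2 : s ≤ grid T n (i₀ + 1)) (w : ℝ) (j : ℕ) :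
    ∑ i ∈ Finset.range j, ((if s ≤ grid T n (i + 1) then w else 0)
      - (if s ≤ grid T n i then w else 0)) / E (i + 1)
      = if s ≤ grid T n j then w * (E (i₀ + 1))⁻¹ else 0 := by
  have hcell : ∀ i, ((if s ≤ grid T n (i + 1) then w else 0)
      - (if s ≤ grid T n i then w else 0)) / E (i + 1)
      = if i = i₀ then w * (E (i₀ + 1))⁻¹ else 0 := by
    intro i
    rcases lt_trichotomy i i₀ with h | h | h
    · have a1 : ¬ s ≤ grid T n (i + 1) := not_le.2 ((grid_mono T n h).trans_lt h1)
      have a2 : ¬ s ≤ grid T n i := not_le.2 ((grid_mono T n h.le).trans_lt h1)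
      simp [a1, a2, h.ne]
    · subst h
      simp [h2, not_le.2 h1, div_eq_mul_inv]
    · have a1 : s ≤ grid T n i := h2.trans (grid_mono T n h)
      have a2 : s ≤ grid T n (i + 1) := a1.trans (grid_mono T n (Nat.le_succ _))
      simp [a1, a2, h.ne']
  simp_rw [hcell]
  rw [Finset.sum_ite_eq']
  have hiff : i₀ ∈ Finset.range j ↔ s ≤ grid T n j := by
    rw [Finset.mem_range]
    constructor
    · intro h; exact h2.trans (grid_mono T n h)
    · intro h
      by_contra hc
      exact absurd (h.trans (grid_mono T n (not_lt.1 hc))) (not_le.2 h1)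
  simp [hiff]

/-- The limit of `div_euler_eq` along refining grids. The assumption `hG` does not follow from `hU`
by crude estimates, because increments of `M` need not be absolutely summable in the limit;
probability will supply it. -/
theorem discounted_eq_on_grid {M : ℝ≥0 → ℝ} (hM : Continuous M) (hM0 : M 0 = 0) {T : ℝ≥0} {c : ℝ}
    (hc : 0 ≤ c) (hQ : HasDyadicQV M T c) {x u : ℝ≥0 → ℝ} {x₀ : ℝ} {K : Finset ℕ} {s : ℕ → ℝ≥0}
    {w : ℕ → ℝ} (hx : ∀ t ≤ T, x t = x₀ + u t + ∑ k ∈ K with s k ≤ t, w k)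
    (hs : ∀ k ∈ K, 0 < s k ∧ s k ≤ T) {ns : ℕ → ℕ} (hns : Tendsto ns atTop atTop)
    (hU : ∀ ε > 0, ∀ᶠ l in atTop, ∀ j ≤ 2 ^ ns l,
      |u (grid T (ns l) j) - riemannSum x M T (ns l) j| < ε)
    (hG : ∀ ε > 0, ∀ᶠ l in atTop, ∀ j ≤ 2 ^ ns l, |∑ i ∈ Finset.range j,
      (u (grid T (ns l) i) - riemannSum x M T (ns l) i) / eulerProd M T (ns l) i
        * incr M T (ns l) i| < ε)
    (m k : ℕ) (hk : k ≤ 2 ^ m) :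
    x (grid T m k) * Real.exp (-logReturn M c (grid T m k))
      = x₀ + ∑ i ∈ K with s i ≤ grid T m k, w i * Real.exp (-logReturn M c (s i)) := by
  set t := grid T m k with ht
  set J : ℝ≥0 → ℝ := fun r => ∑ i ∈ K, if s i ≤ r then w i else 0 with hJ
  have hx' : ∀ r ≤ T, x r = x₀ + u r + J r := fun r hr => by
    rw [hx r hr, Finset.sum_filter]
  -- The index of the fixed time `t` on the grid of level `ns l`. Levels coarser than `m` need not
  -- contain `t`; the default value there is irrelevant in the limit.
  set j : ℕ → ℕ := fun l => if m ≤ ns l then k * 2 ^ (ns l - m) else 0 with hj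
  have hjle : ∀ l, j l ≤ 2 ^ ns l := by
    intro l
    by_cases h : m ≤ ns l
    · simp only [hj, h, if_true]
      calc k * 2 ^ (ns l - m) ≤ 2 ^ m * 2 ^ (ns l - m) := by gcongr
        _ = 2 ^ ns l := by rw [← pow_add]; congr 1; omega
    · simp [hj, h]
  have hjt : ∀ᶠ l in atTop, grid T (ns l) (j l) = t := by
    filter_upwards [hns.eventually (eventually_ge_atTop m)] with l hl
    simp only [hj, hl, if_true]
    obtain ⟨p, hp⟩ := Nat.exists_eq_add_of_le hl
    rw [hp, Nat.add_sub_cancel_left, grid_refine]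
  have hjlim : Tendsto (fun l => grid T (ns l) (j l)) atTop (𝓝 t) :=
    tendsto_const_nhds.congr' (by filter_upwards [hjt] with l hl using hl.symm)
  set r : ℕ → ℕ → ℝ := fun l i => riemannSum x M T (ns l) i with hr
  set δ : ℕ → ℕ → ℝ := fun l i => u (grid T (ns l) i) - r l i with hδ
  set E : ℕ → ℕ → ℝ := fun l i => eulerProd M T (ns l) i with hE
  have hJ0 : J 0 = 0 := by
    refine Finset.sum_eq_zero fun i hi => ?_
    rw [if_neg (not_le.2 (hs i hi).1)]
  -- the discrete identity
  have hid : ∀ᶠ l in atTop, (x₀ + r l (j l) + J (grid T (ns l) (j l))) / E l (j l)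
      = x₀ + (∑ i ∈ Finset.range (j l),
          (J (grid T (ns l) (i + 1)) - J (grid T (ns l) i)) / E l (i + 1))
        + (∑ i ∈ Finset.range (j l), δ l i / E l i * incr M T (ns l) i)
        - ∑ i ∈ Finset.range (j l),
          δ l i / E l i * (incr M T (ns l) i ^ 2 / (1 + incr M T (ns l) i)) := by
    filter_upwards [hns.eventually (eulerProd_log_tendsto hM hM0 hc hQ one_pos)] with l hl
    have hd : ∀ i < j l, 0 < 1 + incr M T (ns l) i := fun i hi => by
      have := abs_le.1 (hl.1 i (hi.trans_le (hjle l)))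
      linarith
    have key := div_euler_eq (E := E l) (d := incr M T (ns l))
      (x := fun i => x (grid T (ns l) i))
      (y := fun i => x₀ + r l i + J (grid T (ns l) i)) (J := fun i => J (grid T (ns l) i))
      (by simp [hE, eulerProd]) (fun i => by simp [hE, eulerProd, Finset.prod_range_succ])
      (fun i => by simp only [hr, riemannSum, Finset.sum_range_succ]; ring) hd
    have hδx : ∀ i ∈ Finset.range (j l),
        x (grid T (ns l) i) - (x₀ + r l i + J (grid T (ns l) i)) = δ l i := by
      intro i hi
      rw [hx' _ (grid_le T (((Finset.mem_range.1 hi).trans_le (hjle l)).le))]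
      simp only [hδ]; ring
    rw [key]
    congr 1
    · congr 1
      · congr 1
        simp [hr, riemannSum, hJ0]
      · exact Finset.sum_congr rfl fun i hi => by rw [hδx i hi]
    · exact Finset.sum_congr rfl fun i hi => by rw [hδx i hi]
  -- limits of the four terms
  have hlim1 : Tendsto (fun l => (x₀ + r l (j l) + J (grid T (ns l) (j l))) / E l (j l)) atTop
      (𝓝 (x t * Real.exp (-logReturn M c t))) := by
    simp_rw [div_eq_mul_inv]
    refine Tendsto.mul ?_ (inv_eulerProd_tendsto hM hM0 hc hQ hns hjle hjlim)
    have h0 : Tendsto (fun l => δ l (j l)) atTop (𝓝 0) := by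
      rw [Metric.tendsto_nhds]
      intro ε hε
      filter_upwards [hU ε hε] with l hl
      rw [Real.dist_0_eq_abs]
      exact hl _ (hjle l)
    have h1 : Tendsto (fun l => x t - δ l (j l)) atTop (𝓝 (x t)) := by
      simpa using tendsto_const_nhds.sub h0
    refine h1.congr' ?_
    filter_upwards [hjt] with l hl
    rw [hx' t (grid_le T hk)]
    simp only [hδ, hl]
    ring
  have hlim2 : Tendsto (fun l => ∑ i ∈ Finset.range (j l),
      (J (grid T (ns l) (i + 1)) - J (grid T (ns l) i)) / E l (i + 1)) atTop
      (𝓝 (∑ i ∈ K with s i ≤ t, w i * Real.exp (-logReturn M c (s i)))) := by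
    have hswap : ∀ l, ∑ i ∈ Finset.range (j l),
        (J (grid T (ns l) (i + 1)) - J (grid T (ns l) i)) / E l (i + 1)
        = ∑ q ∈ K, ∑ i ∈ Finset.range (j l),
          ((if s q ≤ grid T (ns l) (i + 1) then w q else 0)
            - (if s q ≤ grid T (ns l) i then w q else 0)) / E l (i + 1) := by
      intro l
      rw [Finset.sum_comm]
      refine Finset.sum_congr rfl fun i _ => ?_
      simp only [hJ]
      rw [← Finset.sum_sub_distrib, Finset.sum_div]
    simp_rw [hswap]
    rw [Finset.sum_filter]
    refine tendsto_finsetSum _ fun q hq => ?_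
    -- The jump is discounted at the right end of its cell, which tends to the jump time.
    choose i₀ hi₀ hi₁ hi₂ using fun l => exists_grid_Ioc (hs q hq).1 (hs q hq).2 (ns l)
    have hcell : Tendsto (fun l => grid T (ns l) (i₀ l + 1)) atTop (𝓝 (s q)) := by
      rw [tendsto_iff_dist_tendsto_zero]
      refine squeeze_zero (fun _ => dist_nonneg) (fun l => ?_) ((tendsto_mesh T).comp hns)
      have h1 : (grid T (ns l) (i₀ l) : ℝ) < s q := by exact_mod_cast hi₁ l
      have h2 : (s q : ℝ) ≤ grid T (ns l) (i₀ l + 1) := by exact_mod_cast hi₂ l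
      have h3 := coe_grid_succ T (ns l) (i₀ l)
      rw [NNReal.dist_eq, abs_of_nonneg (by linarith)]
      simp only [Function.comp]
      linarith
    have hinv := inv_eulerProd_tendsto hM hM0 hc hQ hns (fun l => hi₀ l) hcell
    have : Tendsto (fun l => if s q ≤ t then w q * (E l (i₀ l + 1))⁻¹ else 0) atTop
        (𝓝 (if s q ≤ t then w q * Real.exp (-logReturn M c (s q)) else 0)) := by
      split_ifs
      · exact hinv.const_mul _
      · exact tendsto_const_nhds
    refine this.congr' ?_
    filter_upwards [hjt] with l hl
    rw [sum_jump_div (E l) (hi₁ l) (hi₂ l), hl]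
  have hlim3 : Tendsto (fun l => ∑ i ∈ Finset.range (j l), δ l i / E l i * incr M T (ns l) i) atTop
      (𝓝 0) := by
    rw [Metric.tendsto_nhds]
    intro ε hε
    filter_upwards [hG ε hε] with l hl
    rw [Real.dist_0_eq_abs]
    exact hl _ (hjle l)
  have hlim4 : Tendsto (fun l => ∑ i ∈ Finset.range (j l),
      δ l i / E l i * (incr M T (ns l) i ^ 2 / (1 + incr M T (ns l) i))) atTop (𝓝 0) := by
    rw [Metric.tendsto_nhds]
    intro ε hε
    set C := c * T + 1 with hC
    have hCpos : 0 < C := by positivity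
    -- Uniformly small weights meet sums of squares bounded by `C`. Increments of size at most `1 /
    -- 2` bound `1 / (1 + d)` by `2`, so the total is at most `ε / 2`.
    filter_upwards [div_eulerProd_small hM hM0 hc hQ hns hU (ε := ε / (4 * C)) (by positivity),
      hns.eventually (eulerProd_log_tendsto hM hM0 hc hQ one_pos),
      hns.eventually (hQ.uniform hc one_pos)] with l h1 h2 h3
    rw [Real.dist_0_eq_abs]
    have hq := abs_lt.1 (h3 _ (hjle l))
    have hg : (grid T (ns l) (j l) : ℝ) ≤ T := by exact_mod_cast grid_le T (hjle l)
    have hqC : sqSum M T (ns l) (j l) ≤ C := by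
      have := mul_le_mul_of_nonneg_left hg hc
      linarith
    calc |∑ i ∈ Finset.range (j l),
          δ l i / E l i * (incr M T (ns l) i ^ 2 / (1 + incr M T (ns l) i))|
        ≤ ∑ i ∈ Finset.range (j l), ε / (4 * C) * (2 * incr M T (ns l) i ^ 2) := by
          refine (Finset.abs_sum_le_sum_abs _ _).trans (Finset.sum_le_sum fun i hi => ?_)
          have hi' := (Finset.mem_range.1 hi).trans_le (hjle l)
          have ha := abs_le.1 (h2.1 i hi')
          have hb : 0 < 1 + incr M T (ns l) i := by linarith
          rw [abs_mul, abs_of_nonneg (a := incr M T (ns l) i ^ 2 / _) (by positivity)]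
          refine mul_le_mul (h1 i hi'.le).le ?_ (by positivity) (by positivity)
          rw [div_le_iff₀ hb]
          nlinarith [sq_nonneg (incr M T (ns l) i)]
      _ = ε / (4 * C) * 2 * sqSum M T (ns l) (j l) := by
          unfold sqSum
          rw [← Finset.mul_sum, ← Finset.mul_sum, mul_assoc]
      _ ≤ ε / (4 * C) * 2 * C := by gcongr
      _ = ε / 2 := by field_simp; norm_num
      _ < ε := by linarith
  have hfin := ((tendsto_const_nhds (x := x₀)).add hlim2).add hlim3 |>.sub hlim4
  rw [add_zero, sub_zero] at hfin
  exact tendsto_nhds_unique (hlim1.congr' hid) hfin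

/-- Grid points decreasing to `t` eventually see the same finitely many jumps as `t`, so
right-continuity carries the identity over. -/
theorem discounted_eq {L x : ℝ≥0 → ℝ} (hL : Continuous L) {T : ℝ≥0} {x₀ : ℝ} {K : Finset ℕ}
    {s : ℕ → ℝ≥0} {v : ℕ → ℝ}
    (hrc : ∀ t < T, ContinuousWithinAt x (Ici t) t)
    (h : ∀ m k, k ≤ 2 ^ m → x (grid T m k) * Real.exp (-L (grid T m k))
      = x₀ + ∑ i ∈ K with s i ≤ grid T m k, v i)
    {t : ℝ≥0} (ht : t ≤ T) :
    x t * Real.exp (-L t) = x₀ + ∑ i ∈ K with s i ≤ t, v i := by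
  -- The horizon is separate: right-continuity is available only before `T`, but `T` itself is a
  -- grid point.
  rcases ht.lt_or_eq with hlt | rfl
  swap
  · have := h 0 1 (by norm_num)
    have e : grid t 0 1 = t := by simpa using grid_top t 0
    rwa [e] at this
  choose i hi hi1 hi2 using fun n => exists_grid_Ico hlt n
  have hlim : Tendsto (fun n => grid T n (i n + 1)) atTop (𝓝 t) := by
    rw [tendsto_iff_dist_tendsto_zero]
    refine squeeze_zero (fun _ => dist_nonneg) (fun n => ?_) (tendsto_mesh T)
    have h1 : (grid T n (i n) : ℝ) ≤ t := by exact_mod_cast hi1 n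
    have h2 : (t : ℝ) < grid T n (i n + 1) := by exact_mod_cast hi2 n
    have h3 := coe_grid_succ T n (i n)
    rw [NNReal.dist_eq, abs_of_nonneg (by linarith)]
    linarith
  have hlimw : Tendsto (fun n => grid T n (i n + 1)) atTop (𝓝[Ici t] t) :=
    tendsto_nhdsWithin_iff.2 ⟨hlim, Eventually.of_forall fun n => (hi2 n).le⟩
  have h1 := ((hrc t hlt).tendsto.comp hlimw).mul
    (((Real.continuous_exp.comp hL.neg).tendsto t).comp hlim)
  refine tendsto_nhds_unique h1 ?_
  refine tendsto_const_nhds.congr' ?_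
  have hev : ∀ᶠ n in atTop, ∀ k ∈ K, s k ≤ grid T n (i n + 1) ↔ s k ≤ t := by
    rw [Filter.eventually_all_finset]
    intro k _
    rcases le_or_gt (s k) t with hk | hk
    · exact Eventually.of_forall fun n => ⟨fun _ => hk, fun _ => hk.trans (hi2 n).le⟩
    · filter_upwards [hlim.eventually (gt_mem_nhds hk)] with n hn
      exact ⟨fun h' => absurd h' (not_le.2 hn), fun h' => absurd h' (not_le.2 hk)⟩
  filter_upwards [hev] with n hn
  have := h n (i n + 1) (hi n)
  simp only [Function.comp, Pi.neg_apply]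
  rw [this]
  congr 1
  exact (Finset.sum_congr (Finset.filter_congr fun k hk => hn k hk) fun _ _ => rfl).symm

/-- A path driven by finitely many multiplicative jumps is a product. -/
theorem prod_formula {T : ℝ≥0} {L x : ℝ≥0 → ℝ} (hL : Continuous L) {x₀ : ℝ} {K : Finset ℕ}
    {s : ℕ → ℝ≥0} (hs : ∀ k ∈ K, 0 < s k ∧ s k ≤ T) (hinj : Set.InjOn s K) {γ : ℕ → ℝ}
    (h : ∀ t ≤ T, x t * Real.exp (-L t)
      = x₀ + ∑ i ∈ K with s i ≤ t, Function.leftLim x (s i) * γ i * Real.exp (-L (s i)))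
    {t : ℝ≥0} (ht : t ≤ T) :
    x t * Real.exp (-L t) = x₀ * ∏ i ∈ K with s i ≤ t, (1 + γ i) := by
  -- Induction on the number of jumps up to `t`. Just before the last jump the induction hypothesis
  -- gives the path explicitly, hence also its left limit at that jump, and one more factor appears.
  induction hn : (K.filter (fun i => s i ≤ t)).card using Nat.strong_induction_on generalizing t with
  | _ n ih =>
  subst hn
  rcases (K.filter (fun i => s i ≤ t)).eq_empty_or_nonempty with he | hne
  · rw [h t ht, he]; simp
  obtain ⟨q, hq, hmax⟩ := Finset.exists_max_image _ s hne
  obtain ⟨hqK, hqt⟩ := Finset.mem_filter.1 hq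
  have hqpos := (hs q hqK).1
  set F := K.filter (fun i => s i ≤ t) with hF
  have hlt : ∀ i ∈ F.erase q, s i < s q := by
    intro i hi
    obtain ⟨hiq, hiF⟩ := Finset.mem_erase.1 hi
    refine lt_of_le_of_ne (hmax i hiF) fun heq => hiq ?_
    exact hinj (by simpa using (Finset.mem_filter.1 hiF).1) (by simpa using hqK) heq
  -- just before `s q` the value of the path is known
  have hbefore : ∀ᶠ r in 𝓝[<] (s q), x r = x₀ * (∏ i ∈ F.erase q, (1 + γ i)) * Real.exp (L r) := by
    have h1 : ∀ᶠ r in 𝓝[<] (s q), ∀ i ∈ F.erase q, s i < r := by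
      rw [Filter.eventually_all_finset]
      intro i hi
      exact nhdsWithin_le_nhds (lt_mem_nhds (hlt i hi))
    filter_upwards [h1, self_mem_nhdsWithin] with r hr hrq
    have hset : K.filter (fun i => s i ≤ r) = F.erase q := by
      ext i
      simp only [Finset.mem_filter, Finset.mem_erase, hF]
      constructor
      · rintro ⟨hiK, hir⟩
        exact ⟨fun h' => absurd (h' ▸ hir) (not_le.2 hrq), hiK, hir.trans ((le_of_lt hrq).trans hqt)⟩
      · rintro ⟨hiq, hiK, hit⟩
        exact ⟨hiK, (hr i (Finset.mem_erase.2 ⟨hiq, Finset.mem_filter.2 ⟨hiK, hit⟩⟩)).le⟩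
    have hr' := ih _ (by rw [hset]; exact Finset.card_erase_lt_of_mem hq)
      ((le_of_lt hrq).trans (hqt.trans ht)) rfl
    rw [hset] at hr'
    rw [← hr', mul_assoc, ← Real.exp_add]
    simp
  have hbot : (𝓝[<] (s q)).NeBot := nhdsLT_neBot_of_exists_lt ⟨0, hqpos⟩
  have hll : Function.leftLim x (s q)
      = x₀ * (∏ i ∈ F.erase q, (1 + γ i)) * Real.exp (L (s q)) := by
    refine leftLim_eq_of_tendsto ?_
    have : Tendsto (fun r => x₀ * (∏ i ∈ F.erase q, (1 + γ i)) * Real.exp (L r)) (𝓝[<] (s q))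
        (𝓝 (x₀ * (∏ i ∈ F.erase q, (1 + γ i)) * Real.exp (L (s q)))) :=
      (((Real.continuous_exp.comp hL).tendsto _).mono_left nhdsWithin_le_nhds).const_mul _
    exact this.congr' (by filter_upwards [hbefore] with r hr using hr.symm)
  -- the sum over the earlier jumps is the earlier value
  obtain ⟨r, hr1, hr2, hrq⟩ := (hbefore.and ((by
      rw [Filter.eventually_all_finset]
      intro i hi
      exact nhdsWithin_le_nhds (lt_mem_nhds (hlt i hi)) :
        ∀ᶠ r in 𝓝[<] (s q), ∀ i ∈ F.erase q, s i < r).and self_mem_nhdsWithin)).exists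
  have hset : K.filter (fun i => s i ≤ r) = F.erase q := by
    ext i
    simp only [Finset.mem_filter, Finset.mem_erase, hF]
    constructor
    · rintro ⟨hiK, hir⟩
      exact ⟨fun h' => absurd (h' ▸ hir) (not_le.2 hrq), hiK, hir.trans ((le_of_lt hrq).trans hqt)⟩
    · rintro ⟨hiq, hiK, hit⟩
      exact ⟨hiK, (hr2 i (Finset.mem_erase.2 ⟨hiq, Finset.mem_filter.2 ⟨hiK, hit⟩⟩)).le⟩
  have hsum := h r ((le_of_lt hrq).trans (hqt.trans ht))
  rw [hset, hr1, mul_assoc, ← Real.exp_add, add_neg_cancel, Real.exp_zero, mul_one] at hsum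
  rw [h t ht, ← hF, ← Finset.add_sum_erase F _ hq, ← Finset.mul_prod_erase F _ hq, hll]
  have e : Real.exp (L (s q)) * Real.exp (-L (s q)) = 1 := by
    rw [← Real.exp_add]; simp
  calc _ = (x₀ + ∑ i ∈ F.erase q, Function.leftLim x (s i) * γ i * Real.exp (-L (s i)))
        + x₀ * (∏ i ∈ F.erase q, (1 + γ i)) * γ q
          * (Real.exp (L (s q)) * Real.exp (-L (s q))) := by ring
    _ = _ := by rw [← hsum, e]; ring

/-! ### Quadratic variation of Brownian motion along dyadic grids -/

/-- Sum of products of increments over the first `j` cells. -/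
noncomputable def crossSum (M M' : ℝ≥0 → ℝ) (T : ℝ≥0) (n j : ℕ) : ℝ :=
  ∑ i ∈ Finset.range j, incr M T n i * incr M' T n i

/-- The products of the increments of `M` and `M'` along the dyadic grids sum up to `c` times the
elapsed time. -/
def HasDyadicCov (M M' : ℝ≥0 → ℝ) (T : ℝ≥0) (c : ℝ) : Prop :=
  ∀ m k, k ≤ 2 ^ m →
    Tendsto (fun n => crossSum M M' T (m + n) (k * 2 ^ n)) atTop (𝓝 (c * grid T m k))

/-- The series of the squares has finite mean, hence converges almost surely, and its terms tend to
zero. Geometric decay on dyadic grids is what gives convergence without passing to a subsequence. -/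
theorem ae_tendsto_zero_of_integral_sq_le {Ω : Type*} [MeasurableSpace Ω] {P : Measure Ω}
    {S : ℕ → Ω → ℝ} (hS : ∀ n, Measurable (S n)) (hI : ∀ n, Integrable (fun ω => S n ω ^ 2) P)
    {C : ℝ} (h : ∀ n, ∫ ω, S n ω ^ 2 ∂P ≤ C * (1 / 2) ^ n) :
    ∀ᵐ ω ∂P, Tendsto (fun n => S n ω) atTop (𝓝 0) := by
  have hsum : ∑' n, ENNReal.ofReal (C * (1 / 2) ^ n) ≠ ∞ := by
    have hC : 0 ≤ C := by
      have := (integral_nonneg fun ω => sq_nonneg (S 0 ω)).trans (h 0)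
      simpa using this
    have hs : Summable fun n : ℕ => C * (1 / 2 : ℝ) ^ n :=
      (summable_geometric_of_lt_one (by norm_num) (by norm_num)).mul_left _
    rw [← ENNReal.ofReal_tsum_of_nonneg (fun n => by positivity) hs]
    exact ENNReal.ofReal_ne_top
  have hfin : ∫⁻ ω, ∑' n, ENNReal.ofReal (S n ω ^ 2) ∂P ≠ ∞ := by
    rw [lintegral_tsum fun n => ((hS n).pow_const 2).ennreal_ofReal.aemeasurable]
    refine ne_top_of_le_ne_top hsum (ENNReal.tsum_le_tsum fun n => ?_)
    rw [← ofReal_integral_eq_lintegral_ofReal (hI n) (ae_of_all _ fun ω => sq_nonneg _)]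
    exact ENNReal.ofReal_le_ofReal (h n)
  filter_upwards [ae_lt_top
    (Measurable.tsum fun n => ((hS n).pow_const 2).ennreal_ofReal) hfin] with ω hω
  have h1 := ENNReal.tendsto_atTop_zero_of_tsum_ne_top hω.ne
  have h2 := (ENNReal.tendsto_toReal ENNReal.zero_ne_top).comp h1
  have h3 : Tendsto (fun n => S n ω ^ 2) atTop (𝓝 0) := by
    refine h2.congr fun n => ?_
    simp [ENNReal.toReal_ofReal (sq_nonneg _)]
  have h4 := (Real.continuous_sqrt.tendsto 0).comp h3
  rw [Real.sqrt_zero] at h4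
  rw [tendsto_zero_iff_abs_tendsto_zero]
  exact h4.congr fun n => by simp [Real.sqrt_sq_eq_abs]

theorem integral_sq_sum_of_orthogonal {Ω : Type*} [MeasurableSpace Ω] {P : Measure Ω}
    {ξ : ℕ → Ω → ℝ} (hξ : ∀ i, MemLp (ξ i) 2 P)
    (horth : ∀ i j, i ≠ j → ∫ ω, ξ i ω * ξ j ω ∂P = 0) (N : ℕ) :
    ∫ ω, (∑ i ∈ Finset.range N, ξ i ω) ^ 2 ∂P = ∑ i ∈ Finset.range N, ∫ ω, ξ i ω ^ 2 ∂P := by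
  have hint : ∀ i j, Integrable (fun ω => ξ i ω * ξ j ω) P := fun i j =>
    (hξ i).integrable_mul (hξ j)
  have : ∀ ω, (∑ i ∈ Finset.range N, ξ i ω) ^ 2
      = ∑ i ∈ Finset.range N, ∑ j ∈ Finset.range N, ξ i ω * ξ j ω := fun ω => by
    rw [sq, Finset.sum_mul_sum]
  simp_rw [this]
  rw [integral_finsetSum _ fun i _ => integrable_finsetSum _ fun j _ => hint i j]
  refine Finset.sum_congr rfl fun i hi => ?_
  rw [integral_finsetSum _ fun j _ => hint i j, Finset.sum_eq_single i]
  · simp [sq]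
  · intro j _ hji
    exact horth i j hji.symm
  · intro h; exact absurd hi h

/-- By orthogonality the second moment of the centred sum is a sum of at most `2 ^ (m + n)` terms of
order `4 ^ (-(m + n))`, which is summable in `n`. -/
theorem hasDyadicCov_ae_of_orthogonal {Ω : Type*} [MeasurableSpace Ω] {P : Measure Ω}
    {M M' : ℝ≥0 → Ω → ℝ} (hM : ∀ t, Measurable (M t)) (hM' : ∀ t, Measurable (M' t)) {T : ℝ≥0}
    {c C : ℝ}
    (hL2 : ∀ n i, MemLp (fun ω => incr (M · ω) T n i * incr (M' · ω) T n i - c * (T / 2 ^ n)) 2 P)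
    (horth : ∀ n i j, i ≠ j → ∫ ω, (incr (M · ω) T n i * incr (M' · ω) T n i - c * (T / 2 ^ n))
      * (incr (M · ω) T n j * incr (M' · ω) T n j - c * (T / 2 ^ n)) ∂P = 0)
    (hsq : ∀ n i, ∫ ω, (incr (M · ω) T n i * incr (M' · ω) T n i - c * (T / 2 ^ n)) ^ 2 ∂P
      ≤ C * (T / 2 ^ n) ^ 2) :
    ∀ᵐ ω ∂P, HasDyadicCov (M · ω) (M' · ω) T c := by
  unfold HasDyadicCov
  rw [ae_all_iff]
  intro m
  rw [ae_all_iff]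
  intro k
  by_cases hk : k ≤ 2 ^ m
  swap
  · exact ae_of_all _ fun ω h => absurd h hk
  set ξ : ℕ → ℕ → Ω → ℝ := fun n i ω =>
    incr (M · ω) T n i * incr (M' · ω) T n i - c * (T / 2 ^ n) with hξ
  have hC : 0 ≤ C * (T : ℝ) ^ 2 := by
    have := (integral_nonneg fun ω => sq_nonneg _).trans (hsq 0 0)
    simpa using this
  have hmeas : ∀ n i, Measurable (ξ n i) := fun n i => by
    simp only [hξ, incr]
    exact (((hM _).sub (hM _)).mul ((hM' _).sub (hM' _))).sub_const _
  have key := ae_tendsto_zero_of_integral_sq_le (P := P)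
    (S := fun n ω => ∑ i ∈ Finset.range (k * 2 ^ n), ξ (m + n) i ω)
    (fun n => Finset.measurable_fun_sum _ fun i _ => hmeas _ i)
    (fun n => (memLp_finsetSum _ fun i _ => hL2 (m + n) i).integrable_sq)
    (C := C * T ^ 2) (fun n => by
      rw [integral_sq_sum_of_orthogonal (fun i => hL2 (m + n) i) (horth (m + n))]
      calc _ ≤ ∑ i ∈ Finset.range (k * 2 ^ n), C * ((T : ℝ) / 2 ^ (m + n)) ^ 2 :=
            Finset.sum_le_sum fun i _ => hsq _ _
        _ = (k * 2 ^ n : ℕ) * (C * ((T : ℝ) / 2 ^ (m + n)) ^ 2) := by simp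
        _ ≤ (2 ^ m * 2 ^ n : ℕ) * (C * ((T : ℝ) / 2 ^ (m + n)) ^ 2) := by
            have : 0 ≤ C * ((T : ℝ) / 2 ^ (m + n)) ^ 2 := by
              rw [div_pow, ← mul_div_assoc]; positivity
            gcongr
        _ = C * T ^ 2 * (1 / 2) ^ (m + n) := by
            push_cast
            rw [← pow_add, one_div, inv_pow]
            field_simp
        _ ≤ C * T ^ 2 * (1 / 2) ^ n := by
            refine mul_le_mul_of_nonneg_left ?_ hC
            exact pow_le_pow_of_le_one (by norm_num) (by norm_num) (by omega))
  filter_upwards [key] with ω hω _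
  have := hω.add_const (c * (grid T m k : ℝ))
  rw [zero_add] at this
  refine this.congr fun n => ?_
  simp only [hξ, crossSum, Finset.sum_sub_distrib, Finset.sum_const, Finset.card_range,
    nsmul_eq_mul]
  rw [← grid_refine T m n k, coe_grid]
  ring

theorem hasLaw_incr {Ω : Type*} [MeasurableSpace Ω] {P : Measure Ω}
    {B : ℝ≥0 → Ω → ℝ} (hB : IsPreBrownianReal B P) (T : ℝ≥0) (n i : ℕ) :
    HasLaw (fun ω => incr (B · ω) T n i) (gaussianReal 0 (T / 2 ^ n)) P := by
  have h := hB.hasLaw_sub (grid T n (i + 1)) (grid T n i)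
  have e : nndist (grid T n (i + 1)).1 (grid T n i).1 = T / 2 ^ n := by
    apply NNReal.coe_injective
    rw [coe_nndist, Real.dist_eq]
    change |((grid T n (i + 1) : ℝ≥0) : ℝ) - (grid T n i : ℝ≥0)| = _
    rw [coe_grid_succ, add_sub_cancel_left, abs_of_nonneg (by positivity)]
    simp
  rw [e] at h
  exact h

theorem integral_sq_gaussianReal (v : ℝ≥0) : ∫ x, x ^ 2 ∂(gaussianReal 0 v) = v := by
  have h := variance_fun_id_gaussianReal (μ := 0) (v := v)
  rw [variance_of_integral_eq_zero (by fun_prop) integral_id_gaussianReal] at h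
  simpa using h

/-- Gaussian scaling: the constant is the same for all mesh sizes, as the variance estimate for the
quadratic variation demands. -/
theorem integral_sq_sub_sq_gaussianReal (v : ℝ≥0) :
    ∫ x, (x ^ 2 - v) ^ 2 ∂(gaussianReal 0 v)
      = (∫ x, (x ^ 2 - 1) ^ 2 ∂(gaussianReal 0 1)) * (v : ℝ) ^ 2 := by
  have h : gaussianReal 0 v = (gaussianReal 0 1).map (fun x => √(v : ℝ) * x) := by
    rw [gaussianReal_map_const_mul]
    congr 1
    · simp
    · apply NNReal.coe_injective; simp
  rw [h, integral_map (by fun_prop) (by fun_prop), ← integral_mul_const]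
  congr 1
  ext x
  rw [mul_pow, Real.sq_sqrt (NNReal.coe_nonneg v)]
  ring

theorem memLp_sq_gaussianReal (v : ℝ≥0) : MemLp (fun x : ℝ => x ^ 2) 2 (gaussianReal 0 v) := by
  have h := (memLp_id_gaussianReal (μ := 0) (v := v) 4).norm_rpow_div (q := 2)
  have e : (4 : ℝ≥0∞) / 2 = 2 := by
    rw [show (4 : ℝ≥0∞) = 2 * 2 by norm_num, ENNReal.mul_div_cancel_right (by norm_num) (by norm_num)]
  have h' := (memLp_congr_ae (p := ((4 : ℝ≥0) : ℝ≥0∞) / 2)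
    (f := fun x : ℝ => ‖id x‖ ^ (2 : ℝ≥0∞).toReal) (g := fun x : ℝ => x ^ 2)
    (μ := gaussianReal 0 v) (ae_of_all _ fun x => by simp)).1 h
  have e' : ((4 : ℝ≥0) : ℝ≥0∞) / 2 = 2 := by push_cast; exact e
  rwa [e'] at h'

theorem IsBM.ae_hasDyadicCov_self {Ω : Type*} [MeasurableSpace Ω] {P : Measure Ω}
    [IsProbabilityMeasure P] {B : ℝ≥0 → Ω → ℝ} (hB : IsBM P B) (T : ℝ≥0) :
    ∀ᵐ ω ∂P, HasDyadicCov (B · ω) (B · ω) T 1 := by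
  have hlaw := hasLaw_incr hB.brownian.toIsPreBrownianReal T
  have hsqL2 : ∀ n i, MemLp (fun ω => incr (B · ω) T n i * incr (B · ω) T n i
      - 1 * (T / 2 ^ n)) 2 P := fun n i => by
    have h1 := (memLp_sq_gaussianReal (T / 2 ^ n))
    rw [← (hlaw n i).map_eq] at h1
    have h2 := h1.comp_of_map (hlaw n i).aemeasurable
    have h3 := h2.sub (memLp_const (1 * ((T : ℝ) / 2 ^ n)))
    refine (memLp_congr_ae (ae_of_all _ fun ω => ?_)).1 h3
    simp [sq]
  have hmean : ∀ n i, ∫ ω, (incr (B · ω) T n i * incr (B · ω) T n i - 1 * (T / 2 ^ n)) ∂P = 0 := by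
    intro n i
    have h1 := (hlaw n i).integral_comp (f := fun x => x * x - 1 * ((T : ℝ) / 2 ^ n)) (by fun_prop)
    simp only [Function.comp_def] at h1
    rw [h1, integral_sub]
    · have := integral_sq_gaussianReal (T / 2 ^ n)
      simp_rw [sq] at this
      rw [this]; simp
    · simpa [sq] using (memLp_sq_gaussianReal (T / 2 ^ n)).integrable one_le_two
    · exact integrable_const _
  refine hasDyadicCov_ae_of_orthogonal hB.measurable hB.measurable
    (C := ∫ x, (x ^ 2 - 1) ^ 2 ∂(gaussianReal 0 1)) hsqL2 ?_ ?_
  · intro n i j hij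
    have hind := (hB.brownian.hasIndepIncrements.nat (grid_mono T n)).indepFun hij
    have hind2 := hind.comp (φ := fun x => x * x - 1 * ((T : ℝ) / 2 ^ n))
      (ψ := fun x => x * x - 1 * ((T : ℝ) / 2 ^ n)) (by fun_prop) (by fun_prop)
    have h3 := hind2.integral_fun_mul_eq_mul_integral (hsqL2 n i).1 (hsqL2 n j).1
    refine h3.trans ?_
    have := hmean n i
    simp only [incr] at this
    simp only [Function.comp_def]
    rw [this, zero_mul]
  · intro n i
    have h1 := (hlaw n i).integral_comp (f := fun x => (x * x - 1 * ((T : ℝ) / 2 ^ n)) ^ 2)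
      (by fun_prop)
    simp only [Function.comp_def] at h1
    rw [h1]
    have := integral_sq_sub_sq_gaussianReal (T / 2 ^ n)
    push_cast at this
    simp only [one_mul]
    simp_rw [sq] at this ⊢
    exact this.le

theorem measurable_processSigma {Ω : Type*} (B : ℝ≥0 → Ω → ℝ) (t : ℝ≥0) :
    Measurable[processSigma B] (B t) := by
  have h : Measurable[processSigma B] (fun ω t => B t ω) := comap_measurable _
  exact (measurable_pi_apply t).comp h

/-- Independence of the paths factorises the mixed fourth moments, so orthogonality of the
increments of `B` alone suffices. -/
theorem IsBM.ae_hasDyadicCov_of_indep {Ω : Type*} [MeasurableSpace Ω] {P : Measure Ω}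
    [IsProbabilityMeasure P] {B B' : ℝ≥0 → Ω → ℝ} (hB : IsBM P B) (hB' : IsBM P B')
    (hind : Indep (processSigma B) (processSigma B') P) (T : ℝ≥0) :
    ∀ᵐ ω ∂P, HasDyadicCov (B · ω) (B' · ω) T 0 := by
  have hlaw := hasLaw_incr hB.brownian.toIsPreBrownianReal T
  have hlaw' := hasLaw_incr hB'.brownian.toIsPreBrownianReal T
  have hms : ∀ n i, Measurable[processSigma B] (fun ω => incr (B · ω) T n i) := fun n i =>
    (measurable_processSigma B _).sub (measurable_processSigma B _)
  have hms' : ∀ n i, Measurable[processSigma B'] (fun ω => incr (B' · ω) T n i) := fun n i =>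
    (measurable_processSigma B' _).sub (measurable_processSigma B' _)
  have hm : ∀ n i, Measurable (fun ω => incr (B · ω) T n i) := fun n i =>
    (hB.measurable _).sub (hB.measurable _)
  have hm' : ∀ n i, Measurable (fun ω => incr (B' · ω) T n i) := fun n i =>
    (hB'.measurable _).sub (hB'.measurable _)
  have hind2 : ∀ n i j, IndepFun (fun ω => incr (B · ω) T n i * incr (B · ω) T n j)
      (fun ω => incr (B' · ω) T n i * incr (B' · ω) T n j) P := fun n i j => by
    rw [IndepFun_iff_Indep]
    exact indep_of_indep_of_le_left (indep_of_indep_of_le_right hind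
      (Measurable.comap_le ((hms' n i).mul (hms' n j)))) (Measurable.comap_le ((hms n i).mul (hms n j)))
  have hL2 : ∀ n i, MemLp (fun ω => incr (B · ω) T n i) 2 P := fun n i => by
    have h1 := memLp_id_gaussianReal (μ := 0) (v := T / 2 ^ n) 2
    rw [← (hlaw n i).map_eq] at h1
    exact h1.comp_of_map (hlaw n i).aemeasurable
  have hL2' : ∀ n i, MemLp (fun ω => incr (B' · ω) T n i) 2 P := fun n i => by
    have h1 := memLp_id_gaussianReal (μ := 0) (v := T / 2 ^ n) 2
    rw [← (hlaw' n i).map_eq] at h1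
    exact h1.comp_of_map (hlaw' n i).aemeasurable
  have hsq : ∀ n i, ∫ ω, incr (B · ω) T n i * incr (B · ω) T n i ∂P = T / 2 ^ n := fun n i => by
    have h1 := (hlaw n i).integral_comp (f := fun x => x * x) (by fun_prop)
    simp only [Function.comp_def] at h1
    have := integral_sq_gaussianReal (T / 2 ^ n)
    simp_rw [sq] at this
    rw [h1, this]; simp
  have hsq' : ∀ n i, ∫ ω, incr (B' · ω) T n i * incr (B' · ω) T n i ∂P = T / 2 ^ n := fun n i => by
    have h1 := (hlaw' n i).integral_comp (f := fun x => x * x) (by fun_prop)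
    simp only [Function.comp_def] at h1
    have := integral_sq_gaussianReal (T / 2 ^ n)
    simp_rw [sq] at this
    rw [h1, this]; simp
  have horth : ∀ n i j, i ≠ j → ∫ ω, incr (B · ω) T n i * incr (B · ω) T n j ∂P = 0 := by
    intro n i j hij
    have hi := (hB.brownian.hasIndepIncrements.nat (grid_mono T n)).indepFun hij
    have h3 := hi.integral_fun_mul_eq_mul_integral (hm n i).aestronglyMeasurable
      (hm n j).aestronglyMeasurable
    refine h3.trans ?_
    have h4 := (hlaw n i).integral_eq
    rw [integral_id_gaussianReal] at h4
    simp only [incr] at h4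
    rw [h4, zero_mul]
  have hprod : ∀ n i j, ∫ ω, (incr (B · ω) T n i * incr (B' · ω) T n i)
      * (incr (B · ω) T n j * incr (B' · ω) T n j) ∂P
      = (∫ ω, incr (B · ω) T n i * incr (B · ω) T n j ∂P)
        * ∫ ω, incr (B' · ω) T n i * incr (B' · ω) T n j ∂P := fun n i j => by
    rw [← (hind2 n i j).integral_fun_mul_eq_mul_integral
      ((hm n i).mul (hm n j)).aestronglyMeasurable ((hm' n i).mul (hm' n j)).aestronglyMeasurable]
    congr 1
    ext ω
    ring
  refine hasDyadicCov_ae_of_orthogonal hB.measurable hB'.measurable (C := 1) ?_ ?_ ?_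
  · intro n i
    simp only [zero_mul, sub_zero]
    refine (memLp_two_iff_integrable_sq
      (by exact ((hm n i).mul (hm' n i)).aestronglyMeasurable)).2 ?_
    have := (hind2 n i i).integrable_mul ((hL2 n i).integrable_mul (hL2 n i))
      ((hL2' n i).integrable_mul (hL2' n i))
    refine this.congr (ae_of_all _ fun ω => ?_)
    simp only [Pi.mul_apply]
    ring
  · intro n i j hij
    simp only [zero_mul, sub_zero]
    rw [hprod, horth n i j hij, zero_mul]
  · intro n i
    simp only [zero_mul, sub_zero, one_mul]
    simp_rw [sq]
    rw [hprod, hsq, hsq']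

/-! ### Quadratic variation of drifted combinations -/

theorem abs_crossSum_le (M M' : ℝ≥0 → ℝ) (T : ℝ≥0) (n j : ℕ) {ε : ℝ}
    (h : ∀ i < j, |incr M' T n i| ≤ ε) :
    |crossSum M M' T n j| ≤ (∑ i ∈ Finset.range j, |incr M T n i|) * ε := by
  unfold crossSum
  rw [Finset.sum_mul]
  refine (Finset.abs_sum_le_sum_abs _ _).trans (Finset.sum_le_sum fun i hi => ?_)
  rw [abs_mul]
  exact mul_le_mul_of_nonneg_left (h i (Finset.mem_range.1 hi)) (abs_nonneg _)

/-- Time has finite variation, while the increments of a continuous path become uniformly small.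
Hence a drift contributes nothing to the quadratic variation. -/
theorem hasDyadicCov_time {M : ℝ≥0 → ℝ} (hM : Continuous M) (T : ℝ≥0) :
    HasDyadicCov (fun t => (t : ℝ)) M T 0 := by
  intro m k hk
  rw [zero_mul, Metric.tendsto_nhds]
  intro ε hε
  have h1 := eventually_incr_grid_lt hM T (ε := ε / (T + 1)) (by positivity)
  have h2 : Tendsto (fun n => m + n) atTop atTop := tendsto_add_atTop_nat m |>.congr fun n => by ring
  filter_upwards [h2.eventually h1] with n hn
  have hle : k * 2 ^ n ≤ 2 ^ (m + n) := by rw [pow_add]; gcongr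
  rw [Real.dist_0_eq_abs]
  refine (abs_crossSum_le _ _ _ _ _ fun i hi => (hn i (hi.trans_le hle)).le).trans_lt ?_
  have hs : ∑ i ∈ Finset.range (k * 2 ^ n), |incr (fun t => (t : ℝ)) T (m + n) i|
      = grid T (m + n) (k * 2 ^ n) := by
    rw [← sub_zero ((grid T (m + n) (k * 2 ^ n) : ℝ≥0) : ℝ)]
    refine (Finset.sum_congr rfl fun i _ => ?_).trans (sum_incr (fun t => (t : ℝ)) T (m + n) _)
    apply abs_of_nonneg
    simp only [incr]
    rw [coe_grid_succ, add_sub_cancel_left]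
    positivity
  rw [hs]
  have hg : (grid T (m + n) (k * 2 ^ n) : ℝ) ≤ T := by exact_mod_cast grid_le T hle
  calc (grid T (m + n) (k * 2 ^ n) : ℝ) * (ε / (T + 1)) ≤ T * (ε / (T + 1)) := by gcongr
    _ = ε * (T / (T + 1)) := by ring
    _ < ε * 1 := by
      gcongr
      rw [div_lt_one (by positivity)]; linarith
    _ = ε := mul_one _

theorem HasDyadicCov.qv_combination {W W₀ : ℝ≥0 → ℝ} {T : ℝ≥0} (hW : Continuous W)
    (hW₀ : Continuous W₀) (h : HasDyadicCov W W T 1) (h₀ : HasDyadicCov W₀ W₀ T 1)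
    (hx : HasDyadicCov W W₀ T 0) (A B B₀ : ℝ) :
    HasDyadicQV (fun t => A * t + B * W t + B₀ * W₀ t) T (B ^ 2 + B₀ ^ 2) := by
  intro m k hk
  have ht := hasDyadicCov_time (M := fun t => (t : ℝ)) (by fun_prop) T m k hk
  have htW := hasDyadicCov_time hW T m k hk
  have htW₀ := hasDyadicCov_time hW₀ T m k hk
  have := (((((ht.const_mul (A ^ 2)).add ((h m k hk).const_mul (B ^ 2))).add
    ((h₀ m k hk).const_mul (B₀ ^ 2))).add ((htW.const_mul (2 * A * B)))).add
    (htW₀.const_mul (2 * A * B₀))).add ((hx m k hk).const_mul (2 * B * B₀))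
  convert this using 1
  · ext n
    simp only [sqSum, crossSum, Finset.mul_sum, ← Finset.sum_add_distrib]
    refine Finset.sum_congr rfl fun i _ => ?_
    simp only [incr]
    ring
  · congr 1
    ring

/-! ### The time axis -/

theorem timeMeasure_apply (S : Set ℝ≥0) : timeMeasure S = volume ((fun t : ℝ≥0 => (t : ℝ)) '' S) := by
  have h : MeasurableEmbedding (fun t : ℝ≥0 => (t : ℝ)) :=
    MeasurableEmbedding.subtype_coe measurableSet_Ici
  exact h.comap_apply _ _

theorem timeMeasure_Iic (t : ℝ≥0) : timeMeasure (Iic t) = t := by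
  rw [timeMeasure_apply]
  have : (fun t : ℝ≥0 => (t : ℝ)) '' Iic t = Icc 0 (t : ℝ) := by
    ext x
    simp only [mem_image, mem_Iic, mem_Icc]
    constructor
    · rintro ⟨y, hy, rfl⟩; exact ⟨y.2, by exact_mod_cast hy⟩
    · rintro ⟨h0, h1⟩; exact ⟨⟨x, h0⟩, by exact_mod_cast h1, rfl⟩
  rw [this, Real.volume_Icc, sub_zero, ENNReal.ofReal_coe_nnreal]

theorem timeMeasure_singleton (t : ℝ≥0) : timeMeasure {t} = 0 := by
  rw [timeMeasure_apply]; simp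

theorem timeMeasure_Ioc {s t : ℝ≥0} (h : s ≤ t) : timeMeasure (Ioc s t) = t - s := by
  have : timeMeasure (Iic t) = timeMeasure (Iic s) + timeMeasure (Ioc s t) := by
    rw [← measure_union (by
      rw [Set.disjoint_left]; intro x hx hx'; exact absurd hx (not_le.2 hx'.1)) measurableSet_Ioc,
      Iic_union_Ioc_eq_Iic h]
  rw [timeMeasure_Iic, timeMeasure_Iic] at this
  rw [this, ENNReal.add_sub_cancel_left ENNReal.coe_ne_top]

instance : SigmaFinite timeMeasure :=
  ⟨⟨{ set := fun n => Iic (n : ℝ≥0)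
      set_mem := fun _ => trivial
      finite := fun n => by rw [timeMeasure_Iic]; exact ENNReal.coe_lt_top
      spanning := by
        ext x
        simp only [mem_iUnion, mem_Iic, mem_univ, iff_true]
        exact exists_nat_ge x }⟩⟩

instance (T : ℝ≥0) : IsFiniteMeasure (timeMeasure.restrict (Iic T)) :=
  ⟨by rw [Measure.restrict_apply_univ, timeMeasure_Iic]; exact ENNReal.coe_lt_top⟩

theorem ae_timeMeasure_pos (T : ℝ≥0) : ∀ᵐ s ∂(timeMeasure.restrict (Iic T)), 0 < s ∧ s ≤ T := by
  have h1 : ∀ᵐ s ∂(timeMeasure.restrict (Iic T)), s ≠ 0 := by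
    refine ae_restrict_of_ae ?_
    rw [ae_iff]
    simpa using timeMeasure_singleton 0
  filter_upwards [h1, ae_restrict_mem measurableSet_Iic] with s h h'
  exact ⟨pos_iff_ne_zero.2 h, h'⟩

/-! ### Càdlàg paths and their step approximations -/

/-- `x` is right-continuous with left limits on `[0,T]`. -/
def IsCadlagOn (T : ℝ≥0) (x : ℝ≥0 → ℝ) : Prop :=
  ∀ t ≤ T, (t < T → ContinuousWithinAt x (Ici t) t) ∧ ∃ l : ℝ, Tendsto x (𝓝[<] t) (𝓝 l)

/-- The step function with value `a i` on the `i`-th cell of the dyadic grid of level `n`. -/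
noncomputable def stepPath (T : ℝ≥0) (n : ℕ) (a : ℕ → ℝ) (s : ℝ≥0) : ℝ :=
  ∑ i ∈ Finset.range (2 ^ n),
    (Ioc (grid T n i) (grid T n (i + 1))).indicator (fun _ => a i) s

theorem stepPath_eq {T : ℝ≥0} {n : ℕ} (a : ℕ → ℝ) {s : ℝ≥0} {i : ℕ} (hi : i < 2 ^ n)
    (h1 : grid T n i < s) (h2 : s ≤ grid T n (i + 1)) : stepPath T n a s = a i := by
  unfold stepPath
  rw [Finset.sum_eq_single i]
  · exact indicator_of_mem (by exact ⟨h1, h2⟩) _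
  · intro j _ hji
    refine indicator_of_notMem (fun hj => hji ?_) _
    exact grid_cell_unique hj.1 hj.2 h1 h2
  · intro h; exact absurd (Finset.mem_range.2 hi) h

theorem measurable_stepPath (T : ℝ≥0) (n : ℕ) (a : ℕ → ℝ) : Measurable (stepPath T n a) :=
  Finset.measurable_fun_sum _ fun _ _ => measurable_const.indicator measurableSet_Ioc

/-- The one-sided limits bound the path near each point, and compactness makes the bound global. -/
theorem IsCadlagOn.bounded {T : ℝ≥0} {x : ℝ≥0 → ℝ} (hx : IsCadlagOn T x) :
    ∃ C, ∀ t ≤ T, |x t| ≤ C := by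
  have key : ∃ C, ∀ t ∈ Icc 0 T, t ≤ T → |x t| ≤ C := by
    refine (isCompact_Icc (a := (0 : ℝ≥0)) (b := T)).induction_on
      (p := fun s => ∃ C, ∀ t ∈ s, t ≤ T → |x t| ≤ C) ⟨0, by simp⟩ ?_ ?_ ?_
    · rintro s t hst ⟨C, hC⟩
      exact ⟨C, fun u hu => hC u (hst hu)⟩
    · rintro s t ⟨C, hC⟩ ⟨D, hD⟩
      refine ⟨max C D, fun u hu huT => ?_⟩
      rcases hu with hu | hu
      · exact (hC u hu huT).trans (le_max_left _ _)
      · exact (hD u hu huT).trans (le_max_right _ _)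
    · intro t ht
      obtain ⟨hr, l, hl⟩ := hx t ht.2
      have e1 : ∀ᶠ u in 𝓝[<] t, u ≤ T → |x u| ≤ max (|l| + 1) (|x t| + 1) := by
        filter_upwards [hl.abs.eventually (gt_mem_nhds (lt_add_one |l|))] with u hu _
        exact hu.le.trans (le_max_left _ _)
      have e2 : ∀ᶠ u in 𝓝[≥] t, u ≤ T → |x u| ≤ max (|l| + 1) (|x t| + 1) := by
        rcases ht.2.lt_or_eq with hlt | heq
        · filter_upwards [(hr hlt).tendsto.abs.eventually (gt_mem_nhds (lt_add_one |x t|))] with u hu _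
          exact hu.le.trans (le_max_right _ _)
        · filter_upwards [self_mem_nhdsWithin] with u hu huT
          have : u = t := le_antisymm (heq ▸ huT) hu
          rw [this]
          exact (le_add_of_nonneg_right zero_le_one).trans (le_max_right _ _)
      have e3 : ∀ᶠ u in 𝓝 t, u ≤ T → |x u| ≤ max (|l| + 1) (|x t| + 1) := by
        rw [← nhdsLT_sup_nhdsGE]
        exact Filter.eventually_sup.2 ⟨e1, e2⟩
      exact ⟨_, nhdsWithin_le_nhds e3, _, fun u hu => hu⟩
  obtain ⟨C, hC⟩ := key
  exact ⟨C, fun t ht => hC t ⟨zero_le, ht⟩ ht⟩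

theorem IsCadlagOn.stepPath_tendsto {T : ℝ≥0} {x : ℝ≥0 → ℝ} (hx : IsCadlagOn T x) {s : ℝ≥0}
    (hs : 0 < s) (hsT : s ≤ T) :
    Tendsto (fun n => stepPath T n (fun i => x (grid T n i)) s) atTop
      (𝓝 (Function.leftLim x s)) := by
  choose i hi hi1 hi2 using fun n => exists_grid_Ioc hs hsT n
  obtain ⟨-, l, hl⟩ := hx s hsT
  have hbot : (𝓝[<] s).NeBot := nhdsLT_neBot_of_exists_lt ⟨0, hs⟩
  rw [leftLim_eq_of_tendsto hl]
  have hlim : Tendsto (fun n => grid T n (i n)) atTop (𝓝[<] s) := by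
    refine tendsto_nhdsWithin_iff.2 ⟨?_, Eventually.of_forall fun n => hi1 n⟩
    rw [tendsto_iff_dist_tendsto_zero]
    refine squeeze_zero (fun _ => dist_nonneg) (fun n => ?_) (tendsto_mesh T)
    have h1 : (grid T n (i n) : ℝ) < s := by exact_mod_cast hi1 n
    have h2 : (s : ℝ) ≤ grid T n (i n + 1) := by exact_mod_cast hi2 n
    have h3 := coe_grid_succ T n (i n)
    rw [NNReal.dist_eq, abs_sub_comm, abs_of_nonneg (by linarith)]
    linarith
  refine (hl.comp hlim).congr fun n => ?_
  rw [stepPath_eq _ (hi n) (hi1 n) (hi2 n)]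
  rfl

theorem abs_stepPath_le {T : ℝ≥0} {n : ℕ} {a : ℕ → ℝ} {C : ℝ} (hC : ∀ i < 2 ^ n, |a i| ≤ C)
    {s : ℝ≥0} (hs : 0 < s) (hsT : s ≤ T) : |stepPath T n a s| ≤ C := by
  obtain ⟨i, hi, h1, h2⟩ := exists_grid_Ioc hs hsT n
  rw [stepPath_eq a hi h1 h2]
  exact hC i hi

theorem IsCadlagOn.abs_leftLim_le {T : ℝ≥0} {x : ℝ≥0 → ℝ} (hx : IsCadlagOn T x) {C : ℝ}
    (hC : ∀ t ≤ T, |x t| ≤ C) {s : ℝ≥0} (hs : 0 < s) (hsT : s ≤ T) :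
    |Function.leftLim x s| ≤ C :=
  le_of_tendsto (hx.stepPath_tendsto hs hsT).abs
    (Eventually.of_forall fun _ => abs_stepPath_le (fun _ hi => hC _ (grid_le T hi.le)) hs hsT)

theorem IsCadlagOn.aestronglyMeasurable_leftLim {T : ℝ≥0} {x : ℝ≥0 → ℝ} (hx : IsCadlagOn T x) :
    AEStronglyMeasurable (Function.leftLim x) (timeMeasure.restrict (Iic T)) := by
  refine aestronglyMeasurable_of_tendsto_ae atTop
    (f := fun n => stepPath T n (fun i => x (grid T n i)))
    (fun n => (measurable_stepPath T n _).aestronglyMeasurable) ?_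
  filter_upwards [ae_timeMeasure_pos T] with s hs
  exact hx.stepPath_tendsto hs.1 hs.2

theorem IsCadlagOn.integrable_leftLim {T : ℝ≥0} {x : ℝ≥0 → ℝ} (hx : IsCadlagOn T x) :
    Integrable (Function.leftLim x) (timeMeasure.restrict (Iic T)) := by
  obtain ⟨C, hC⟩ := hx.bounded
  refine Integrable.of_bound hx.aestronglyMeasurable_leftLim C ?_
  filter_upwards [ae_timeMeasure_pos T] with s hs
  exact hx.abs_leftLim_le hC hs.1 hs.2

theorem integral_stepPath (T : ℝ≥0) (n : ℕ) (a : ℕ → ℝ) {j : ℕ} (hj : j ≤ 2 ^ n) :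
    ∫ s in Iic (grid T n j), stepPath T n a s ∂timeMeasure
      = ∑ i ∈ Finset.range j, a i * incr (fun t => (t : ℝ)) T n i := by
  unfold stepPath
  rw [integral_finsetSum _ fun i _ =>
    (integrable_const (a i)).indicator measurableSet_Ioc]
  have hterm : ∀ i, ∫ s in Iic (grid T n j),
      (Ioc (grid T n i) (grid T n (i + 1))).indicator (fun _ => a i) s ∂timeMeasure
      = if i < j then a i * incr (fun t => (t : ℝ)) T n i else 0 := by
    intro i
    rw [setIntegral_indicator measurableSet_Ioc]
    split_ifs with h
    · have : Iic (grid T n j) ∩ Ioc (grid T n i) (grid T n (i + 1))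
          = Ioc (grid T n i) (grid T n (i + 1)) :=
        inter_eq_right.2 fun s hs => hs.2.trans (grid_mono T n h)
      rw [this, setIntegral_const, smul_eq_mul, mul_comm, Measure.real,
        timeMeasure_Ioc (grid_mono T n (Nat.le_succ i)), ← ENNReal.coe_sub, ENNReal.coe_toReal,
        NNReal.coe_sub (grid_mono T n (Nat.le_succ i))]
      rfl
    · have : Iic (grid T n j) ∩ Ioc (grid T n i) (grid T n (i + 1)) = ∅ := by
        ext s
        simp only [mem_inter_iff, mem_Iic, mem_Ioc, mem_empty_iff_false, iff_false, not_and]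
        intro h1 h2
        exact absurd (h2.trans_le h1) (not_lt.2 (grid_mono T n (not_lt.1 h)))
      rw [this]; simp
  simp_rw [hterm]
  rw [← Finset.sum_filter]
  congr 1
  ext i
  simp only [Finset.mem_filter, Finset.mem_range]
  omega

/-- Step approximations converge to the left limits in `L¹` of time by dominated convergence; one
`L¹` bound on `[0,T]` serves all upper limits at once. -/
theorem IsCadlagOn.riemannSum_time {T : ℝ≥0} {x : ℝ≥0 → ℝ} (hx : IsCadlagOn T x)
    {ε : ℝ} (hε : 0 < ε) :
    ∀ᶠ n in atTop, ∀ j ≤ 2 ^ n, |riemannSum x (fun t => (t : ℝ)) T n j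
      - ∫ s in Iic (grid T n j), Function.leftLim x s ∂timeMeasure| < ε := by
  obtain ⟨C, hC⟩ := hx.bounded
  set f : ℕ → ℝ≥0 → ℝ := fun n => stepPath T n (fun i => x (grid T n i)) with hf
  have hfint : ∀ n, Integrable (f n) (timeMeasure.restrict (Iic T)) := fun n =>
    Integrable.of_bound (measurable_stepPath T n _).aestronglyMeasurable C (by
      filter_upwards [ae_timeMeasure_pos T] with s hs
      exact abs_stepPath_le (fun i hi => hC _ (grid_le T hi.le)) hs.1 hs.2)
  have hlim : Tendsto (fun n => ∫ s in Iic T, |f n s - Function.leftLim x s| ∂timeMeasure) atTop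
      (𝓝 (∫ s in Iic T, (0 : ℝ) ∂timeMeasure)) := by
    refine tendsto_integral_of_dominated_convergence (fun _ => C + C)
      (fun n => ((hfint n).sub hx.integrable_leftLim).abs.1) (integrable_const _) ?_ ?_
    · intro n
      filter_upwards [ae_timeMeasure_pos T] with s hs
      rw [Real.norm_eq_abs, abs_abs]
      exact (abs_sub _ _).trans (add_le_add
        (abs_stepPath_le (fun i hi => hC _ (grid_le T hi.le)) hs.1 hs.2)
        (hx.abs_leftLim_le hC hs.1 hs.2))
    · filter_upwards [ae_timeMeasure_pos T] with s hs
      have := ((hx.stepPath_tendsto hs.1 hs.2).sub_const (Function.leftLim x s)).abs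
      simpa using this
  rw [integral_zero] at hlim
  filter_upwards [hlim.eventually (gt_mem_nhds hε)] with n hn j hj
  have hsub : Iic (grid T n j) ⊆ Iic T := Iic_subset_Iic.2 (grid_le T hj)
  have e : riemannSum x (fun t => (t : ℝ)) T n j = ∫ s in Iic (grid T n j), f n s ∂timeMeasure := by
    rw [hf, integral_stepPath T n _ hj]; rfl
  have i1 := (hfint n).mono_measure (Measure.restrict_mono_set timeMeasure hsub)
  have i2 := hx.integrable_leftLim.mono_measure (Measure.restrict_mono_set timeMeasure hsub)
  rw [e, ← integral_sub i1 i2]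
  refine (abs_integral_le_integral_abs).trans_lt (lt_of_le_of_lt ?_ hn)
  exact integral_mono_measure (Measure.restrict_mono_set timeMeasure hsub)
    (ae_of_all _ fun _ => abs_nonneg _) ((hfint n).sub hx.integrable_leftLim).abs

/-! ### Simple processes on dyadic grids -/

section Probability

variable {Ω : Type*} {F : ℝ≥0 → MeasurableSpace Ω}

/-- The simple process with coefficient `C i` on the `i`-th cell of the dyadic grid of level `n`. -/
noncomputable def gridProcess (F : ℝ≥0 → MeasurableSpace Ω) (T : ℝ≥0) (n : ℕ) (C : ℕ → Ω → ℝ)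
    (hC : ∀ i < 2 ^ n, Measurable[F (grid T n i)] (C i)) : SimpleProcess F where
  n := 2 ^ n
  -- Beyond the horizon the coefficients are set to zero, since their adaptedness is required only
  -- on the cells inside `[0,T]`.
  time := grid T n
  mono := grid_mono T n
  coef i := if i < 2 ^ n then C i else 0
  measurable_coef i := by
    split_ifs with h
    · exact hC i h
    · exact @measurable_zero _ _ _ (F (grid T n i)) _

theorem gridProcess_value {T : ℝ≥0} {n : ℕ} {C : ℕ → Ω → ℝ}
    (hC : ∀ i < 2 ^ n, Measurable[F (grid T n i)] (C i)) (s : ℝ≥0) (ω : Ω) :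
    (gridProcess F T n C hC).value s ω = stepPath T n (fun i => C i ω) s := by
  unfold SimpleProcess.value gridProcess stepPath
  refine Finset.sum_congr rfl fun i hi => ?_
  simp only [Finset.mem_range.1 hi, if_true]

theorem gridProcess_integral_grid {T : ℝ≥0} {n : ℕ} {C : ℕ → Ω → ℝ}
    (hC : ∀ i < 2 ^ n, Measurable[F (grid T n i)] (C i)) (B : ℝ≥0 → Ω → ℝ) {j : ℕ}
    (hj : j ≤ 2 ^ n) (ω : Ω) :
    (gridProcess F T n C hC).integral B (grid T n j) ω
      = ∑ i ∈ Finset.range j, C i ω * incr (B · ω) T n i := by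
  unfold SimpleProcess.integral gridProcess
  have hterm : ∀ i ∈ Finset.range (2 ^ n), (if i < 2 ^ n then C i else 0) ω
      * (B (min (grid T n (i + 1)) (grid T n j)) ω - B (min (grid T n i) (grid T n j)) ω)
      = if i < j then C i ω * incr (B · ω) T n i else 0 := by
    intro i hi
    rw [if_pos (Finset.mem_range.1 hi)]
    split_ifs with h
    · rw [min_eq_left (grid_mono T n h), min_eq_left (grid_mono T n h.le)]; rfl
    · have h1 := grid_mono T n (not_lt.1 h)
      rw [min_eq_right h1, min_eq_right (h1.trans (grid_mono T n (Nat.le_succ i)))]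
      simp
  simp only
  rw [Finset.sum_congr rfl hterm, ← Finset.sum_filter]
  congr 1
  ext i
  simp only [Finset.mem_filter, Finset.mem_range]
  omega

variable [m0 : MeasurableSpace Ω] {P : Measure Ω}

/-- Dominated convergence path by path, then passage to convergence in probability. The coefficients
may differ from the sampled integrand by a uniformly vanishing error; this freedom is what later
removes the linear error sum of the Euler scheme. -/
theorem gridProcess_approximates [IsProbabilityMeasure P] (hFle : ∀ t, F t ≤ m0) {T : ℝ≥0}
    {X : ℝ≥0 → Ω → ℝ} (hX : ∀ t ≤ T, Measurable (X t))
    (hcad : ∀ᵐ ω ∂P, IsCadlagOn T (X · ω)) {b : Ω → ℝ} (hb : Measurable b) {ns : ℕ → ℕ}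
    (hns : Tendsto ns atTop atTop) {C : ℕ → ℕ → Ω → ℝ}
    (hC : ∀ l, ∀ i < 2 ^ ns l, Measurable[F (grid T (ns l) i)] (C l i))
    (hlim : ∀ᵐ ω ∂P, ∀ ε > 0, ∀ᶠ l in atTop, ∀ i < 2 ^ ns l,
      |C l i ω - X (grid T (ns l) i) ω * b ω| < ε) :
    ApproximatesInL2 P T (fun l => gridProcess F T (ns l) (C l) (hC l))
      (fun s ω => leftValue X s ω * b ω) := by
  -- a jointly measurable version of the left limits
  set st : ℕ → ℝ≥0 × Ω → ℝ := fun n p => stepPath T n (fun i => X (grid T n i) p.2) p.1 with hst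
  have hmeasStep : ∀ (n : ℕ) (D : ℕ → Ω → ℝ), (∀ i < 2 ^ n, Measurable (D i)) →
      Measurable (fun p : ℝ≥0 × Ω => stepPath T n (fun i => D i p.2) p.1) := by
    intro n D hD
    unfold stepPath
    refine Finset.measurable_fun_sum _ fun i hi => ?_
    have : (fun p : ℝ≥0 × Ω => (Ioc (grid T n i) (grid T n (i + 1))).indicator (fun _ => D i p.2) p.1)
        = (Prod.fst ⁻¹' (Ioc (grid T n i) (grid T n (i + 1)))).indicator (fun p => D i p.2) := by
      ext p; simp [indicator]
    rw [this]
    exact ((hD i (Finset.mem_range.1 hi)).comp measurable_snd).indicator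
      (measurable_fst measurableSet_Ioc)
  have hstm : ∀ n, Measurable (st n) := fun n =>
    hmeasStep n _ fun i hi => hX _ (grid_le T hi.le)
  set H : ℝ≥0 × Ω → ℝ := fun p => limsup (fun n => st n p) atTop with hH
  have hHm : Measurable H := Measurable.limsup hstm
  set V : ℕ → ℝ≥0 × Ω → ℝ := fun l p => stepPath T (ns l) (fun i => C l i p.2) p.1 with hV
  have hVm : ∀ l, Measurable (V l) := fun l =>
    hmeasStep (ns l) _ fun i hi => (hC l i hi).mono (hFle _) le_rfl
  set f : ℕ → Ω → ℝ≥0∞ := fun l ω =>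
    ∫⁻ s in Iic T, ENNReal.ofReal ((V l (s, ω) - H (s, ω) * b ω) ^ 2) ∂timeMeasure with hf
  have hfm : ∀ l, Measurable (f l) := fun l => by
    refine Measurable.lintegral_prod_left' (μ := timeMeasure.restrict (Iic T))
      (f := fun p : ℝ≥0 × Ω => ENNReal.ofReal ((V l p - H p * b p.2) ^ 2)) ?_
    exact (((hVm l).sub (hHm.mul (hb.comp measurable_snd))).pow_const 2).ennreal_ofReal
  have hHeq : ∀ᵐ ω ∂P, ∀ s, 0 < s → s ≤ T → H (s, ω) = leftValue X s ω := by
    filter_upwards [hcad] with ω hω s hs hsT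
    exact (hω.stepPath_tendsto hs hsT).limsup_eq
  have hfeq : ∀ᵐ ω ∂P, ∀ l, ∫⁻ s in Iic T, ENNReal.ofReal
      (((gridProcess F T (ns l) (C l) (hC l)).value s ω - leftValue X s ω * b ω) ^ 2) ∂timeMeasure
      = f l ω := by
    filter_upwards [hHeq] with ω hω l
    refine lintegral_congr_ae ?_
    filter_upwards [ae_timeMeasure_pos T] with s hs
    rw [gridProcess_value, ← hω s hs.1 hs.2]
  have hftend : ∀ᵐ ω ∂P, Tendsto (fun l => f l ω) atTop (𝓝 0) := by
    filter_upwards [hcad, hHeq, hlim] with ω hω hHω hlω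
    obtain ⟨D, hD⟩ := hω.bounded
    have hbd : ∀ᶠ l in atTop, ∀ i < 2 ^ ns l, |C l i ω| ≤ D * |b ω| + 1 := by
      filter_upwards [hlω 1 one_pos] with l hl i hi
      have h1 := hl i hi
      have h2 : |X (grid T (ns l) i) ω * b ω| ≤ D * |b ω| := by
        rw [abs_mul]
        exact mul_le_mul_of_nonneg_right (hD _ (grid_le T hi.le)) (abs_nonneg _)
      have h3 := abs_sub_abs_le_abs_sub (C l i ω) (X (grid T (ns l) i) ω * b ω)
      linarith
    obtain ⟨l₀, hl₀⟩ := eventually_atTop.1 hbd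
    -- The coefficients are bounded only from the random level `l₀` on, so the sequence is shifted
    -- before domination.
    rw [← tendsto_add_atTop_iff_nat l₀]
    have h0 : (0 : ℝ≥0∞) = ∫⁻ s in Iic T, (0 : ℝ≥0∞) ∂timeMeasure := by simp
    rw [h0]
    refine tendsto_lintegral_of_dominated_convergence'
      (fun _ => ENNReal.ofReal ((2 * (D * |b ω| + 1)) ^ 2)) (fun l => ?_) (fun l => ?_) ?_ ?_
    · have h1 : Measurable (fun s => V (l + l₀) (s, ω)) := (hVm _).comp measurable_prodMk_right
      have h2 : Measurable (fun s => H (s, ω)) := hHm.comp measurable_prodMk_right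
      exact ((h1.sub (h2.mul_const _)).pow_const 2).ennreal_ofReal.aemeasurable
    · filter_upwards [ae_timeMeasure_pos T] with s hs
      refine ENNReal.ofReal_le_ofReal (sq_le_sq' ?_ ?_) <;>
      · have h1 := abs_le.1 (abs_stepPath_le (a := fun i => C (l + l₀) i ω)
          (hl₀ (l + l₀) (by omega)) hs.1 hs.2)
        have h2 := abs_le.1 (hω.abs_leftLim_le hD hs.1 hs.2)
        have h3 : |leftValue X s ω * b ω| ≤ D * |b ω| := by
          rw [abs_mul]
          exact mul_le_mul_of_nonneg_right (abs_le.2 h2) (abs_nonneg _)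
        have h4 := abs_le.1 h3
        rw [hHω s hs.1 hs.2]
        simp only [hV]
        linarith [h1.1, h1.2, h4.1, h4.2]
    · rw [lintegral_const]
      exact ENNReal.mul_ne_top ENNReal.ofReal_ne_top (measure_ne_top _ _)
    · filter_upwards [ae_timeMeasure_pos T] with s hs
      have hdiff : Tendsto (fun l => V l (s, ω) - H (s, ω) * b ω) atTop (𝓝 0) := by
        have h1 : Tendsto (fun l => st (ns l) (s, ω) * b ω - H (s, ω) * b ω) atTop (𝓝 0) := by
          have h2 := ((hω.stepPath_tendsto hs.1 hs.2).comp hns).mul_const (b ω)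
          have h3 := h2.sub_const (H (s, ω) * b ω)
          rw [hHω s hs.1 hs.2] at h3 ⊢
          simpa [leftValue, hst] using h3
        have h4 : Tendsto (fun l => V l (s, ω) - st (ns l) (s, ω) * b ω) atTop (𝓝 0) := by
          rw [Metric.tendsto_nhds]
          intro ε hε
          filter_upwards [hlω ε hε] with l hl
          obtain ⟨i, hi, hi1, hi2⟩ := exists_grid_Ioc hs.1 hs.2 (ns l)
          rw [Real.dist_0_eq_abs]
          simp only [hV, hst]
          rw [stepPath_eq _ hi hi1 hi2, stepPath_eq _ hi hi1 hi2]
          exact hl i hi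
        have := h4.add h1
        simpa using this
      have h5 := (hdiff.pow 2).comp (tendsto_add_atTop_nat l₀)
      have h6 := (ENNReal.continuous_ofReal.tendsto _).comp h5
      simpa [Function.comp_def] using h6
  intro ε hε
  have hmain : Tendsto (fun l => P {ω | ε ≤ f l ω}) atTop (𝓝 0) := by
    have := tendsto_measure_of_ae_tendsto_indicator_of_isFiniteMeasure (μ := P) atTop
      (A := ∅) (As := fun l => {ω | ε ≤ f l ω}) MeasurableSet.empty
      (fun l => measurableSet_le measurable_const (hfm l)) (by
        filter_upwards [hftend] with ω hω
        filter_upwards [hω.eventually (gt_mem_nhds hε)] with l hl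
        simp [hl])
    simpa using this
  refine hmain.congr fun l => measure_congr ?_
  filter_upwards [hfeq] with ω hω
  apply propext
  change ε ≤ f l ω ↔ ε ≤ _
  rw [← hω l]

/-- Convergence in probability, uniformly on `[0,T]`, of two sequences of processes implies almost
sure uniform convergence along a common subsequence. -/
theorem exists_subseq_uniform {T : ℝ≥0} {D D' : ℕ → ℝ≥0 → Ω → ℝ}
    (h : ∀ ε > 0, Tendsto (fun n => P {ω | ∃ t ≤ T, ε ≤ |D n t ω|}) atTop (𝓝 0))
    (h' : ∀ ε > 0, Tendsto (fun n => P {ω | ∃ t ≤ T, ε ≤ |D' n t ω|}) atTop (𝓝 0)) :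
    ∃ ns : ℕ → ℕ, StrictMono ns ∧ ∀ᵐ ω ∂P, ∀ ε > 0, ∀ᶠ l in atTop, ∀ t ≤ T,
      |D (ns l) t ω| < ε ∧ |D' (ns l) t ω| < ε := by
  set S : ℝ → ℕ → Set Ω := fun ε n => {ω | ∃ t ≤ T, ε ≤ |D n t ω|} ∪ {ω | ∃ t ≤ T, ε ≤ |D' n t ω|}
    with hS
  have hSlim : ∀ ε > 0, Tendsto (fun n => P (S ε n)) atTop (𝓝 0) := by
    intro ε hε
    have := (h ε hε).add (h' ε hε)
    rw [add_zero] at this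
    exact tendsto_of_tendsto_of_tendsto_of_le_of_le tendsto_const_nhds this
      (fun _ => zero_le) (fun n => measure_union_le _ _)
  -- Deviations above `2 ^ (-k)` get probability at most `2 ^ (-k)`, so that Borel–Cantelli applies
  -- along the selected indices.
  have hsel : ∀ k : ℕ, ∃ N, ∀ n ≥ N, P (S ((1 / 2 : ℝ) ^ k) n) ≤ (1 / 2 : ℝ≥0∞) ^ k := by
    intro k
    have hpos : (0 : ℝ≥0∞) < (1 / 2 : ℝ≥0∞) ^ k := by
      apply ENNReal.pow_pos; simp
    exact eventually_atTop.1 ((hSlim _ (by positivity)).eventually (ge_mem_nhds hpos))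
  obtain ⟨ns, hns, hP⟩ := extraction_forall_of_eventually' hsel
  refine ⟨ns, hns, ?_⟩
  have hsum : ∑' k, P (S ((1 / 2 : ℝ) ^ k) (ns k)) ≠ ∞ := by
    refine ne_top_of_le_ne_top ?_ (ENNReal.tsum_le_tsum hP)
    rw [ENNReal.tsum_geometric]
    simp
  filter_upwards [ae_eventually_notMem hsum] with ω hω ε hε
  have hsmall : ∀ᶠ k : ℕ in atTop, (1 / 2 : ℝ) ^ k < ε :=
    (tendsto_pow_atTop_nhds_zero_of_lt_one (by norm_num) (by norm_num)).eventually
      (gt_mem_nhds hε)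
  filter_upwards [hω, hsmall] with k hk hkε t ht
  simp only [hS, mem_union, mem_ofPred_eq, not_or, not_exists, not_and, not_le] at hk
  exact ⟨(hk.1 t ht).trans hkε, (hk.2 t ht).trans hkε⟩

end Probability

/-! ### The wealth equation is solved by the stochastic exponential -/

/-- The pathwise properties of a pair of independent Brownian motions. -/
structure IsDrivingPath (T : ℝ≥0) (w w₀ : ℝ≥0 → ℝ) : Prop where
  cont : Continuous w
  cont₀ : Continuous w₀
  zero : w 0 = 0
  zero₀ : w₀ 0 = 0
  cov : HasDyadicCov w w T 1
  cov₀ : HasDyadicCov w₀ w₀ T 1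
  cross : HasDyadicCov w w₀ T 0

/-- On `[0,T]` the measure `n` is the sum of finitely many point masses with distinct positive
times. -/
structure HasAtoms {E : Type*} [MeasurableSpace E] (n : Measure (ℝ≥0 × E)) (T : ℝ≥0)
    (K : Finset ℕ) (p : ℕ → ℝ≥0 × E) : Prop where
  restrict_eq : n.restrict (Iic T ×ˢ univ) = ∑ k ∈ K, Measure.dirac (p k)
  pos : ∀ k ∈ K, 0 < (p k).1 ∧ (p k).1 ≤ T
  inj : Set.InjOn (fun k => (p k).1) K

theorem HasAtoms.setIntegral {E : Type*} [MeasurableSpace E] [MeasurableSingletonClass E]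
    {n : Measure (ℝ≥0 × E)} {T : ℝ≥0} {K : Finset ℕ} {p : ℕ → ℝ≥0 × E} (h : HasAtoms n T K p)
    {t : ℝ≥0} (ht : t ≤ T) (f : ℝ≥0 × E → ℝ) :
    ∫ q in Iic t ×ˢ univ, f q ∂n = ∑ k ∈ K with (p k).1 ≤ t, f (p k) := by
  have hsub : (Iic t ×ˢ univ : Set (ℝ≥0 × E)) ⊆ Iic T ×ˢ univ :=
    prod_mono (Iic_subset_Iic.2 ht) subset_rfl
  have hS : MeasurableSet (Iic t ×ˢ univ : Set (ℝ≥0 × E)) := measurableSet_Iic.prod .univ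
  rw [← Measure.restrict_restrict_of_subset hsub, h.restrict_eq, ← integral_indicator hS,
    integral_finsetSum_measure fun k _ => integrable_dirac (by simp), Finset.sum_filter]
  refine Finset.sum_congr rfl fun k _ => ?_
  rw [integral_dirac]
  simp [indicator]

theorem riemannSum_combination (x w w₀ : ℝ≥0 → ℝ) (A B B₀ : ℝ) (T : ℝ≥0) (n j : ℕ) :
    riemannSum x (fun t => A * t + B * w t + B₀ * w₀ t) T n j
      = A * riemannSum x (fun t => (t : ℝ)) T n j + B * riemannSum x w T n j
        + B₀ * riemannSum x w₀ T n j := by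
  unfold riemannSum
  rw [Finset.mul_sum, Finset.mul_sum, Finset.mul_sum, ← Finset.sum_add_distrib,
    ← Finset.sum_add_distrib]
  refine Finset.sum_congr rfl fun i _ => ?_
  unfold incr
  ring

set_option maxHeartbeats 1000000 in
/-- Any wealth process equals the stochastic exponential: a geometric Brownian motion multiplied by
the gross returns of the jumps. -/
theorem IsWealthProcess.eq_exp_mul_prod {Ω E : Type*} [m0 : MeasurableSpace Ω] [MeasurableSpace E]
    [MeasurableSingletonClass E] {P : Measure Ω} [IsProbabilityMeasure P]
    {F : ℝ≥0 → MeasurableSpace Ω} (hFmono : Monotone F) (hFle : ∀ t, F t ≤ m0) {T : ℝ≥0}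
    {W W₀ : ℝ≥0 → Ω → ℝ} (hW : ∀ t, Measurable[F t] (W t)) (hW₀ : ∀ t, Measurable[F t] (W₀ t))
    {N : Ω → Measure (ℝ≥0 × E)} {x₀ r κ σ σ₀ : Ω → ℝ} {η ζ : Ω → E → ℝ} {φ : Ω → ℝ → ℝ}
    {X : ℝ≥0 → Ω → ℝ} (h : IsWealthProcess P F T W W₀ N x₀ r κ σ σ₀ η ζ φ X)
    (hr : Measurable[F 0] r) (hκ : Measurable[F 0] κ) (hσ : Measurable[F 0] σ)
    (hσ₀ : Measurable[F 0] σ₀) (hφ : Measurable[F 0] (fun ω => φ ω 0))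
    (hpath : ∀ᵐ ω ∂P, IsDrivingPath T (W · ω) (W₀ · ω)) :
    ∀ᵐ ω ∂P, ∀ (K : Finset ℕ) (p : ℕ → ℝ≥0 × E), HasAtoms (N ω) T K p → ∀ t ≤ T,
      X t ω = x₀ ω * Real.exp (logReturn (fun s => (r ω + φ ω 0 * (κ ω - r ω)) * s
          + (σ ω * φ ω 0) * W s ω + (σ₀ ω * φ ω 0) * W₀ s ω)
          ((σ ω * φ ω 0) ^ 2 + (σ₀ ω * φ ω 0) ^ 2) t)
        * ∏ k ∈ K with (p k).1 ≤ t, (1 + η ω (p k).2 * φ ω (ζ ω (p k).2)) := by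
  obtain ⟨I, I₀, hI, hI₀, hdyn⟩ := h.dynamics
  set A : Ω → ℝ := fun ω => r ω + φ ω 0 * (κ ω - r ω) with hAdef
  set B : Ω → ℝ := fun ω => σ ω * φ ω 0 with hBdef
  set B₀ : Ω → ℝ := fun ω => σ₀ ω * φ ω 0 with hB₀def
  have hA : Measurable[F 0] A := hr.add (hφ.mul (hκ.sub hr))
  have hB : Measurable[F 0] B := hσ.mul hφ
  have hB₀ : Measurable[F 0] B₀ := hσ₀.mul hφ
  have up : ∀ {s t : ℝ≥0} {f : Ω → ℝ}, s ≤ t → Measurable[F s] f → Measurable[F t] f :=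
    fun hst hf => hf.mono (hFmono hst) le_rfl
  have hcad : ∀ᵐ ω ∂P, IsCadlagOn T (X · ω) := h.cadlag
  set M : Ω → ℝ≥0 → ℝ := fun ω t => A ω * t + B ω * W t ω + B₀ ω * W₀ t ω with hMdef
  have hM : ∀ t, Measurable[F t] (fun ω => M ω t) := fun t =>
    (((up zero_le hA).mul_const _).add ((up zero_le hB).mul (hW t))).add
      ((up zero_le hB₀).mul (hW₀ t))
  have hXg : ∀ n, ∀ i ≤ 2 ^ n, Measurable[F (grid T n i)] (X (grid T n i)) := fun n i hi =>
    h.adapted _ (grid_le T hi)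
  have hXm : ∀ t ≤ T, Measurable (X t) := fun t ht => (h.adapted t ht).mono (hFle t) le_rfl
  have hinc : ∀ n i, Measurable[F (grid T n (i + 1))] (fun ω => incr (M ω) T n i) := fun n i =>
    (hM _).sub (up (grid_mono T n (Nat.le_succ i)) (hM _))
  have hRS : ∀ n, ∀ j ≤ 2 ^ n,
      Measurable[F (grid T n j)] (fun ω => riemannSum (X · ω) (M ω) T n j) := by
    intro n j hj
    unfold riemannSum
    refine Finset.measurable_fun_sum _ fun i hi => ?_
    have hij := Finset.mem_range.1 hi
    exact (up (grid_mono T n hij.le) (hXg n i (hij.le.trans hj))).mul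
      (up (grid_mono T n hij) (hinc n i))
  have hEP : ∀ n j, Measurable[F (grid T n j)] (fun ω => eulerProd (M ω) T n j) := by
    intro n j
    unfold eulerProd
    refine Finset.measurable_fun_prod _ fun i hi => ?_
    exact (up (grid_mono T n (Finset.mem_range.1 hi)) (hinc n i)).const_add 1
  -- the Riemann sums converge to the stochastic integrals
  have hCB : ∀ (b : Ω → ℝ), Measurable[F 0] b → ∀ n, ∀ i < 2 ^ n,
      Measurable[F (grid T n i)] (fun ω => X (grid T n i) ω * b ω) := fun b hb n i hi =>
    (hXg n i hi.le).mul (up zero_le hb)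
  have hap : ∀ (b : Ω → ℝ) (hb : Measurable[F 0] b), ApproximatesInL2 P T
      (fun n => gridProcess F T n (fun i ω => X (grid T n i) ω * b ω) (hCB b hb n))
      (fun s ω => leftValue X s ω * b ω) := fun b hb =>
    gridProcess_approximates hFle hXm hcad (hb.mono (hFle 0) le_rfl) tendsto_id _
      (ae_of_all _ fun ω ε hε => Eventually.of_forall fun n i _ => by simpa using hε)
  obtain ⟨ns, hns, hconv⟩ := exists_subseq_uniform (P := P) (T := T)
    (D := fun n t ω => (gridProcess F T n (fun i ω => X (grid T n i) ω * B ω)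
      (hCB B hB n)).integral W t ω - I t ω)
    (D' := fun n t ω => (gridProcess F T n (fun i ω => X (grid T n i) ω * B₀ ω)
      (hCB B₀ hB₀ n)).integral W₀ t ω - I₀ t ω)
    (hI.tendsto _ (hap B hB)) (hI₀.tendsto _ (hap B₀ hB₀))
  have hnst := hns.tendsto_atTop
  -- The continuous-noise part of the wealth. The integral processes `I` and `I₀` are not assumed
  -- adapted, so neither is `u`.
  set u : Ω → ℝ≥0 → ℝ := fun ω t =>
    (∫ s in Iic t, leftValue X s ω * A ω ∂timeMeasure) + I t ω + I₀ t ω with hu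
  have hint : ∀ (b : Ω → ℝ) (hb : Measurable[F 0] b) (V : ℝ≥0 → Ω → ℝ) (ω : Ω) (n j : ℕ),
      j ≤ 2 ^ n → (gridProcess F T n (fun i ω => X (grid T n i) ω * b ω)
        (hCB b hb n)).integral V (grid T n j) ω = b ω * riemannSum (X · ω) (V · ω) T n j := by
    intro b hb V ω n j hj
    rw [gridProcess_integral_grid _ _ hj, riemannSum, Finset.mul_sum]
    exact Finset.sum_congr rfl fun i _ => by ring
  have hU : ∀ᵐ ω ∂P, ∀ ε > 0, ∀ᶠ l in atTop, ∀ j ≤ 2 ^ ns l,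
      |u ω (grid T (ns l) j) - riemannSum (X · ω) (M ω) T (ns l) j| < ε := by
    filter_upwards [hconv, hcad] with ω hω hc ε hε
    filter_upwards [hω (ε / 3) (by positivity), hnst.eventually
      (hc.riemannSum_time (ε := ε / (3 * (|A ω| + 1))) (by positivity))] with l h1 h2 j hj
    obtain ⟨h3, h4⟩ := h1 _ (grid_le T hj)
    rw [hint B hB W ω _ _ hj] at h3
    rw [hint B₀ hB₀ W₀ ω _ _ hj] at h4
    have h5 : |A ω * riemannSum (X · ω) (fun t => (t : ℝ)) T (ns l) j
        - ∫ s in Iic (grid T (ns l) j), leftValue X s ω * A ω ∂timeMeasure| < ε / 3 := by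
      rw [integral_mul_const, mul_comm (A ω), ← sub_mul, abs_mul]
      calc _ ≤ ε / (3 * (|A ω| + 1)) * |A ω| := by
            refine mul_le_mul_of_nonneg_right ?_ (abs_nonneg _)
            exact (h2 j hj).le
        _ = ε / 3 * (|A ω| / (|A ω| + 1)) := by field_simp
        _ < ε / 3 * 1 := by
            gcongr
            rw [div_lt_one (by positivity)]; linarith
        _ = ε / 3 := mul_one _
    have h6 : u ω (grid T (ns l) j) - riemannSum (X · ω) (M ω) T (ns l) j
        = -(A ω * riemannSum (X · ω) (fun t => (t : ℝ)) T (ns l) j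
          - ∫ s in Iic (grid T (ns l) j), leftValue X s ω * A ω ∂timeMeasure)
          - (B ω * riemannSum (X · ω) (W · ω) T (ns l) j - I (grid T (ns l) j) ω)
          - (B₀ ω * riemannSum (X · ω) (W₀ · ω) T (ns l) j - I₀ (grid T (ns l) j) ω) := by
      simp only [hMdef, riemannSum_combination, hu]
      ring
    rw [h6]
    rw [abs_lt] at h3 h4 h5 ⊢
    constructor <;> linarith
  -- an adapted version of the continuous part at the grid points
  set U : ℕ → ℕ → Ω → ℝ := fun n i ω => limsup (fun l => if n ≤ ns l then
    riemannSum (X · ω) (M ω) T (ns l) (i * 2 ^ (ns l - n)) else 0) atTop with hUdef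
  have hrefine : ∀ n l i, n ≤ ns l → grid T (ns l) (i * 2 ^ (ns l - n)) = grid T n i := by
    intro n l i hn
    obtain ⟨q, hq⟩ := Nat.exists_eq_add_of_le hn
    rw [hq, Nat.add_sub_cancel_left, grid_refine]
  have hile : ∀ n l i, n ≤ ns l → i ≤ 2 ^ n → i * 2 ^ (ns l - n) ≤ 2 ^ ns l := by
    intro n l i hn hi
    calc i * 2 ^ (ns l - n) ≤ 2 ^ n * 2 ^ (ns l - n) := by gcongr
      _ = 2 ^ ns l := by rw [← pow_add]; congr 1; omega
  have hUm : ∀ n, ∀ i ≤ 2 ^ n, Measurable[F (grid T n i)] (U n i) := by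
    intro n i hi
    refine @Measurable.limsup _ _ _ _ _ (F (grid T n i)) _ _ _ _ fun l => ?_
    by_cases hn : n ≤ ns l
    · simp only [hn, if_true]
      rw [← hrefine n l i hn]
      exact hRS (ns l) _ (hile n l i hn hi)
    · simp only [hn, if_false]
      exact measurable_const
  have hUeq : ∀ᵐ ω ∂P, ∀ n, ∀ i ≤ 2 ^ n, U n i ω = u ω (grid T n i) := by
    filter_upwards [hU] with ω hω n i hi
    refine Tendsto.limsup_eq ?_
    rw [Metric.tendsto_nhds]
    intro ε hε
    filter_upwards [hω ε hε, hnst.eventually (eventually_ge_atTop n)] with l hl hn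
    have h1 := hl _ (hile n l i hn hi)
    rw [hrefine n l i hn] at h1
    rw [if_pos hn, dist_comm, Real.dist_eq]
    exact h1
  -- the perturbation of the integrand that is asymptotically negligible
  set G : ℕ → ℕ → Ω → ℝ := fun l i ω =>
    (U (ns l) i ω - riemannSum (X · ω) (M ω) T (ns l) i) / eulerProd (M ω) T (ns l) i with hG
  have hGm : ∀ l, ∀ i ≤ 2 ^ ns l, Measurable[F (grid T (ns l) i)] (G l i) := fun l i hi =>
    ((hUm _ i hi).sub (hRS _ i hi)).div (hEP _ i)
  have hQV : ∀ᵐ ω ∂P, Continuous (M ω) ∧ M ω 0 = 0 ∧ HasDyadicQV (M ω) T (B ω ^ 2 + B₀ ω ^ 2) := by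
    filter_upwards [hpath] with ω hω
    refine ⟨?_, by simp [hMdef, hω.zero, hω.zero₀],
      hω.cov.qv_combination hω.cont hω.cont₀ hω.cov₀ hω.cross _ _ _⟩
    have := hω.cont
    have := hω.cont₀
    simp only [hMdef]
    fun_prop
  have hGs : ∀ᵐ ω ∂P, ∀ ε > 0, ∀ᶠ l in atTop, ∀ i ≤ 2 ^ ns l, |G l i ω| < ε := by
    filter_upwards [hU, hUeq, hQV] with ω hω heq hq ε hε
    refine div_eulerProd_small hq.1 hq.2.1 (by positivity) hq.2.2 hnst
      (δ := fun l j => U (ns l) j ω - riemannSum (X · ω) (M ω) T (ns l) j) ?_ hε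
    intro ε' hε'
    filter_upwards [hω ε' hε'] with l hl j hj
    rw [heq _ j hj]
    exact hl j hj
  have hCG : ∀ (b : Ω → ℝ), Measurable[F 0] b → ∀ l, ∀ i < 2 ^ ns l,
      Measurable[F (grid T (ns l) i)]
        (fun ω => X (grid T (ns l) i) ω * b ω + G l i ω * b ω) := fun b hb l i hi =>
    ((hXg _ i hi.le).mul (up zero_le hb)).add ((hGm l i hi.le).mul (up zero_le hb))
  -- The crucial use of the Itô integral. The integrand perturbed by `G` approximates the same
  -- process, so its integrals have the same limit; subtracting the unperturbed ones shows that the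
  -- sums of `G` against the Brownian increments vanish uniformly.
  have hapG : ∀ (b : Ω → ℝ) (hb : Measurable[F 0] b), ApproximatesInL2 P T
      (fun l => gridProcess F T (ns l)
        (fun i ω => X (grid T (ns l) i) ω * b ω + G l i ω * b ω) (hCG b hb l))
      (fun s ω => leftValue X s ω * b ω) := fun b hb => by
    refine gridProcess_approximates hFle hXm hcad (hb.mono (hFle 0) le_rfl) hnst
      (C := fun l i ω => X (grid T (ns l) i) ω * b ω + G l i ω * b ω) _ ?_
    filter_upwards [hGs] with ω hω ε hε
    filter_upwards [hω (ε / (|b ω| + 1)) (by positivity)] with l hl i hi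
    rw [add_sub_cancel_left, abs_mul]
    calc |G l i ω| * |b ω| ≤ ε / (|b ω| + 1) * |b ω| := by
          gcongr; exact (hl i hi.le).le
      _ = ε * (|b ω| / (|b ω| + 1)) := by ring
      _ < ε * 1 := by
          gcongr
          rw [div_lt_one (by positivity)]; linarith
      _ = ε := mul_one _
  obtain ⟨ks, hks, hconvG⟩ := exists_subseq_uniform (P := P) (T := T)
    (D := fun l t ω => (gridProcess F T (ns l)
      (fun i ω => X (grid T (ns l) i) ω * B ω + G l i ω * B ω) (hCG B hB l)).integral W t ω - I t ω)
    (D' := fun l t ω => (gridProcess F T (ns l)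
      (fun i ω => X (grid T (ns l) i) ω * B₀ ω + G l i ω * B₀ ω)
        (hCG B₀ hB₀ l)).integral W₀ t ω - I₀ t ω)
    (hI.tendsto _ (hapG B hB)) (hI₀.tendsto _ (hapG B₀ hB₀))
  have hkst := hks.tendsto_atTop
  have hintG : ∀ (b : Ω → ℝ) (hb : Measurable[F 0] b) (V : ℝ≥0 → Ω → ℝ) (ω : Ω) (l j : ℕ),
      j ≤ 2 ^ ns l → (gridProcess F T (ns l)
        (fun i ω => X (grid T (ns l) i) ω * b ω + G l i ω * b ω) (hCG b hb l)).integral V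
          (grid T (ns l) j) ω = b ω * riemannSum (X · ω) (V · ω) T (ns l) j
          + ∑ i ∈ Finset.range j, G l i ω * (b ω * incr (V · ω) T (ns l) i) := by
    intro b hb V ω l j hj
    rw [gridProcess_integral_grid _ _ hj, riemannSum, Finset.mul_sum, ← Finset.sum_add_distrib]
    exact Finset.sum_congr rfl fun i _ => by ring
  filter_upwards [hpath, hcad, hdyn, hconv, hU, hUeq, hQV, hGs, hconvG] with ω hp hc hd hcv hUω
    hUe hq hGω hcG K p hKp t ht
  obtain ⟨hMc, hM0, hMq⟩ := hq
  set γ : ℕ → ℝ := fun k => η ω (p k).2 * φ ω (ζ ω (p k).2) with hγ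
  have hcnn : 0 ≤ B ω ^ 2 + B₀ ω ^ 2 := by positivity
  have hx : ∀ t ≤ T, X t ω = x₀ ω + u ω t
      + ∑ k ∈ K with (p k).1 ≤ t, Function.leftLim (X · ω) (p k).1 * γ k := by
    intro t ht
    rw [hd t ht, hKp.setIntegral ht]
    simp only [hu, leftValue, hγ, hAdef]
    ring
  have hGsum : ∀ ε > 0, ∀ᶠ l in atTop, ∀ j ≤ 2 ^ ns (ks l), |∑ i ∈ Finset.range j,
      (u ω (grid T (ns (ks l)) i) - riemannSum (X · ω) (M ω) T (ns (ks l)) i)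
        / eulerProd (M ω) T (ns (ks l)) i * incr (M ω) T (ns (ks l)) i| < ε := by
    intro ε hε
    -- Five errors: the perturbed and the unperturbed integral for each of the two Brownian motions,
    -- and the drift, which is handled by finite variation.
    filter_upwards [hcG (ε / 5) (by positivity), hkst.eventually (hcv (ε / 5) (by positivity)),
      hkst.eventually (hGω (ε / (5 * ((|A ω| + 1) * (T + 1)))) (by positivity))] with l h1 h2 h3 j hj
    obtain ⟨g1, g2⟩ := h1 _ (grid_le T hj)
    obtain ⟨g3, g4⟩ := h2 _ (grid_le T hj)
    rw [hintG B hB W ω _ _ hj] at g1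
    rw [hintG B₀ hB₀ W₀ ω _ _ hj] at g2
    rw [hint B hB W ω _ _ hj] at g3
    rw [hint B₀ hB₀ W₀ ω _ _ hj] at g4
    have g5 : |∑ i ∈ Finset.range j,
        G (ks l) i ω * (A ω * incr (fun t => (t : ℝ)) T (ns (ks l)) i)| ≤ ε / 5 := by
      refine (Finset.abs_sum_le_sum_abs _ _).trans ?_
      calc _ ≤ ∑ i ∈ Finset.range j, ε / (5 * ((|A ω| + 1) * (T + 1)))
            * (|A ω| * incr (fun t => (t : ℝ)) T (ns (ks l)) i) := by
            refine Finset.sum_le_sum fun i hi => ?_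
            have hnn : 0 ≤ incr (fun t => (t : ℝ)) T (ns (ks l)) i := by
              simp only [incr]; rw [coe_grid_succ, add_sub_cancel_left]; positivity
            rw [abs_mul, abs_mul, abs_of_nonneg hnn]
            gcongr
            exact (h3 i ((Finset.mem_range.1 hi).le.trans hj)).le
        _ = ε / (5 * ((|A ω| + 1) * (T + 1))) * (|A ω| * grid T (ns (ks l)) j) := by
            rw [← Finset.mul_sum, ← Finset.mul_sum, sum_incr]; simp
        _ ≤ ε / (5 * ((|A ω| + 1) * (T + 1))) * ((|A ω| + 1) * (T + 1)) := by
            have : (grid T (ns (ks l)) j : ℝ) ≤ T := by exact_mod_cast grid_le T hj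
            gcongr
            · linarith
            · linarith
        _ = ε / 5 := by field_simp
    have g6 : ∑ i ∈ Finset.range j,
        (u ω (grid T (ns (ks l)) i) - riemannSum (X · ω) (M ω) T (ns (ks l)) i)
          / eulerProd (M ω) T (ns (ks l)) i * incr (M ω) T (ns (ks l)) i
        = (∑ i ∈ Finset.range j, G (ks l) i ω * (A ω * incr (fun t => (t : ℝ)) T (ns (ks l)) i))
          + (∑ i ∈ Finset.range j, G (ks l) i ω * (B ω * incr (W · ω) T (ns (ks l)) i))
          + ∑ i ∈ Finset.range j, G (ks l) i ω * (B₀ ω * incr (W₀ · ω) T (ns (ks l)) i) := by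
      rw [← Finset.sum_add_distrib, ← Finset.sum_add_distrib]
      refine Finset.sum_congr rfl fun i hi => ?_
      rw [← hUe _ i ((Finset.mem_range.1 hi).le.trans hj)]
      simp only [hG, hMdef, incr]
      ring
    rw [g6]
    rw [abs_lt] at g1 g2 g3 g4 ⊢
    rw [abs_le] at g5
    constructor <;> linarith
  have hgrid := discounted_eq_on_grid hMc hM0 hcnn hMq hx hKp.pos (hnst.comp hkst)
    (fun ε hε => hkst.eventually (hUω ε hε)) hGsum
  have hLc := continuous_logReturn hMc (B ω ^ 2 + B₀ ω ^ 2)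
  have hall := fun t (ht : t ≤ T) => discounted_eq hLc (fun t ht => (hc t ht.le).1 ht) hgrid ht
  have hfin := prod_formula hLc hKp.pos hKp.inj (γ := γ) hall ht
  have e : Real.exp (-logReturn (M ω) (B ω ^ 2 + B₀ ω ^ 2) t)
      * Real.exp (logReturn (M ω) (B ω ^ 2 + B₀ ω ^ 2) t) = 1 := by
    rw [← Real.exp_add]; simp
  calc X t ω = X t ω * Real.exp (-logReturn (M ω) (B ω ^ 2 + B₀ ω ^ 2) t)
      * Real.exp (logReturn (M ω) (B ω ^ 2 + B₀ ω ^ 2) t) := by rw [mul_assoc, e, mul_one]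
    _ = _ := by rw [hfin]; ring

/-! ### Poisson laws -/

/-- Size-biasing from `(n + 1) p(n + 1) = r p(n)`: weighting a Poisson variable by its value adds
one. Mecke's formula grows out of this. -/
theorem lintegral_natCast_mul_poissonMeasure (r : ℝ≥0) (g : ℕ → ℝ≥0∞) :
    ∫⁻ n, (n : ℝ≥0∞) * g n ∂(poissonMeasure r) = r * ∫⁻ n, g (n + 1) ∂(poissonMeasure r) := by
  rw [lintegral_countable', lintegral_countable', tsum_eq_zero_add' ENNReal.summable]
  simp only [Nat.cast_zero, zero_mul, zero_add]
  rw [← ENNReal.tsum_mul_left]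
  refine tsum_congr fun n => ?_
  have h : ((n + 1 : ℕ) : ℝ≥0∞) * (poissonMeasure r) {n + 1} = r * (poissonMeasure r) {n} := by
    rw [poissonMeasure_singleton, poissonMeasure_singleton, ← ENNReal.ofReal_natCast,
      ← ENNReal.ofReal_coe_nnreal, ← ENNReal.ofReal_mul (by positivity),
      ← ENNReal.ofReal_mul (by positivity)]
    congr 1
    rw [Nat.factorial_succ]
    push_cast
    field_simp
    ring
  calc _ = g (n + 1) * (((n + 1 : ℕ) : ℝ≥0∞) * (poissonMeasure r) {n + 1}) := by ring
    _ = _ := by rw [h]; ring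

theorem lintegral_mul_map_poissonMeasure (r : ℝ≥0) {g : ℝ≥0∞ → ℝ≥0∞} (hg : Measurable g) :
    ∫⁻ x, x * g x ∂((poissonMeasure r).map (fun n : ℕ => (n : ℝ≥0∞)))
      = r * ∫⁻ x, g (x + 1) ∂((poissonMeasure r).map (fun n : ℕ => (n : ℝ≥0∞))) := by
  rw [lintegral_map (by fun_prop) (by fun_prop), lintegral_map (by fun_prop) (by fun_prop),
    lintegral_natCast_mul_poissonMeasure]
  simp

/-! ### First properties of Poisson random measures -/

section Poisson

variable {Ω S : Type*} [MeasurableSpace Ω] [MeasurableSpace S] {P : Measure Ω} {m : Measure S}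
  {N : Ω → Measure S}

theorem IsPoissonRandomMeasure.measurable_apply (h : IsPoissonRandomMeasure P m N) {A : Set S}
    (hA : MeasurableSet A) : Measurable (fun ω => N ω A) :=
  (Measure.measurable_coe hA).comp h.measurable

theorem IsPoissonRandomMeasure.lintegral_mul (h : IsPoissonRandomMeasure P m N) {A : Set S}
    (hA : MeasurableSet A) (hfin : m A < ∞) {g : ℝ≥0∞ → ℝ≥0∞} (hg : Measurable g) :
    ∫⁻ ω, N ω A * g (N ω A) ∂P = m A * ∫⁻ ω, g (N ω A + 1) ∂P := by
  have hm := h.measurable_apply hA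
  have h1 := lintegral_mul_map_poissonMeasure (m A).toNNReal hg
  rw [← h.law A hA hfin, lintegral_map (by fun_prop) hm, lintegral_map (by fun_prop) hm,
    ENNReal.coe_toNNReal hfin.ne] at h1
  exact h1

theorem IsPoissonRandomMeasure.iIndepFun_fintype {ι : Type*} [Fintype ι]
    (h : IsPoissonRandomMeasure P m N) {A : ι → Set S} (hA : ∀ i, MeasurableSet (A i))
    (hdisj : Pairwise (fun i j => Disjoint (A i) (A j))) : iIndepFun (fun i ω => N ω (A i)) P := by
  let e := Fintype.equivFin ι
  have h1 := h.indep (Fintype.card ι) (fun k => A (e.symm k)) (fun k => hA _)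
    (fun i j hij => hdisj (fun h' => hij (e.symm.injective h')))
  have h2 := h1.precomp e.injective
  simpa using h2

variable [IsProbabilityMeasure P]

theorem IsPoissonRandomMeasure.lintegral_apply_of_lt (h : IsPoissonRandomMeasure P m N) {A : Set S}
    (hA : MeasurableSet A) (hfin : m A < ∞) : ∫⁻ ω, N ω A ∂P = m A := by
  simpa using h.lintegral_mul hA hfin (g := fun _ => 1) measurable_const

/-- Markov's inequality for the factorial moment `N (N - 1)`, whose mean is exactly the square of
the intensity. -/
theorem IsPoissonRandomMeasure.measure_two_le (h : IsPoissonRandomMeasure P m N) {A : Set S}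
    (hA : MeasurableSet A) (hfin : m A < ∞) : P {ω | 2 ≤ N ω A} ≤ m A ^ 2 := by
  have hm := h.measurable_apply hA
  have h1 : ∫⁻ ω, N ω A * (N ω A - 1) ∂P = m A ^ 2 := by
    rw [h.lintegral_mul hA hfin (g := fun x => x - 1) (by fun_prop), sq]
    congr 1
    rw [← h.lintegral_apply_of_lt hA hfin]
    refine lintegral_congr fun ω => ?_
    rw [ENNReal.add_sub_cancel_right ENNReal.one_ne_top]
  rw [← h1]
  have h2 := mul_meas_ge_le_lintegral₀ (μ := P) (f := fun ω => N ω A * (N ω A - 1))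
    (hm.mul (hm.sub_const _)).aemeasurable 1
  rw [one_mul] at h2
  refine (measure_mono fun ω hω => ?_).trans h2
  have hω' : (2 : ℝ≥0∞) ≤ N ω A := hω
  have h3 : (1 : ℝ≥0∞) ≤ N ω A - 1 := by
    refine ENNReal.le_sub_of_add_le_right ENNReal.one_ne_top ?_
    rwa [one_add_one_eq_two]
  change (1 : ℝ≥0∞) ≤ N ω A * (N ω A - 1)
  calc (1 : ℝ≥0∞) = 1 * 1 := (one_mul 1).symm
    _ ≤ N ω A * (N ω A - 1) := mul_le_mul' (le_trans (by norm_num) hω') h3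

theorem IsPoissonRandomMeasure.ae_lt_top (h : IsPoissonRandomMeasure P m N) {A : Set S}
    (hA : MeasurableSet A) (hfin : m A < ∞) : ∀ᵐ ω ∂P, N ω A < ∞ :=
  MeasureTheory.ae_lt_top (h.measurable_apply hA)
    (by rw [h.lintegral_apply_of_lt hA hfin]; exact hfin.ne)

theorem IsPoissonRandomMeasure.ae_eq_zero (h : IsPoissonRandomMeasure P m N) {A : Set S}
    (hA : MeasurableSet A) (h0 : m A = 0) : ∀ᵐ ω ∂P, N ω A = 0 := by
  have h1 := h.lintegral_apply_of_lt hA (by rw [h0]; exact ENNReal.zero_lt_top)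
  rw [h0, lintegral_eq_zero_iff (h.measurable_apply hA)] at h1
  exact h1

/-- Campbell's formula. -/
theorem IsPoissonRandomMeasure.lintegral_lintegral (h : IsPoissonRandomMeasure P m N) {B : Set S}
    (hB : MeasurableSet B) (hfin : m B < ∞) {f : S → ℝ≥0∞} (hf : Measurable f) :
    ∫⁻ ω, ∫⁻ p in B, f p ∂(N ω) ∂P = ∫⁻ p in B, f p ∂m := by
  have hmeas : Measurable (fun ω => (N ω).restrict B) := by
    refine Measure.measurable_of_measurable_coe _ fun A hA => ?_
    simp_rw [Measure.restrict_apply hA]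
    exact h.measurable_apply (hA.inter hB)
  have hbind : P.bind (fun ω => (N ω).restrict B) = m.restrict B := by
    ext A hA
    rw [Measure.bind_apply hA hmeas.aemeasurable, Measure.restrict_apply hA]
    simp_rw [Measure.restrict_apply hA]
    exact h.lintegral_apply_of_lt (hA.inter hB)
      ((measure_mono inter_subset_right).trans_lt hfin)
  rw [← hbind, Measure.lintegral_bind hmeas.aemeasurable hf.aemeasurable]

end Poisson

/-! ### Atoms -/

section Atoms

variable {Ω E : Type*} [MeasurableSpace Ω] [MeasurableSpace E] {P : Measure Ω}
  [IsProbabilityMeasure P] {ν : Measure E} [IsFiniteMeasure ν] {N : Ω → Measure (ℝ≥0 × E)}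

theorem timeMeasure_prod_Iic_lt_top (ν : Measure E) [IsFiniteMeasure ν] (T : ℝ≥0) :
    (timeMeasure.prod ν) (Iic T ×ˢ univ) < ∞ := by
  rw [Measure.prod_prod, timeMeasure_Iic]
  exact ENNReal.mul_lt_top ENNReal.coe_lt_top (measure_lt_top _ _)

/-- Each point contributes mass one, so finite mass up to `T` leaves finitely many points. -/
theorem exists_finset_atoms {n : Measure (ℝ≥0 × E)} {T : ℝ≥0}
    (hn : ∃ (I : Set ℕ) (p : ℕ → ℝ≥0 × E), n = Measure.sum (fun k : I => Measure.dirac (p k)))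
    (hfin : n (Iic T ×ˢ univ) < ∞) :
    ∃ (K : Finset ℕ) (p : ℕ → ℝ≥0 × E), (∀ k ∈ K, (p k).1 ≤ T) ∧
      n.restrict (Iic T ×ˢ univ) = ∑ k ∈ K, Measure.dirac (p k) := by
  classical
  obtain ⟨I, p, rfl⟩ := hn
  have hS : MeasurableSet (Iic T ×ˢ univ : Set (ℝ≥0 × E)) := measurableSet_Iic.prod .univ
  have happ : ∀ A : Set (ℝ≥0 × E), MeasurableSet A →
      Measure.sum (fun k : I => Measure.dirac (p k)) A
        = ∑' k : ℕ, I.indicator (fun k => A.indicator (1 : ℝ≥0 × E → ℝ≥0∞) (p k)) k := by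
    intro A hA
    rw [Measure.sum_apply _ hA, ← tsum_subtype I]
    exact tsum_congr fun k => Measure.dirac_apply' _ hA
  have hfinite : {k : ℕ | k ∈ I ∧ (p k).1 ≤ T}.Finite := by
    rw [happ _ hS] at hfin
    refine (ENNReal.finite_const_le_of_tsum_ne_top hfin.ne one_ne_zero).subset fun k hk => ?_
    obtain ⟨hkI, hkT⟩ := hk
    change (1 : ℝ≥0∞) ≤ _
    rw [indicator_of_mem hkI, indicator_of_mem (by simpa using hkT)]
    rfl
  refine ⟨hfinite.toFinset, p, fun k hk => ((hfinite.mem_toFinset).1 hk).2, ?_⟩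
  ext A hA
  rw [Measure.restrict_apply hA, happ _ (hA.inter hS), tsum_eq_sum (s := hfinite.toFinset),
    Measure.finsetSum_apply]
  · refine Finset.sum_congr rfl fun k hk => ?_
    obtain ⟨hkI, hkT⟩ := (hfinite.mem_toFinset).1 hk
    rw [indicator_of_mem hkI, Measure.dirac_apply' _ hA]
    by_cases hkA : p k ∈ A
    · rw [indicator_of_mem hkA, indicator_of_mem]
      exact ⟨hkA, hkT, trivial⟩
    · rw [indicator_of_notMem hkA, indicator_of_notMem fun h => hkA h.1]
  · intro k hk
    by_cases hkI : k ∈ I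
    · rw [indicator_of_mem hkI, indicator_of_notMem]
      intro h
      exact hk ((hfinite.mem_toFinset).2 ⟨hkI, h.2.1⟩)
    · exact indicator_of_notMem hkI _

/-- Almost surely no two points share a cell of all dyadic grids. -/
theorem IsPoissonRandomMeasure.ae_exists_grid_lt_two
    (h : IsPoissonRandomMeasure P (timeMeasure.prod ν) N) (T : ℝ≥0) :
    ∀ᵐ ω ∂P, ∃ n : ℕ, ∀ i < 2 ^ n, N ω (Ioc (grid T n i) (grid T n (i + 1)) ×ˢ univ) < 2 := by
  have hcell : ∀ n i, (timeMeasure.prod ν) (Ioc (grid T n i) (grid T n (i + 1)) ×ˢ univ)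
      = (T / 2 ^ n : ℝ≥0) * ν univ := by
    intro n i
    rw [Measure.prod_prod, timeMeasure_Ioc (grid_mono T n (Nat.le_succ i)), ← ENNReal.coe_sub]
    congr 2
    apply NNReal.coe_injective
    rw [NNReal.coe_sub (grid_mono T n (Nat.le_succ i)), coe_grid_succ]
    simp
  have hmeas : ∀ n i, MeasurableSet (Ioc (grid T n i) (grid T n (i + 1)) ×ˢ (univ : Set E)) :=
    fun n i => measurableSet_Ioc.prod .univ
  set bad : ℕ → Set Ω := fun n =>
    ⋃ i ∈ Finset.range (2 ^ n), {ω | 2 ≤ N ω (Ioc (grid T n i) (grid T n (i + 1)) ×ˢ univ)}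
  set a : ℝ≥0 := (ν univ).toNNReal with ha
  have hν : ν univ = a := (ENNReal.coe_toNNReal (measure_ne_top _ _)).symm
  -- There are `2 ^ n` cells, each with two points with probability at most `(T a / 2 ^ n)²`.
  have hbad : ∀ n, P (bad n) ≤ ENNReal.ofReal ((T * a : ℝ) ^ 2 / 2 ^ n) := by
    intro n
    calc P (bad n) ≤ ∑ i ∈ Finset.range (2 ^ n),
          P {ω | 2 ≤ N ω (Ioc (grid T n i) (grid T n (i + 1)) ×ˢ univ)} :=
          measure_biUnion_finset_le _ _
      _ ≤ ∑ i ∈ Finset.range (2 ^ n), (((T / 2 ^ n : ℝ≥0) : ℝ≥0∞) * a) ^ 2 := by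
          refine Finset.sum_le_sum fun i _ => ?_
          rw [← hν, ← hcell n i]
          refine h.measure_two_le (hmeas n i) ?_
          rw [hcell, hν]
          exact ENNReal.mul_lt_top ENNReal.coe_lt_top ENNReal.coe_lt_top
      _ = ENNReal.ofReal ((T * a : ℝ) ^ 2 / 2 ^ n) := by
          rw [Finset.sum_const, Finset.card_range, nsmul_eq_mul, ← ENNReal.coe_mul,
            ← ENNReal.coe_pow, ← ENNReal.ofReal_coe_nnreal, ← ENNReal.ofReal_natCast,
            ← ENNReal.ofReal_mul (by positivity)]
          congr 1
          push_cast
          field_simp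
  have hlim : Tendsto (fun n : ℕ => ENNReal.ofReal ((T * a : ℝ) ^ 2 / 2 ^ n)) atTop (𝓝 0) := by
    have h1 : Tendsto (fun n : ℕ => (T * a : ℝ) ^ 2 * (1 / 2 : ℝ) ^ n) atTop
        (𝓝 ((T * a : ℝ) ^ 2 * 0)) :=
      (tendsto_pow_atTop_nhds_zero_of_lt_one (by norm_num) (by norm_num)).const_mul _
    have h2 := (ENNReal.continuous_ofReal.tendsto _).comp h1
    rw [mul_zero, ENNReal.ofReal_zero] at h2
    exact h2.congr fun n => by simp [div_eq_mul_inv]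
  have hzero : P (⋂ n, bad n) = 0 := by
    refine le_antisymm (ge_of_tendsto hlim (Eventually.of_forall fun n => ?_)) zero_le
    exact (measure_mono (iInter_subset _ n)).trans (hbad n)
  filter_upwards [measure_eq_zero_iff_ae_notMem.1 hzero] with ω hω
  simp only [bad, mem_iInter, mem_iUnion, Finset.mem_range, mem_ofPred_eq, not_forall, not_exists,
    not_le] at hω
  obtain ⟨n, hn⟩ := hω
  exact ⟨n, fun i hi => hn i hi⟩

/-- No point has time zero because that slice is null. Two points with equal times would share a
cell of every grid, which almost surely does not occur. -/
theorem IsPoissonRandomMeasure.ae_hasAtoms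
    (h : IsPoissonRandomMeasure P (timeMeasure.prod ν) N) (T : ℝ≥0) :
    ∀ᵐ ω ∂P, ∃ K p, HasAtoms (N ω) T K p := by
  have h0 : (timeMeasure.prod ν) ({(0 : ℝ≥0)} ×ˢ (univ : Set E)) = 0 := by
    rw [Measure.prod_prod, timeMeasure_singleton, zero_mul]
  filter_upwards [h.point_process, h.ae_lt_top (measurableSet_Iic.prod .univ)
    (timeMeasure_prod_Iic_lt_top ν T), h.ae_eq_zero ((measurableSet_singleton _).prod .univ) h0,
    h.ae_exists_grid_lt_two T] with ω hp hfin hz hg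
  obtain ⟨K, p, hK, hr⟩ := exists_finset_atoms hp hfin
  have happ : ∀ A : Set (ℝ≥0 × E), MeasurableSet A → A ⊆ Iic T ×ˢ univ →
      N ω A = ∑ k ∈ K, A.indicator 1 (p k) := by
    intro A hA hsub
    rw [← inter_eq_left.2 hsub, ← Measure.restrict_apply hA, hr, Measure.finsetSum_apply,
      inter_eq_left.2 hsub]
    exact Finset.sum_congr rfl fun k _ => Measure.dirac_apply' _ hA
  have hpos : ∀ k ∈ K, 0 < (p k).1 := by
    intro k hk
    rw [pos_iff_ne_zero]
    intro hk0
    have h1 := happ ({0} ×ˢ univ) ((measurableSet_singleton _).prod .univ)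
      (prod_mono (by simp) subset_rfl)
    rw [hz] at h1
    have h2 := (Finset.sum_eq_zero_iff.1 h1.symm) k hk
    rw [indicator_of_mem (by simpa using hk0)] at h2
    exact one_ne_zero h2
  refine ⟨K, p, hr, fun k hk => ⟨hpos k hk, hK k hk⟩, ?_⟩
  intro k hk l hl hkl
  by_contra hne
  obtain ⟨n, hn⟩ := hg
  obtain ⟨i, hi, hi1, hi2⟩ := exists_grid_Ioc (hpos k hk) (hK k hk) n
  refine absurd (hn i hi) (not_lt.2 ?_)
  rw [happ _ (measurableSet_Ioc.prod .univ) (prod_mono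
    (fun s hs => hs.2.trans (grid_le T hi)) subset_rfl)]
  have hkl' : (p k).1 = (p l).1 := hkl
  calc (2 : ℝ≥0∞) = ∑ q ∈ ({k, l} : Finset ℕ),
        (Ioc (grid T n i) (grid T n (i + 1)) ×ˢ (univ : Set E)).indicator 1 (p q) := by
        rw [Finset.sum_pair hne, indicator_of_mem (by exact ⟨⟨hi1, hi2⟩, trivial⟩),
          indicator_of_mem (by exact ⟨⟨hkl' ▸ hi1, hkl' ▸ hi2⟩, trivial⟩)]
        simp [one_add_one_eq_two]
    _ ≤ _ := Finset.sum_le_sum_of_subset (by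
        intro q hq
        rcases Finset.mem_insert.1 hq with rfl | hq
        · exact hk
        · rw [Finset.mem_singleton.1 hq]; exact hl)

end Atoms

/-! ### Random null sets -/

section RandomNullSets

variable {S : Type*} [MeasurableSpace S]

/-- The kernel sending a measure to its restriction to `B`, if the mass of `B` lies in
`[n, n + 1)`. -/
noncomputable def truncKernelPiece (B : Set S) (hB : MeasurableSet B) (n : ℕ) :
    Kernel (Measure S) S where
  toFun := open Classical in fun μ =>
    if (n : ℝ≥0∞) ≤ μ B ∧ μ B < n + 1 then μ.restrict B else 0
  measurable' := by
    classical
    refine Measurable.ite ?_ ?_ measurable_const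
    · exact (measurableSet_le measurable_const (Measure.measurable_coe hB)).inter
        (measurableSet_lt (Measure.measurable_coe hB) measurable_const)
    · refine Measure.measurable_of_measurable_coe _ fun A hA => ?_
      simp_rw [Measure.restrict_apply hA]
      exact Measure.measurable_coe (hA.inter hB)

instance (B : Set S) (hB : MeasurableSet B) (n : ℕ) :
    IsFiniteKernel (truncKernelPiece B hB n) := by
  refine ⟨⟨n + 1, by simp, fun μ => ?_⟩⟩
  change (if (n : ℝ≥0∞) ≤ μ B ∧ μ B < n + 1 then μ.restrict B else 0) univ ≤ _
  split_ifs with h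
  · rw [Measure.restrict_apply_univ]; exact h.2.le
  · simp

/-- The kernel sending a measure to its restriction to `B`, if this is finite. -/
noncomputable def truncKernel (B : Set S) (hB : MeasurableSet B) : Kernel (Measure S) S :=
  Kernel.sum (truncKernelPiece B hB)

instance (B : Set S) (hB : MeasurableSet B) : IsSFiniteKernel (truncKernel B hB) :=
  Kernel.isSFiniteKernel_sum

/-- Only the piece indexed by the integer part of the mass survives. Slicing by mass makes the
kernel s-finite, which is needed for joint measurability of integrals and sections against a random
measure. -/
theorem truncKernel_apply (B : Set S) (hB : MeasurableSet B) {μ : Measure S} (h : μ B < ∞) :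
    truncKernel B hB μ = μ.restrict B := by
  classical
  set r := (μ B).toNNReal with hrdef
  have hr : (r : ℝ≥0∞) = μ B := ENNReal.coe_toNNReal h.ne
  unfold truncKernel
  rw [Kernel.sum_apply]
  ext A hA
  rw [Measure.sum_apply _ hA, tsum_eq_single ⌊r⌋₊]
  · change (if _ then μ.restrict B else 0) A = _
    rw [if_pos]
    rw [← hr]
    exact ⟨by exact_mod_cast Nat.floor_le zero_le, by exact_mod_cast Nat.lt_floor_add_one r⟩
  · intro n hn
    change (if _ then μ.restrict B else 0) A = _
    rw [if_neg]
    · simp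
    · rintro ⟨h1, h2⟩
      rw [← hr] at h1 h2
      refine hn ?_
      symm
      rw [Nat.floor_eq_iff zero_le]
      exact ⟨by exact_mod_cast h1, by exact_mod_cast h2⟩

variable {Ω Θ : Type*} [MeasurableSpace Ω] [MeasurableSpace Θ] {P : Measure Ω}
  [IsProbabilityMeasure P] {m : Measure S} {N : Ω → Measure S}

theorem IsPoissonRandomMeasure.lintegral_prod_lintegral (h : IsPoissonRandomMeasure P m N)
    {B : Set S} (hB : MeasurableSet B) (hfin : m B < ∞) (α : Measure Θ) [SFinite α]
    {f : Θ × S → ℝ≥0∞} (hf : Measurable f) :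
    AEMeasurable (fun q : Θ × Ω => ∫⁻ p in B, f (q.1, p) ∂(N q.2)) (α.prod P) ∧
    ∫⁻ q, ∫⁻ p in B, f (q.1, p) ∂(N q.2) ∂(α.prod P) = ∫⁻ t, ∫⁻ p in B, f (t, p) ∂m ∂α := by
  let κ : Kernel (Θ × Ω) S := (truncKernel B hB).comap (fun q => N q.2)
    (h.measurable.comp measurable_snd)
  have hκ : ∀ᵐ ω ∂P, ∀ t : Θ, κ (t, ω) = (N ω).restrict B := by
    filter_upwards [h.ae_lt_top hB hfin] with ω hω t
    change truncKernel B hB (N ω) = _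
    rw [truncKernel_apply B hB hω]
  have hm : Measurable (fun q : Θ × Ω => ∫⁻ p, f (q.1, p) ∂(κ q)) :=
    Measurable.lintegral_kernel_prod_right (f := fun (q : Θ × Ω) p => f (q.1, p))
      (by simp only [Function.uncurry_def]; fun_prop)
  have hae : (fun q : Θ × Ω => ∫⁻ p in B, f (q.1, p) ∂(N q.2))
      =ᵐ[α.prod P] fun q => ∫⁻ p, f (q.1, p) ∂(κ q) := by
    filter_upwards [Measure.quasiMeasurePreserving_snd.ae hκ] with q hq
    rw [← hq q.1]
  refine ⟨⟨_, hm, hae⟩, ?_⟩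
  rw [lintegral_congr_ae hae, lintegral_prod _ hm.aemeasurable]
  refine lintegral_congr fun t => ?_
  rw [← h.lintegral_lintegral (f := fun p => f (t, p)) hB hfin (hf.comp measurable_prodMk_left)]
  refine lintegral_congr_ae ?_
  filter_upwards [hκ] with ω hω
  rw [hω t]

theorem IsPoissonRandomMeasure.ae_prod_null (h : IsPoissonRandomMeasure P m N)
    {B : Set S} (hB : MeasurableSet B) (hfin : m B < ∞) (α : Measure Θ) [SFinite α]
    {bad : Set (Θ × S)} (hbad : MeasurableSet bad)
    (hnull : ∀ᵐ t ∂α, ∀ᵐ p ∂m, (t, p) ∉ bad) :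
    ∀ᵐ q ∂(α.prod P), ∀ᵐ p ∂((N q.2).restrict B), (q.1, p) ∉ bad := by
  obtain ⟨h1, h2⟩ := h.lintegral_prod_lintegral hB hfin α
    (f := bad.indicator 1) (measurable_one.indicator hbad)
  have h3 : ∫⁻ t, ∫⁻ p in B, bad.indicator 1 (t, p) ∂m ∂α = 0 := by
    rw [← lintegral_zero (μ := α)]
    refine lintegral_congr_ae ?_
    filter_upwards [hnull] with t ht
    rw [← lintegral_zero (μ := m.restrict B)]
    refine lintegral_congr_ae ?_
    filter_upwards [ae_restrict_of_ae ht] with p hp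
    exact indicator_of_notMem hp _
  rw [h3, lintegral_eq_zero_iff' h1] at h2
  filter_upwards [h2] with q hq
  have hq' : ∫⁻ p in B, bad.indicator 1 (q.1, p) ∂(N q.2) = 0 := hq
  have hm : Measurable fun p => bad.indicator (1 : Θ × S → ℝ≥0∞) (q.1, p) :=
    (measurable_one.indicator hbad).comp measurable_prodMk_left
  rw [lintegral_eq_zero_iff hm] at hq'
  filter_upwards [hq'] with p hp hmem
  rw [indicator_of_mem hmem] at hp
  exact one_ne_zero hp

/-- A random set that is determined by a parameter independent of the Poisson random measure and
that is almost surely negligible for the intensity contains no points. -/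
theorem IsPoissonRandomMeasure.ae_null_of_indepFun (h : IsPoissonRandomMeasure P m N)
    {B : Set S} (hB : MeasurableSet B) (hfin : m B < ∞) {θ : Ω → Θ} (hθ : Measurable θ)
    (hind : IndepFun θ N P) {bad : Set (Θ × S)} (hbad : MeasurableSet bad)
    (hnull : ∀ᵐ t ∂(P.map θ), ∀ᵐ p ∂m, (t, p) ∉ bad) :
    ∀ᵐ ω ∂P, ∀ᵐ p ∂((N ω).restrict B), (θ ω, p) ∉ bad := by
  have hjoint := (indepFun_iff_map_prod_eq_prod_map_map hθ.aemeasurable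
    h.measurable.aemeasurable).1 hind
  have : IsProbabilityMeasure (P.map θ) := Measure.isProbabilityMeasure_map hθ.aemeasurable
  have hmap : (P.map θ).prod (P.map N) = ((P.map θ).prod P).map (Prod.map id N) := by
    rw [← Measure.map_prod_map _ _ measurable_id h.measurable, Measure.map_id]
  have hsec : ∀ μ : Measure S, μ B < ∞ → ∀ t, (∀ᵐ p ∂(μ.restrict B), (t, p) ∉ bad)
      ↔ truncKernel B hB μ (Prod.mk t ⁻¹' bad) = 0 := by
    intro μ hμ t
    rw [truncKernel_apply B hB hμ, ae_iff]
    simp only [not_not]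
    rfl
  have hmeas : MeasurableSet {q : Θ × Measure S | truncKernel B hB q.2 (Prod.mk q.1 ⁻¹' bad) = 0} := by
    have : Measurable (fun q : Θ × Measure S =>
        (truncKernel B hB).comap Prod.snd measurable_snd q (Prod.mk q ⁻¹'
          ((fun r : (Θ × Measure S) × S => (r.1.1, r.2)) ⁻¹' bad))) :=
      Kernel.measurable_kernel_prodMk_left (hbad.preimage (by fun_prop))
    exact this (measurableSet_singleton 0)
  -- By independence the joint law is a product, so it suffices to treat a parameter drawn on its
  -- own space. Writing the event through the kernel makes it measurable and lets it pass between
  -- the two laws.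
  have key : ∀ᵐ q ∂((P.map θ).prod (P.map N)),
      truncKernel B hB q.2 (Prod.mk q.1 ⁻¹' bad) = 0 := by
    rw [hmap, ae_map_iff (by exact (measurable_id.prodMap h.measurable).aemeasurable) hmeas]
    filter_upwards [h.ae_prod_null hB hfin (P.map θ) hbad hnull,
      Measure.quasiMeasurePreserving_snd.ae (h.ae_lt_top hB hfin)] with q h1 h2
    exact (hsec _ h2 _).1 h1
  rw [← hjoint, ae_map_iff (hθ.prodMk h.measurable).aemeasurable hmeas] at key
  filter_upwards [key, h.ae_lt_top hB hfin] with ω h1 h2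
  exact (hsec _ h2 _).2 h1

end RandomNullSets

/-! ### The Mecke formula -/

theorem measurable_restrict_measure {S : Type*} [MeasurableSpace S] {B : Set S}
    (hB : MeasurableSet B) : Measurable (fun μ : Measure S => μ.restrict B) := by
  refine Measure.measurable_of_measurable_coe _ fun A hA => ?_
  simp_rw [Measure.restrict_apply hA]
  exact Measure.measurable_coe (hA.inter hB)

section Mecke

variable {Ω S ι : Type*} [MeasurableSpace Ω] [MeasurableSpace S] {P : Measure Ω}
  {m : Measure S} {N : Ω → Measure S}

theorem IsPoissonRandomMeasure.measurable_shift [IsProbabilityMeasure P]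
    (h : IsPoissonRandomMeasure P m N)
    {D : ι → Set S} (hD : ∀ j, MeasurableSet (D j)) {H : (ι → ℝ≥0∞) → ℝ≥0∞} (hH : Measurable H) :
    Measurable fun p => ∫⁻ ω, H (fun j => N ω (D j) + (D j).indicator 1 p) ∂P := by
  refine Measurable.lintegral_prod_right' (f := fun q : S × Ω =>
    H (fun j => N q.2 (D j) + (D j).indicator 1 q.1)) ?_
  refine hH.comp (measurable_pi_lambda _ fun j => ?_)
  exact ((h.measurable_apply (hD j)).comp measurable_snd).add
    ((measurable_one.indicator (hD j)).comp measurable_fst)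

variable [Fintype ι]

theorem measurableSet_cell {D : ι → Set S} (hD : ∀ j, MeasurableSet (D j)) (ε : Finset ι) :
    MeasurableSet {p | ∀ j, p ∈ D j ↔ j ∈ ε} := by
  rw [ofPred_forall]
  refine MeasurableSet.iInter fun j => ?_
  by_cases hj : j ∈ ε
  · simpa [hj] using hD j
  · have h : {p | p ∈ D j ↔ j ∈ ε} = (D j)ᶜ := by
      ext p
      simp [hj]
    rw [h]
    exact (hD j).compl

theorem IsPoissonRandomMeasure.indepFun_disjoint (h : IsPoissonRandomMeasure P m N) {A : Set S}
    (hA : MeasurableSet A) {D : ι → Set S} (hD : ∀ j, MeasurableSet (D j))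
    (hdisj : ∀ j, Disjoint A (D j)) :
    IndepFun (fun ω => N ω A) (fun ω j => N ω (D j)) P := by
  classical
  -- The sets `D j` may overlap. They are cut into the cells recording which `D j` contain a point;
  -- together with `A` these cells are disjoint, and independence of counts applies.
  let F : Option (Finset ι) → Set S := fun o =>
    o.elim A fun ε => {p | ∀ j, p ∈ D j ↔ j ∈ ε} \ A
  have hF : ∀ o, MeasurableSet (F o) := by
    rintro (_ | ε)
    · exact hA
    · exact (measurableSet_cell hD ε).diff hA
  have hcell : ∀ ε ε' : Finset ι, ∀ p : S, (∀ j, p ∈ D j ↔ j ∈ ε) → (∀ j, p ∈ D j ↔ j ∈ ε') →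
      ε = ε' := fun ε ε' p h1 h2 => by
    ext j
    rw [← h1 j, ← h2 j]
  have hFd : Pairwise fun o o' => Disjoint (F o) (F o') := by
    rintro (_ | ε) (_ | ε') hne
    · exact absurd rfl hne
    · exact disjoint_sdiff_right
    · exact disjoint_sdiff_left
    · rw [Set.disjoint_left]
      rintro p ⟨h1, -⟩ ⟨h2, -⟩
      exact hne (congrArg some (hcell ε ε' p h1 h2))
  have hind := (h.iIndepFun_fintype hF hFd).indepFun_finset {none} (Finset.univ.erase none)
    (by simp) (fun o => h.measurable_apply (hF o))
  have hsum : ∀ ω j, N ω (D j) = ∑ ε : Finset ι with j ∈ ε, N ω (F (some ε)) := by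
    intro ω j
    rw [← measure_biUnion_finset (fun ε _ ε' _ hne => hFd (fun h' => hne (Option.some_injective _ h')))
      (fun ε _ => hF _)]
    congr 1
    ext p
    simp only [mem_iUnion, Finset.mem_filter, Finset.mem_univ, true_and, exists_prop]
    constructor
    · intro hp
      exact ⟨Finset.univ.filter fun j => p ∈ D j, by simpa using hp, by simp,
        fun hpA => Set.disjoint_left.1 (hdisj j) hpA hp⟩
    · rintro ⟨ε, hj, h1, -⟩
      exact (h1 j).2 hj
  let φ : (({none} : Finset (Option (Finset ι))) → ℝ≥0∞) → ℝ≥0∞ := fun x => x ⟨none, by simp⟩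
  let ψ : (↥((Finset.univ : Finset (Option (Finset ι))).erase none) → ℝ≥0∞) → ι → ℝ≥0∞ :=
    fun y j => ∑ ε : Finset ι with j ∈ ε, y ⟨some ε, by simp⟩
  have hφ : Measurable φ := measurable_pi_apply _
  have hψ : Measurable ψ := by fun_prop
  have h2 := hind.comp hφ hψ
  have e : (fun ω j => N ω (D j)) = fun ω j => ∑ ε : Finset ι with j ∈ ε, N ω (F (some ε)) :=
    funext fun ω => funext fun j => hsum ω j
  rw [e]
  exact h2

variable [IsProbabilityMeasure P]

/-- Each `D j` contains `A` or misses it, so its count is `N (D j \ A) + c j * N A`. The first part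
is independent of `N A`; freeze it and size-bias `N A`. -/
theorem IsPoissonRandomMeasure.lintegral_mul_of_cell (h : IsPoissonRandomMeasure P m N) {A : Set S}
    (hA : MeasurableSet A) (hfin : m A < ∞) {D : ι → Set S} (hD : ∀ j, MeasurableSet (D j))
    {c : ι → ℝ≥0∞} (hc : ∀ p ∈ A, ∀ j, (D j).indicator 1 p = c j)
    {H : (ι → ℝ≥0∞) → ℝ≥0∞} (hH : Measurable H) :
    ∫⁻ ω, N ω A * H (fun j => N ω (D j)) ∂P = m A * ∫⁻ ω, H (fun j => N ω (D j) + c j) ∂P := by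
  rcases A.eq_empty_or_nonempty with rfl | ⟨p₀, hp₀⟩
  · simp
  have hdich : ∀ j, (A ⊆ D j ∧ c j = 1) ∨ (Disjoint A (D j) ∧ c j = 0) := by
    intro j
    by_cases hj : p₀ ∈ D j
    · left
      have hcj : c j = 1 := by rw [← hc p₀ hp₀ j, indicator_of_mem hj]; rfl
      refine ⟨fun p hp => by_contra fun hpD => ?_, hcj⟩
      have := hc p hp j
      rw [indicator_of_notMem hpD, hcj] at this
      exact zero_ne_one this
    · right
      have hcj : c j = 0 := by rw [← hc p₀ hp₀ j, indicator_of_notMem hj]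
      refine ⟨Set.disjoint_left.2 fun p hp hpD => ?_, hcj⟩
      have := hc p hp j
      rw [indicator_of_mem hpD, hcj] at this
      exact one_ne_zero this
  have hsplit : ∀ ω j, N ω (D j) = N ω (D j \ A) + c j * N ω A := by
    intro ω j
    rcases hdich j with ⟨hsub, hcj⟩ | ⟨hd, hcj⟩
    · rw [hcj, one_mul, ← measure_inter_add_sdiff (D j) hA, inter_eq_right.2 hsub, add_comm]
    · rw [hcj, zero_mul, add_zero, hd.symm.sdiff_eq_left]
  have hind := h.indepFun_disjoint hA (fun j => (hD j).diff hA) (fun j => disjoint_sdiff_right)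
  have hmA := h.measurable_apply hA
  have hmD : Measurable fun ω j => N ω (D j \ A) :=
    measurable_pi_lambda _ fun j => h.measurable_apply ((hD j).diff hA)
  have hjoint := (indepFun_iff_map_prod_eq_prod_map_map hmA.aemeasurable hmD.aemeasurable).1 hind
  have := Measure.isProbabilityMeasure_map (μ := P) hmA.aemeasurable
  have := Measure.isProbabilityMeasure_map (μ := P) hmD.aemeasurable
  have hgen : ∀ G : ℝ≥0∞ × (ι → ℝ≥0∞) → ℝ≥0∞, Measurable G →
      ∫⁻ ω, G (N ω A, fun j => N ω (D j \ A)) ∂P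
        = ∫⁻ y, ∫⁻ ω, G (N ω A, y) ∂P ∂(P.map fun ω j => N ω (D j \ A)) := by
    intro G hG
    rw [← lintegral_map (f := G) hG (hmA.prodMk hmD), hjoint, lintegral_prod_symm _ hG.aemeasurable]
    refine lintegral_congr fun y => ?_
    rw [lintegral_map (by fun_prop) hmA]
  simp_rw [hsplit]
  rw [hgen (fun q => q.1 * H fun j => q.2 j + c j * q.1) (by fun_prop),
    hgen (fun q => H fun j => q.2 j + c j * q.1 + c j) (by fun_prop),
    ← lintegral_const_mul _ (by fun_prop)]
  refine lintegral_congr fun y => ?_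
  rw [h.lintegral_mul hA hfin (g := fun x => H fun j => y j + c j * x) (by fun_prop)]
  simp_rw [mul_add, mul_one, add_assoc]

/-- Mecke's formula for functionals of finitely many counts. For indicators, cut the set into cells
on which membership in the `D j` is constant; equality of the resulting measures extends this to all
`f`. -/
theorem IsPoissonRandomMeasure.mecke (h : IsPoissonRandomMeasure P m N) {B : Set S}
    (hB : MeasurableSet B) (hfin : m B < ∞) {D : ι → Set S} (hD : ∀ j, MeasurableSet (D j))
    {H : (ι → ℝ≥0∞) → ℝ≥0∞} (hH : Measurable H) {f : S → ℝ≥0∞} (hf : Measurable f) :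
    ∫⁻ ω, (∫⁻ p in B, f p ∂(N ω)) * H (fun j => N ω (D j)) ∂P
      = ∫⁻ p in B, f p * ∫⁻ ω, H (fun j => N ω (D j) + (D j).indicator 1 p) ∂P ∂m := by
  classical
  have hmH : Measurable fun ω => H (fun j => N ω (D j)) :=
    hH.comp (measurable_pi_lambda _ fun j => h.measurable_apply (hD j))
  have hset : ∀ A, MeasurableSet A → ∫⁻ ω, N ω (A ∩ B) * H (fun j => N ω (D j)) ∂P
      = ∫⁻ p in A ∩ B, ∫⁻ ω, H (fun j => N ω (D j) + (D j).indicator 1 p) ∂P ∂m := by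
    intro A hA
    let F : Finset ι → Set S := fun ε => {p | ∀ j, p ∈ D j ↔ j ∈ ε} ∩ (A ∩ B)
    have hF : ∀ ε, MeasurableSet (F ε) := fun ε => (measurableSet_cell hD ε).inter (hA.inter hB)
    have hFd : Pairwise fun ε ε' => Disjoint (F ε) (F ε') := by
      intro ε ε' hne
      rw [Set.disjoint_left]
      rintro p ⟨h1, -⟩ ⟨h2, -⟩
      refine hne ?_
      ext j
      rw [← h1 j, ← h2 j]
    have hU : A ∩ B = ⋃ ε ∈ (Finset.univ : Finset (Finset ι)), F ε := by
      ext p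
      simp only [mem_iUnion, Finset.mem_univ, exists_prop, true_and]
      constructor
      · intro hp
        exact ⟨Finset.univ.filter fun j => p ∈ D j, by simp, hp⟩
      · rintro ⟨ε, -, hp⟩
        exact hp
    rw [hU, lintegral_biUnion_finset (fun ε _ ε' _ hne => hFd hne) (fun ε _ => hF ε)]
    simp_rw [measure_biUnion_finset (fun ε _ ε' _ hne => hFd hne) (fun ε _ => hF ε),
      Finset.sum_mul]
    rw [lintegral_finsetSum (f := fun ε ω => N ω (F ε) * H (fun j => N ω (D j))) _
      fun ε _ => (h.measurable_apply (hF ε)).mul hmH]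
    refine Finset.sum_congr rfl fun ε _ => ?_
    have hind : ∀ p ∈ F ε, ∀ j, (D j).indicator (1 : S → ℝ≥0∞) p = if j ∈ ε then 1 else 0 := by
      intro p hp j
      rw [indicator_apply]
      simp only [hp.1 j, Pi.one_apply]
    rw [h.lintegral_mul_of_cell (hF ε) ((measure_mono (inter_subset_right.trans
      inter_subset_right)).trans_lt hfin) hD hind hH]
    rw [setLIntegral_congr_fun (hF ε) (g := fun _ =>
      ∫⁻ ω, H (fun j => N ω (D j) + if j ∈ ε then 1 else 0) ∂P), setLIntegral_const, mul_comm]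
    intro p hp
    simp only [hind p hp]
  have hmeas : Measurable fun ω => (N ω).restrict B :=
    (measurable_restrict_measure hB).comp h.measurable
  have hmeasure : (P.withDensity fun ω => H (fun j => N ω (D j))).bind
      (fun ω => (N ω).restrict B) = (m.restrict B).withDensity fun p =>
        ∫⁻ ω, H (fun j => N ω (D j) + (D j).indicator 1 p) ∂P := by
    ext A hA
    rw [Measure.bind_apply hA hmeas.aemeasurable, withDensity_apply _ hA,
      Measure.restrict_restrict hA, ← hset A hA,
      lintegral_withDensity_eq_lintegral_mul (g := fun ω => (N ω).restrict B A) _ hmH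
        ((Measure.measurable_coe hA).comp hmeas)]
    refine lintegral_congr fun ω => ?_
    simp only [Pi.mul_apply, Measure.restrict_apply hA]
    rw [mul_comm]
  have h1 : ∫⁻ p, f p ∂_ = ∫⁻ p, f p ∂_ := congrArg (fun μ => ∫⁻ p, f p ∂μ) hmeasure
  rw [Measure.lintegral_bind hmeas.aemeasurable hf.aemeasurable,
    lintegral_withDensity_eq_lintegral_mul (g := fun ω => ∫⁻ p in B, f p ∂(N ω)) _ hmH
      ((Measure.measurable_lintegral hf).comp hmeas),
    lintegral_withDensity_eq_lintegral_mul _ (h.measurable_shift hD hH) hf] at h1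
  simp only [Pi.mul_apply] at h1
  simp_rw [mul_comm _ (H _), mul_comm (f _)]
  exact h1

end Mecke

/-! ### Thinning -/

section Thinning

variable {Ω S S' Θ : Type*} [MeasurableSpace Ω] [MeasurableSpace S] [MeasurableSpace S']
  [MeasurableSpace Θ] {P : Measure Ω}
  [IsProbabilityMeasure P] {m : Measure S} {N : Ω → Measure S}

/-- Sums over the points of a Poisson random measure of two functions with the same projections
under `q` have the same mean on the events that are determined by the image under `q`. -/
theorem IsPoissonRandomMeasure.setLIntegral_congr (h : IsPoissonRandomMeasure P m N) {B : Set S}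
    (hB : MeasurableSet B) (hfin : m B < ∞) {q : S → S'} (hq : Measurable q) {f g : S → ℝ≥0∞}
    (hf : Measurable f) (hg : Measurable g) (hfint : ∫⁻ p in B, f p ∂m ≠ ∞)
    (hfg : ((m.restrict B).withDensity f).map q = ((m.restrict B).withDensity g).map q)
    {V : Set (Measure S')} (hV : MeasurableSet V) :
    ∫⁻ ω in {ω | (N ω).map q ∈ V}, ∫⁻ p in B, f p ∂(N ω) ∂P
      = ∫⁻ ω in {ω | (N ω).map q ∈ V}, ∫⁻ p in B, g p ∂(N ω) ∂P := by
  have hmeas : Measurable fun ω => (N ω).restrict B :=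
    (measurable_restrict_measure hB).comp h.measurable
  have hmap : Measurable fun ω => (N ω).map q := (Measure.measurable_map q hq).comp h.measurable
  have hmi : ∀ {f : S → ℝ≥0∞}, Measurable f → Measurable fun ω => ∫⁻ p in B, f p ∂(N ω) :=
    fun hf => (Measure.measurable_lintegral hf).comp hmeas
  -- A measure is recorded as the family of all its values, so that its law is governed by finitely
  -- many counts at a time.
  let Φ : Measure S' → ({D : Set S' // MeasurableSet D} → ℝ≥0∞) := fun n D => n D.1
  have hΦ : Measurable Φ := measurable_pi_lambda _ fun D => Measure.measurable_coe D.2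
  have hΦN : Measurable fun ω => Φ ((N ω).map q) := hΦ.comp hmap
  have hgint : ∫⁻ p in B, g p ∂m = ∫⁻ p in B, f p ∂m := by
    have := congrArg (fun μ => μ univ) hfg
    simp only [Measure.map_apply hq .univ, preimage_univ, withDensity_apply _ .univ,
      Measure.restrict_univ] at this
    exact this.symm
  let μ : (S → ℝ≥0∞) → Measure ({D : Set S' // MeasurableSet D} → ℝ≥0∞) := fun f =>
    (P.withDensity fun ω => ∫⁻ p in B, f p ∂(N ω)).map fun ω => Φ ((N ω).map q)
  have hfinite : ∀ {f : S → ℝ≥0∞}, Measurable f → ∫⁻ p in B, f p ∂m ≠ ∞ → IsFiniteMeasure (μ f) := by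
    intro f hf hfint
    have : IsFiniteMeasure (P.withDensity fun ω => ∫⁻ p in B, f p ∂(N ω)) :=
      isFiniteMeasure_withDensity (by rwa [h.lintegral_lintegral hB hfin hf])
    infer_instance
  have := hfinite hf hfint
  have := hfinite hg (hgint ▸ hfint)
  -- In Mecke's formula for counts of preimages under `q`, the added point enters only through its
  -- projection; hence `f` enters only through its projected density.
  have hmarg : ∀ (I : Finset {D : Set S' // MeasurableSet D}) (f : S → ℝ≥0∞), Measurable f →
      ∀ A : Set (I → ℝ≥0∞), MeasurableSet A → (μ f).map I.restrict A
        = ∫⁻ s, ∫⁻ ω, A.indicator 1 (fun D : I => N ω (q ⁻¹' D.1.1)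
            + D.1.1.indicator 1 s) ∂P ∂(((m.restrict B).withDensity f).map q) := by
    intro I f hf A hA
    have hmI : Measurable (I.restrict (π := fun _ => ℝ≥0∞)) := Finset.measurable_restrict I
    have hms := h.measurable_shift (D := fun D : I => q ⁻¹' D.1.1) (fun D => hq D.1.2)
      (H := A.indicator 1) (measurable_one.indicator hA)
    have hms' : Measurable fun s : S' => ∫⁻ ω, A.indicator 1 (fun D : I => N ω (q ⁻¹' D.1.1)
            + D.1.1.indicator (1 : S' → ℝ≥0∞) s) ∂P := by
      refine Measurable.lintegral_prod_right' (f := fun r : S' × Ω =>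
        A.indicator 1 (fun D : I => N r.2 (q ⁻¹' D.1.1) + D.1.1.indicator 1 r.1)) ?_
      refine (measurable_one.indicator hA).comp (measurable_pi_lambda _ fun j => ?_)
      exact ((h.measurable_apply (hq j.1.2)).comp measurable_snd).add
        ((measurable_one.indicator j.1.2).comp measurable_fst)
    rw [lintegral_map hms' hq, lintegral_withDensity_eq_lintegral_mul
      (g := fun p => ∫⁻ ω, A.indicator 1 (fun D : I => N ω (q ⁻¹' D.1.1)
            + D.1.1.indicator (1 : S' → ℝ≥0∞) (q p)) ∂P) _ hf (hms'.comp hq)]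
    have h1 := h.mecke hB hfin (D := fun D : I => q ⁻¹' D.1.1) (fun D => hq D.1.2)
      (H := A.indicator 1) (measurable_one.indicator hA) hf
    refine Eq.trans ?_ h1
    rw [Measure.map_apply hmI hA, Measure.map_apply hΦN (hmI hA),
      withDensity_apply _ (hΦN (hmI hA)),
      ← lintegral_indicator (hΦN (hmI hA))]
    refine lintegral_congr fun ω => ?_
    have hval : (fun D : I => N ω (q ⁻¹' D.1.1)) = I.restrict (Φ ((N ω).map q)) := by
      ext D
      exact (Measure.map_apply hq D.1.2).symm
    rw [hval]
    by_cases hω : I.restrict (Φ ((N ω).map q)) ∈ A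
    · rw [indicator_of_mem hω, indicator_of_mem (by exact hω)]
      simp
    · rw [indicator_of_notMem hω, indicator_of_notMem (by exact hω)]
      simp
  -- Finite measures on a product are determined by their finite-dimensional marginals.
  have hμ : μ f = μ g := by
    refine IsProjectiveLimit.unique (P := fun I => (μ f).map I.restrict) (fun I => rfl) fun I => ?_
    ext A hA
    rw [hmarg I g hg A hA, hmarg I f hf A hA, hfg]
  obtain ⟨Q, hQ, rfl⟩ : ∃ Q, MeasurableSet Q ∧ Φ ⁻¹' Q = V := by
    have hle : (inferInstance : MeasurableSpace (Measure S')) ≤ MeasurableSpace.comap Φ inferInstance := by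
      refine iSup₂_le fun D hD => ?_
      rw [← measurable_iff_comap_le]
      exact (measurable_pi_apply (⟨D, hD⟩ : {D : Set S' // MeasurableSet D})).comp
        (comap_measurable Φ)
    exact hle V hV
  have h2 := congrArg (fun μ => μ Q) hμ
  simp only [μ] at h2
  rw [Measure.map_apply hΦN hQ, Measure.map_apply hΦN hQ,
    withDensity_apply _ (hΦN hQ), withDensity_apply _ (hΦN hQ)] at h2
  exact h2

/-- Freeze the independent variable by Fubini and use the previous case on each section of `V`. -/
theorem IsPoissonRandomMeasure.setLIntegral_congr_of_indepFun (h : IsPoissonRandomMeasure P m N)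
    {B : Set S} (hB : MeasurableSet B) (hfin : m B < ∞) {q : S → S'} (hq : Measurable q)
    {f g : S → ℝ≥0∞} (hf : Measurable f) (hg : Measurable g) (hfint : ∫⁻ p in B, f p ∂m ≠ ∞)
    (hfg : ((m.restrict B).withDensity f).map q = ((m.restrict B).withDensity g).map q)
    {θ : Ω → Θ} (hθ : Measurable θ) (hind : IndepFun θ N P)
    {V : Set (Θ × Measure S')} (hV : MeasurableSet V) :
    ∫⁻ ω in {ω | (θ ω, (N ω).map q) ∈ V}, ∫⁻ p in B, f p ∂(N ω) ∂P
      = ∫⁻ ω in {ω | (θ ω, (N ω).map q) ∈ V}, ∫⁻ p in B, g p ∂(N ω) ∂P := by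
  have hmq : Measurable fun n : Measure S => n.map q := Measure.measurable_map q hq
  have hmap : Measurable fun ω => (N ω).map q := hmq.comp h.measurable
  have hjoint := (indepFun_iff_map_prod_eq_prod_map_map hθ.aemeasurable
    h.measurable.aemeasurable).1 hind
  have := Measure.isProbabilityMeasure_map (μ := P) hθ.aemeasurable
  have := Measure.isProbabilityMeasure_map (μ := P) h.measurable.aemeasurable
  have key : ∀ f : S → ℝ≥0∞, Measurable f →
      ∫⁻ ω in {ω | (θ ω, (N ω).map q) ∈ V}, ∫⁻ p in B, f p ∂(N ω) ∂P
        = ∫⁻ t, ∫⁻ ω in {ω | (N ω).map q ∈ Prod.mk t ⁻¹' V}, ∫⁻ p in B, f p ∂(N ω) ∂P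
          ∂(P.map θ) := by
    intro f hf
    have hmf : Measurable fun n : Measure S => ∫⁻ p in B, f p ∂n :=
      (Measure.measurable_lintegral hf).comp (measurable_restrict_measure hB)
    have hV' : MeasurableSet {r : Θ × Measure S | (r.1, r.2.map q) ∈ V} :=
      hV.preimage (measurable_fst.prodMk (hmq.comp measurable_snd))
    have hG : Measurable ({r : Θ × Measure S | (r.1, r.2.map q) ∈ V}.indicator
        fun r => ∫⁻ p in B, f p ∂r.2) := (hmf.comp measurable_snd).indicator hV'
    have hVω : MeasurableSet {ω | (θ ω, (N ω).map q) ∈ V} := hV.preimage (hθ.prodMk hmap)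
    rw [← lintegral_indicator hVω]
    have e1 : ∫⁻ ω, {ω | (θ ω, (N ω).map q) ∈ V}.indicator (fun ω => ∫⁻ p in B, f p ∂(N ω)) ω ∂P
      = ∫⁻ ω, {r : Θ × Measure S | (r.1, r.2.map q) ∈ V}.indicator
        (fun r => ∫⁻ p in B, f p ∂r.2) (θ ω, N ω) ∂P := rfl
    rw [e1, ← lintegral_map (g := fun ω => (θ ω, N ω)) hG (hθ.prodMk h.measurable), hjoint,
      lintegral_prod _ hG.aemeasurable]
    refine lintegral_congr fun t => ?_
    rw [lintegral_map (f := fun y => {r : Θ × Measure S | (r.1, r.2.map q) ∈ V}.indicator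
        (fun r => ∫⁻ p in B, f p ∂r.2) (t, y)) (hG.comp measurable_prodMk_left) h.measurable,
      ← lintegral_indicator (s := {ω | (N ω).map q ∈ Prod.mk t ⁻¹' V})
        ((hV.preimage measurable_prodMk_left).preimage hmap)]
    rfl
  rw [key f hf, key g hg]
  exact lintegral_congr fun t => h.setLIntegral_congr hB hfin hq hf hg hfint hfg
    (hV.preimage measurable_prodMk_left)

end Thinning

/-! ### Bounds on admissible positions -/

section Positions

variable {E : Type*} [MeasurableSpace E] {ν : Measure E} {t : InvestorType E} {a b z x c₀ : ℝ}

/-- The bound `c₀` excludes an upper jump of `⊥`; for an infinite one the convention `1/∞ = 0`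
forbids short positions, which is stronger than the claim. -/
theorem le_of_mem_positions (hx : x ∈ positions ν t a b z) (ha : a ≤ 1)
    (hU : (c₀ : EReal) ≤ upperJump ν t z) {y : ℝ} (hy0 : 0 < y) (hy : (y : EReal) ≤ upperJump ν t z) :
    -((1 - a) / y) ≤ x := by
  have h1 := hx.1
  generalize upperJump ν t z = U at *
  induction U with
  | bot => simp at hU
  | top =>
    rw [EReal.div_top, neg_zero, EReal.coe_nonneg] at h1
    have : 0 ≤ (1 - a) / y := div_nonneg (by linarith) hy0.le
    linarith
  | coe u =>
    rw [← EReal.coe_div, ← EReal.coe_neg, EReal.coe_le_coe_iff] at h1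
    rw [EReal.coe_le_coe_iff] at hy
    have : (1 - a) / u ≤ (1 - a) / y := div_le_div_of_nonneg_left (by linarith) hy0 hy
    linarith

theorem mem_positions_le (hx : x ∈ positions ν t a b z) (hb : b ≤ 1)
    (hL : lowerJump ν t z ≤ ((-c₀ : ℝ) : EReal)) {y : ℝ} (hy0 : 0 < y)
    (hy : lowerJump ν t z ≤ ((-y : ℝ) : EReal)) : x ≤ (1 - b) / y := by
  have h1 := hx.2
  generalize lowerJump ν t z = L at *
  induction L with
  | top => simp at hL
  | bot =>
    rw [EReal.div_bot, neg_zero] at h1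
    have h2 : x ≤ 0 := by exact_mod_cast h1
    have : 0 ≤ (1 - b) / y := div_nonneg (by linarith) hy0.le
    linarith
  | coe l =>
    rw [← EReal.coe_div, ← EReal.coe_neg, EReal.coe_le_coe_iff] at h1
    rw [EReal.coe_le_coe_iff] at hy
    have : (1 - b) / (-l) ≤ (1 - b) / y := div_le_div_of_nonneg_left (by linarith) hy0 (by linarith)
    rw [div_neg] at this
    linarith

theorem abs_le_of_mem_positions (hx : x ∈ positions ν t a b z) (ha : a ∈ Ioc (0 : ℝ) 1)
    (hb : b ∈ Ioc (0 : ℝ) 1) (hc : 0 < c₀) (hU : (c₀ : EReal) ≤ upperJump ν t z)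
    (hL : lowerJump ν t z ≤ ((-c₀ : ℝ) : EReal)) : |x| ≤ 1 / c₀ := by
  have h1 := le_of_mem_positions hx ha.2 hU hc hU
  have h2 := mem_positions_le hx hb.2 hL hc hL
  have h3 : (1 - a) / c₀ ≤ 1 / c₀ := by gcongr; linarith [ha.1]
  have h4 : (1 - b) / c₀ ≤ 1 / c₀ := by gcongr; linarith [hb.1]
  rw [abs_le]
  constructor <;> linarith

/-- The sign of the jump decides which end of the interval binds: `a` guards against upward jumps
and `b` against downward ones. -/
theorem le_one_add_mul_of_mem_positions (hx : x ∈ positions ν t a b z) (ha : a ∈ Ioc (0 : ℝ) 1)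
    (hb : b ∈ Ioc (0 : ℝ) 1) (hU : (c₀ : EReal) ≤ upperJump ν t z)
    (hL : lowerJump ν t z ≤ ((-c₀ : ℝ) : EReal)) {y : ℝ} (hyL : lowerJump ν t z ≤ y)
    (hyU : (y : EReal) ≤ upperJump ν t z) : min a b ≤ 1 + x * y := by
  rcases lt_trichotomy y 0 with hy | rfl | hy
  · have h1 := mem_positions_le hx hb.2 hL (y := -y) (by linarith) (by simpa using hyL)
    rw [le_div_iff₀ (by linarith)] at h1
    exact (min_le_right _ _).trans (by linarith)
  · exact (min_le_left _ _).trans (by linarith [ha.2])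
  · have h1 := le_of_mem_positions hx ha.2 hU hy hyU
    rw [neg_le, ← sub_nonneg] at h1
    have h2 := mul_nonneg h1 hy.le
    rw [sub_mul, div_mul_cancel₀ _ hy.ne'] at h2
    exact (min_le_left _ _).trans (by linarith)

/-- Finitely many signals allow the exceptional sets to be united. The bounds for signal `0` only
see true jumps, whence the alternative of no signal and no jump. -/
theorem ae_jump_mem [IsFiniteMeasure ν] (hfin : (range t.ζ).Finite) :
    ∀ᵐ e ∂ν, (t.ζ e = 0 ∧ t.η e = 0) ∨
      (lowerJump ν t (t.ζ e) ≤ t.η e ∧ (t.η e : EReal) ≤ upperJump ν t (t.ζ e)) := by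
  have hζ : ∀ z, MeasurableSet {e | t.ζ e = z} := fun z => t.measurable_ζ (measurableSet_singleton z)
  have key : ∀ z, ∀ᵐ e ∂ν, t.ζ e = z → (t.ζ e = 0 ∧ t.η e = 0) ∨
      (lowerJump ν t z ≤ t.η e ∧ (t.η e : EReal) ≤ upperJump ν t z) := by
    intro z
    have h1 : ∀ᵐ e ∂(markLaw ν t z), lowerJump ν t z ≤ t.η e ∧ (t.η e : EReal) ≤ upperJump ν t z := by
      filter_upwards [ae_le_essSup (f := fun e => (t.η e : EReal)) (μ := markLaw ν t z),
        ae_essInf_le (f := fun e => (t.η e : EReal)) (μ := markLaw ν t z)] with e h1 h2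
      exact ⟨h2, h1⟩
    by_cases hz : z = 0
    · subst hz
      have h0 : MeasurableSet {e | t.ζ e = 0 ∧ t.η e ≠ 0} :=
        (hζ 0).inter (t.measurable_η (measurableSet_singleton 0)).compl
      rw [show markLaw ν t 0 = ν.restrict {e | t.ζ e = 0 ∧ t.η e ≠ 0} from if_pos rfl,
        ae_restrict_iff' h0] at h1
      filter_upwards [h1] with e he hze
      by_cases hη : t.η e = 0
      · exact Or.inl ⟨hze, hη⟩
      · exact Or.inr (he ⟨hze, hη⟩)
    · rw [show markLaw ν t z = ProbabilityTheory.cond ν {e | t.ζ e = z} from if_neg hz,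
        ProbabilityTheory.cond, Measure.ae_ennreal_smul_measure_iff
          (ENNReal.inv_ne_zero.2 (measure_ne_top _ _)), ae_restrict_iff' (hζ z)] at h1
      filter_upwards [h1] with e he hze
      exact Or.inr (he hze)
  have hall := (ae_ball_iff hfin.countable).2 fun z _ => key z
  filter_upwards [hall] with e he
  exact he (t.ζ e) (mem_range_self e) rfl

end Positions

/-! ### Uniform bounds and integrability for admissible strategies -/

section Strategy

variable {E : Type*} [MeasurableSpace E] {ν : Measure E} [IsFiniteMeasure ν]
  {Ty : Set (InvestorType E)} [MeasurableSpace Ty] {TT : Measure Ty} {a b : Ty → ℝ}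
  {π : Ty → ℝ → ℝ}

theorem AdmissibleSignalDriven.exists_bounds (hπ : AdmissibleSignalDriven ν TT a b π)
    (hTT : StandingAssumption ν TT) (hab : SafetyMargins TT a b) :
    ∃ C : ℝ, 0 < C ∧ ∀ᵐ t ∂TT, |π t 0| ≤ C ∧ ∀ᵐ e ∂ν,
      min (a t) (b t) ≤ 1 + π t (t.1.ζ e) * t.1.η e ∧ |π t (t.1.ζ e)| ≤ C ∧ -1 ≤ t.1.η e := by
  obtain ⟨c₀, hc, hjump⟩ := hTT.jump_bounds
  refine ⟨1 / c₀, by positivity, ?_⟩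
  filter_upwards [hjump, hπ.mem_positions, hTT.finite_signals, hTT.nonneg_price]
    with t ⟨⟨hU0, hL0⟩, hz⟩ ⟨hx0, hx⟩ hfin hprice
  refine ⟨abs_le_of_mem_positions hx0 (hab.a_mem t) (hab.b_mem t) hc hU0 hL0, ?_⟩
  filter_upwards [ae_of_ae_map t.1.measurable_ζ.aemeasurable hz,
    ae_of_ae_map t.1.measurable_ζ.aemeasurable hx, ae_jump_mem hfin,
    measure_eq_zero_iff_ae_notMem.1 hprice] with e ⟨hU, hL⟩ hxe hmem hp
  refine ⟨?_, abs_le_of_mem_positions hxe (hab.a_mem t) (hab.b_mem t) hc hU hL, not_lt.1 hp⟩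
  rcases hmem with ⟨-, h0⟩ | ⟨h1, h2⟩
  · rw [h0, mul_zero, add_zero]
    exact (min_le_left _ _).trans (hab.a_mem t).2
  · exact le_one_add_mul_of_mem_positions hxe (hab.a_mem t) (hab.b_mem t) hU hL h1 h2

theorem AdmissibleSignalDriven.ae_pos (hπ : AdmissibleSignalDriven ν TT a b π)
    (hTT : StandingAssumption ν TT) (hab : SafetyMargins TT a b) :
    ∀ᵐ t ∂TT, ∀ᵐ e ∂ν, 0 < 1 + π t (t.1.ζ e) * t.1.η e := by
  obtain ⟨C, -, h⟩ := hπ.exists_bounds hTT hab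
  filter_upwards [h] with t ht
  filter_upwards [ht.2] with e he
  exact (lt_min (hab.a_mem t).1 (hab.b_mem t).1).trans_le he.1

/-- From below by `log m`, from above by `log u ≤ u - 1`. The bound is affine in `1 + y`, the
quantity whose moments are assumed. -/
theorem abs_log_one_add_le {m x y C : ℝ} (hm : 0 < m) (h : m ≤ 1 + x * y) (hx : |x| ≤ C)
    (hy : -1 ≤ y) : |Real.log (1 + x * y)| ≤ |Real.log m| + C * (1 + (1 + y)) := by
  have hC : 0 ≤ C := (abs_nonneg x).trans hx
  have hpos : 0 < 1 + x * y := hm.trans_le h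
  have h1 : |x * y| ≤ C * (1 + (1 + y)) := by
    rw [abs_mul]
    refine mul_le_mul hx ?_ (abs_nonneg y) hC
    rw [abs_le]
    constructor <;> linarith
  rw [abs_le]
  constructor
  · have h2 := Real.log_le_log hm h
    have h3 := neg_abs_le (Real.log m)
    have h4 := (abs_nonneg _).trans h1
    linarith
  · have h2 := Real.log_le_sub_one_of_pos hpos
    have h3 := le_abs_self (x * y)
    have h4 := abs_nonneg (Real.log m)
    linarith

theorem measurable_log_jump (hTy : MeasurableTypes Ty)
    (hπm : Measurable (fun p : Ty × ℝ => π p.1 p.2)) :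
    Measurable fun p : Ty × E => Real.log (1 + π p.1 (p.1.1.ζ p.2) * p.1.1.η p.2) := by
  have h1 : Measurable fun p : Ty × E => π p.1 (p.1.1.ζ p.2) :=
    hπm.comp (measurable_fst.prodMk hTy.ζ)
  exact Real.measurable_log.comp ((h1.mul hTy.η).const_add 1)

theorem AdmissibleSignalDriven.integrable_log_jump [IsProbabilityMeasure TT]
    (hπ : AdmissibleSignalDriven ν TT a b π)
    (hTy : MeasurableTypes Ty) (hTT : StandingAssumption ν TT) (hab : SafetyMargins TT a b) :
    Integrable (fun p : Ty × E => Real.log (1 + π p.1 (p.1.1.ζ p.2) * p.1.1.η p.2))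
      (TT.prod ν) := by
  have hm := measurable_log_jump (E := E) hTy hπ.measurable
  obtain ⟨C, hC, hbd⟩ := hπ.exists_bounds hTT hab
  have hmin : ∀ t, 0 < min (a t) (b t) := fun t => lt_min (hab.a_mem t).1 (hab.b_mem t).1
  by_cases hfin : FinitelyManyTypes TT
  · obtain ⟨S, hS, hTS⟩ := id hfin
    set g : Ty → ℝ≥0∞ := fun t =>
      ∫⁻ e, ‖Real.log (1 + π t (t.1.ζ e) * t.1.η e)‖ₑ ∂ν with hg
    have hgfin : ∀ᵐ t ∂TT, g t < ∞ := by
      filter_upwards [hbd, hTT.moments hfin] with t ht hmom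
      have h1 : Integrable (fun e => 1 + t.1.η e) ν := by
        simpa using hmom 1 one_pos
      have h2 : Integrable (fun e => Real.log (1 + π t (t.1.ζ e) * t.1.η e)) ν := by
        refine ((integrable_const (|Real.log (min (a t) (b t))|)).add
          (((integrable_const (1 : ℝ)).add h1).const_mul C)).mono'
          (hm.comp measurable_prodMk_left).aestronglyMeasurable ?_
        filter_upwards [ht.2] with e he
        exact abs_log_one_add_le (hmin t) he.1 he.2.1 he.2.2
      exact h2.2
    refine ⟨hm.aestronglyMeasurable, ?_⟩
    rw [hasFiniteIntegral_iff_enorm, lintegral_prod _ hm.enorm.aemeasurable]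
    -- Single types need not be measurable sets, so the fibre integrals are dominated by a constant;
    -- exceptional members of `S` with infinite integral are discarded.
    have hle : ∀ᵐ t ∂TT, g t ≤ ∑ s ∈ hS.toFinset, if g s < ∞ then g s else 0 := by
      filter_upwards [hTS, hgfin] with t htS htf
      have h1 := Finset.single_le_sum (f := fun s => if g s < ∞ then g s else 0)
        (fun _ _ => zero_le) (hS.mem_toFinset.2 htS)
      simpa only [if_pos htf] using h1
    refine (lintegral_mono_ae hle).trans_lt ?_
    rw [lintegral_const, measure_univ, mul_one]
    refine ENNReal.sum_lt_top.2 fun s _ => ?_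
    split_ifs with h
    · exact h
    · exact ENNReal.zero_lt_top
  · obtain ⟨C', hC'⟩ := hTT.bounded_jumps hfin
    obtain ⟨a₀, b₀, hconst⟩ := hab.const hfin
    refine Integrable.of_bound hm.aestronglyMeasurable
      (|Real.log (min a₀ b₀)| + C * (1 + (1 + C'))) ?_
    have hmeas : MeasurableSet {p : Ty × E | p.1.1.η p.2 ≤ C' →
        ‖Real.log (1 + π p.1 (p.1.1.ζ p.2) * p.1.1.η p.2)‖
          ≤ |Real.log (min a₀ b₀)| + C * (1 + (1 + C'))} :=
      (measurableSet_le hTy.η measurable_const).imp (measurableSet_le hm.norm measurable_const)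
    have hae : ∀ᵐ p ∂(TT.prod ν), p.1.1.η p.2 ≤ C' →
        ‖Real.log (1 + π p.1 (p.1.1.ζ p.2) * p.1.1.η p.2)‖
          ≤ |Real.log (min a₀ b₀)| + C * (1 + (1 + C')) := by
      refine (Measure.ae_prod_iff_ae_ae hmeas).2 ?_
      filter_upwards [hbd] with t ht
      filter_upwards [ht.2] with e he hle
      have h1 := abs_log_one_add_le (hmin t) he.1 he.2.1 he.2.2
      rw [(hconst t).1, (hconst t).2] at h1
      refine h1.trans ?_
      gcongr
    filter_upwards [hae, hC'] with p h1 h2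
    exact h1 h2

theorem AdmissibleSignalDriven.integrable_parameters [IsProbabilityMeasure TT]
    (hπ : AdmissibleSignalDriven ν TT a b π)
    (hTy : MeasurableTypes Ty) (hTT : StandingAssumption ν TT) (hab : SafetyMargins TT a b) :
    Integrable (fun t : Ty => t.1.r + π t 0 * (t.1.κ - t.1.r)
        - 1 / 2 * (t.1.σ ^ 2 + t.1.σ₀ ^ 2) * (π t 0) ^ 2) TT ∧
      Integrable (fun t : Ty => t.1.σ * π t 0) TT ∧
      Integrable (fun t : Ty => t.1.σ₀ * π t 0) TT := by
  obtain ⟨C, hC, hbd⟩ := hπ.exists_bounds hTT hab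
  obtain ⟨D, hD⟩ := hTT.bounded_parameters
  have hπ0 : Measurable fun t => π t 0 := hπ.measurable.comp (measurable_id.prodMk measurable_const)
  have hr := hTy.r
  have hκ := hTy.κ
  have hσ := hTy.σ
  have hσ₀ := hTy.σ₀
  have hpar : ∀ᵐ t ∂TT, |t.1.r| ≤ D ∧ |t.1.κ| ≤ D ∧ |t.1.σ| ≤ D ∧ |t.1.σ₀| ≤ D := by
    filter_upwards [hD] with t ht
    have h1 := t.1.σ_nonneg
    have h2 := t.1.σ₀_nonneg
    have h3 := t.1.α_pos
    have h4 := abs_nonneg t.1.r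
    have h5 := abs_nonneg t.1.κ
    rw [abs_of_nonneg h1, abs_of_nonneg h2]
    refine ⟨?_, ?_, ?_, ?_⟩ <;> linarith
  refine ⟨?_, ?_, ?_⟩
  · refine Integrable.of_bound (C := D + C * (D + D) + 1 / 2 * (D ^ 2 + D ^ 2) * C ^ 2)
      (by fun_prop) ?_
    filter_upwards [hbd, hpar] with t ⟨h0, _⟩ ⟨h1, h2, h3, h4⟩
    rw [Real.norm_eq_abs]
    refine (abs_sub _ _).trans (add_le_add ((abs_add_le _ _).trans (add_le_add h1 ?_)) ?_)
    · rw [abs_mul]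
      exact mul_le_mul h0 ((abs_sub _ _).trans (add_le_add h2 h1)) (abs_nonneg _) hC.le
    · rw [abs_mul, abs_mul, abs_of_pos (by norm_num : (0 : ℝ) < 1 / 2),
        abs_of_nonneg (by positivity : 0 ≤ t.1.σ ^ 2 + t.1.σ₀ ^ 2), abs_pow, ← sq_abs t.1.σ,
        ← sq_abs t.1.σ₀]
      gcongr
  · refine Integrable.of_bound (C := D * C) (by fun_prop) ?_
    filter_upwards [hbd, hpar] with t ⟨h0, _⟩ ⟨h1, h2, h3, h4⟩
    rw [Real.norm_eq_abs, abs_mul]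
    exact mul_le_mul h3 h0 (abs_nonneg _) ((abs_nonneg _).trans h3)
  · refine Integrable.of_bound (C := D * C) (by fun_prop) ?_
    filter_upwards [hbd, hpar] with t ⟨h0, _⟩ ⟨h1, h2, h3, h4⟩
    rw [Real.norm_eq_abs, abs_mul]
    exact mul_le_mul h4 h0 (abs_nonneg _) ((abs_nonneg _).trans h4)

end Strategy

/-! ### Integrability of the jump returns in the type and the idiosyncratic mark -/

section CommonMarks

theorem measurePreserving_prod_left_comm {A B C : Type*} [MeasurableSpace A] [MeasurableSpace B]
    [MeasurableSpace C] (α : Measure A) (β : Measure B) (γ : Measure C) [SFinite α] [SFinite β]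
    [SFinite γ] :
    MeasurePreserving (fun p : A × (B × C) => (p.2.1, (p.1, p.2.2))) (α.prod (β.prod γ))
      (β.prod (α.prod γ)) := by
  have h1 : MeasurePreserving (MeasurableEquiv.prodAssoc : (A × B) × C ≃ᵐ A × (B × C)).symm
      (α.prod (β.prod γ)) ((α.prod β).prod γ) := (measurePreserving_prodAssoc α β γ).symm _
  have h2 : MeasurePreserving (Prod.map Prod.swap id : (A × B) × C → (B × A) × C)
      ((α.prod β).prod γ) ((β.prod α).prod γ) :=
    Measure.measurePreserving_swap.prod (.id γ)
  exact (measurePreserving_prodAssoc β α γ).comp (h2.comp h1)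

variable {Ec Ei : Type*} [MeasurableSpace Ec] [MeasurableSpace Ei]
  {Ty : Set (InvestorType (Ec × Ei))} [MeasurableSpace Ty] {TT : Measure Ty}
  {lam : ℝ≥0} {νc : Measure Ec} {νi : Measure Ei} [IsProbabilityMeasure νc]
  [IsProbabilityMeasure νi] {a b : Ty → ℝ} {π : Ty → ℝ → ℝ}

instance : IsFiniteMeasure (jumpIntensity lam νc νi) := by
  unfold jumpIntensity; infer_instance

theorem AdmissibleSignalDriven.integrable_logJump [IsProbabilityMeasure TT]
    (hπ : AdmissibleSignalDriven (jumpIntensity lam νc νi) TT a b π) (hlam : 0 < lam)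
    (hTy : MeasurableTypes Ty) (hTT : StandingAssumption (jumpIntensity lam νc νi) TT)
    (hab : SafetyMargins TT a b) :
    Integrable (fun p : Ec × (Ty × Ei) => logJump π p.2.1 (p.1, p.2.2)) (νc.prod (TT.prod νi)) := by
  have h1 := hπ.integrable_log_jump hTy hTT hab
  have h2 : TT.prod (jumpIntensity lam νc νi) = lam • TT.prod (νc.prod νi) := by
    exact Measure.prod_smul_right lam
  rw [h2] at h1
  have h3 := (integrable_smul_measure (c := (lam : ℝ≥0∞)) (by simpa using hlam.ne')
    ENNReal.coe_ne_top).1 h1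
  have hmp := measurePreserving_prod_left_comm TT νc νi
  have hg : Measurable fun p : Ec × (Ty × Ei) => ((p.2.1, (p.1, p.2.2)) : Ty × (Ec × Ei)) := by
    fun_prop
  have hm : Measurable fun p : Ec × (Ty × Ei) => logJump π p.2.1 (p.1, p.2.2) :=
    (measurable_log_jump hTy hπ.measurable).comp hg
  rw [← hmp.integrable_comp hm.aestronglyMeasurable]
  exact h3

end CommonMarks

/-! ### Information -/

section Information

variable {Ω S ι : Type*} {G : MeasurableSpace Ω} [m0 : MeasurableSpace Ω] [MeasurableSpace S]
  {P : Measure Ω} {B : ι → ℝ≥0 → Ω → ℝ} {N : Ω → Measure (ℝ≥0 × S)}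

theorem monotone_informationAt : Monotone (informationAt G P B N) := by
  intro s t hst
  refine sup_le_sup_right (sup_le_sup (sup_le_sup_left (iSup_mono fun i => ?_) _) ?_) _
  · exact iSup_le fun u => le_iSup (fun u : Iic t => MeasurableSpace.comap (B i u) inferInstance)
      ⟨u.1, u.2.trans hst⟩
  · exact iSup_le fun u => le_iSup (fun u : Iic t => ⨆ A : {A : Set S // MeasurableSet A},
        MeasurableSpace.comap (fun ω => N ω (Iic (u : ℝ≥0) ×ˢ (A : Set S))) inferInstance)
      ⟨u.1, u.2.trans hst⟩

theorem nullSigma_le : nullSigma P ≤ m0 :=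
  MeasurableSpace.generateFrom_le fun _ h => h.1

theorem informationAt_le (hG : G ≤ m0) (hB : ∀ i t, Measurable (B i t)) (hN : Measurable N)
    (t : ℝ≥0) : informationAt G P B N t ≤ m0 := by
  refine sup_le (sup_le (sup_le hG ?_) ?_) nullSigma_le
  · exact iSup₂_le fun i s => (hB i s).comap_le
  · exact iSup₂_le fun s A =>
      ((Measure.measurable_coe (measurableSet_Iic.prod A.2)).comp hN).comap_le

theorem measurable_informationAt (i : ι) (t : ℝ≥0) :
    Measurable[informationAt G P B N t] (B i t) := by
  rw [measurable_iff_comap_le]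
  refine le_trans ?_ (le_sup_of_le_left (le_sup_of_le_left le_sup_right))
  exact le_iSup₂_of_le (f := fun i (s : Iic t) => MeasurableSpace.comap (B i s) inferInstance)
    i ⟨t, self_mem_Iic⟩ le_rfl

theorem le_informationAt (t : ℝ≥0) : G ≤ informationAt G P B N t :=
  le_sup_of_le_left (le_sup_of_le_left le_sup_left)

end Information

/-! ### The logarithm of the wealth -/

/-- Every atom has positive mass and cannot lie in a null set. -/
theorem HasAtoms.forall_of_ae {E : Type*} [MeasurableSpace E] [MeasurableSingletonClass E]
    {n : Measure (ℝ≥0 × E)} {T : ℝ≥0} {K : Finset ℕ} {p : ℕ → ℝ≥0 × E} (h : HasAtoms n T K p)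
    {Q : ℝ≥0 × E → Prop} (hQ : ∀ᵐ q ∂(n.restrict (Iic T ×ˢ univ)), Q q) : ∀ k ∈ K, Q (p k) := by
  intro k hk
  by_contra hkQ
  rw [h.restrict_eq, ae_iff] at hQ
  have h1 : (∑ k ∈ K, Measure.dirac (p k)) {p k} = 0 :=
    measure_mono_null (by simpa using hkQ) hQ
  rw [Measure.finsetSum_apply] at h1
  have h2 := (Finset.sum_eq_zero_iff.1 h1) k hk
  simp at h2

theorem IsWealthProcess.log_eq {Ω E : Type*} [m0 : MeasurableSpace Ω] [MeasurableSpace E]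
    [MeasurableSingletonClass E] {P : Measure Ω} [IsProbabilityMeasure P]
    {F : ℝ≥0 → MeasurableSpace Ω} (hFmono : Monotone F) (hFle : ∀ t, F t ≤ m0) {T : ℝ≥0}
    {W W₀ : ℝ≥0 → Ω → ℝ} (hW : ∀ t, Measurable[F t] (W t)) (hW₀ : ∀ t, Measurable[F t] (W₀ t))
    {N : Ω → Measure (ℝ≥0 × E)} {x₀ r κ σ σ₀ : Ω → ℝ} {η ζ : Ω → E → ℝ} {φ : Ω → ℝ → ℝ}
    {X : ℝ≥0 → Ω → ℝ} (h : IsWealthProcess P F T W W₀ N x₀ r κ σ σ₀ η ζ φ X)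
    (hr : Measurable[F 0] r) (hκ : Measurable[F 0] κ) (hσ : Measurable[F 0] σ)
    (hσ₀ : Measurable[F 0] σ₀) (hφ : Measurable[F 0] (fun ω => φ ω 0))
    (hpath : ∀ᵐ ω ∂P, IsDrivingPath T (W · ω) (W₀ · ω)) (hx₀ : ∀ ω, 0 < x₀ ω)
    (hatoms : ∀ᵐ ω ∂P, ∃ K p, HasAtoms (N ω) T K p)
    (hpos : ∀ᵐ ω ∂P, ∀ᵐ q ∂((N ω).restrict (Iic T ×ˢ univ)),
      0 < 1 + φ ω (ζ ω q.2) * η ω q.2) :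
    ∀ᵐ ω ∂P, ∀ t ≤ T, 0 < X t ω ∧ Real.log (X t ω) = Real.log (x₀ ω)
        + (r ω + φ ω 0 * (κ ω - r ω) - 1 / 2 * (σ ω ^ 2 + σ₀ ω ^ 2) * φ ω 0 ^ 2) * t
        + (σ ω * φ ω 0) * W t ω + (σ₀ ω * φ ω 0) * W₀ t ω
        + ∫ q in Iic t ×ˢ univ, Real.log (1 + φ ω (ζ ω q.2) * η ω q.2) ∂(N ω) := by
  filter_upwards [h.eq_exp_mul_prod hFmono hFle hW hW₀ hr hκ hσ hσ₀ hφ hpath, hatoms, hpos]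
    with ω hX ⟨K, p, hK⟩ hq t ht
  have hk := hK.forall_of_ae hq
  have hk' : ∀ k ∈ K.filter fun k => (p k).1 ≤ t,
      0 < 1 + η ω (p k).2 * φ ω (ζ ω (p k).2) := by
    intro k hkt
    rw [mul_comm]
    exact hk k (Finset.mem_filter.1 hkt).1
  rw [hX K p hK t ht, hK.setIntegral ht]
  refine ⟨mul_pos (mul_pos (hx₀ ω) (Real.exp_pos _)) (Finset.prod_pos hk'), ?_⟩
  rw [Real.log_mul (mul_pos (hx₀ ω) (Real.exp_pos _)).ne' (Finset.prod_pos hk').ne',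
    Real.log_mul (hx₀ ω).ne' (Real.exp_ne_zero _), Real.log_exp,
    Real.log_prod fun k hkt => (hk' k hkt).ne']
  simp_rw [mul_comm (φ ω (ζ ω _))]
  unfold logReturn
  ring

theorem ae_isDrivingPath {Ω : Type*} [MeasurableSpace Ω] {P : Measure Ω} [IsProbabilityMeasure P]
    {W W₀ : ℝ≥0 → Ω → ℝ} (hW : IsBM P W) (hW₀ : IsBM P W₀)
    (hind : Indep (processSigma W) (processSigma W₀) P) (T : ℝ≥0) :
    ∀ᵐ ω ∂P, IsDrivingPath T (W · ω) (W₀ · ω) := by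
  filter_upwards [hW.brownian.cont, hW₀.brownian.cont, hW.brownian.eval_zero_ae_eq_zero,
    hW₀.brownian.eval_zero_ae_eq_zero, hW.ae_hasDyadicCov_self T, hW₀.ae_hasDyadicCov_self T,
    hW.ae_hasDyadicCov_of_indep hW₀ hind T] with ω h1 h2 h3 h4 h5 h6 h7
  exact ⟨h1, h2, h3, h4, h5, h6, h7⟩

/-! ### Integrals against a Poisson random measure -/

section PoissonIntegral

variable {Ω S Θ : Type*} [MeasurableSpace Ω] [MeasurableSpace S] [MeasurableSpace Θ]
  {P : Measure Ω} [IsProbabilityMeasure P] {m : Measure S} {N : Ω → Measure S}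

theorem IsPoissonRandomMeasure.integrable_prod_setIntegral (h : IsPoissonRandomMeasure P m N)
    {B : Set S} (hB : MeasurableSet B) (hfin : m B < ∞) {α : Measure Θ} [SFinite α]
    {f : Θ × S → ℝ} (hf : Measurable f) (hint : Integrable f (α.prod (m.restrict B))) :
    Integrable (fun q : Θ × Ω => ∫ p in B, f (q.1, p) ∂(N q.2)) (α.prod P) ∧
      ∀ᵐ ω ∂P, Integrable f (α.prod ((N ω).restrict B)) := by
  have : IsFiniteMeasure (m.restrict B) := ⟨by rwa [Measure.restrict_apply_univ]⟩
  obtain ⟨h1, h2⟩ := h.lintegral_prod_lintegral hB hfin α hf.enorm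
  rw [← lintegral_prod _ hf.enorm.aemeasurable] at h2
  have h3 : ∫⁻ q, ∫⁻ p in B, ‖f (q.1, p)‖ₑ ∂(N q.2) ∂(α.prod P) < ∞ := h2 ▸ hint.2
  let κ : Kernel (Θ × Ω) S := (truncKernel B hB).comap (fun q => N q.2)
    (h.measurable.comp measurable_snd)
  have hκ : ∀ᵐ q ∂(α.prod P), κ q = (N q.2).restrict B := by
    filter_upwards [Measure.quasiMeasurePreserving_snd.ae (h.ae_lt_top hB hfin)] with q hq
    exact truncKernel_apply B hB hq
  have hm : StronglyMeasurable fun q : Θ × Ω => ∫ p, f (q.1, p) ∂(κ q) := by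
    refine StronglyMeasurable.integral_kernel_prod_right' (κ := κ)
      (f := fun r : (Θ × Ω) × S => f (r.1.1, r.2)) ?_
    exact (hf.comp (by fun_prop : Measurable fun r : (Θ × Ω) × S => (r.1.1, r.2))).stronglyMeasurable
  refine ⟨⟨⟨_, hm, ?_⟩, ?_⟩, ?_⟩
  · filter_upwards [hκ] with q hq
    rw [hq]
  · refine lt_of_le_of_lt (lintegral_mono fun q => ?_) h3
    exact enorm_integral_le_lintegral_enorm _
  · rw [lintegral_prod_symm _ h1] at h3
    filter_upwards [ae_lt_top' h1.lintegral_prod_left' h3.ne, h.ae_lt_top hB hfin] with ω h4 h5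
    have : IsFiniteMeasure ((N ω).restrict B) := ⟨by rwa [Measure.restrict_apply_univ]⟩
    refine ⟨hf.aestronglyMeasurable, ?_⟩
    rw [hasFiniteIntegral_iff_enorm, lintegral_prod _ hf.enorm.aemeasurable]
    exact h4

theorem IsPoissonRandomMeasure.ae_integrableOn (h : IsPoissonRandomMeasure P m N)
    {B : Set S} (hB : MeasurableSet B) (hfin : m B < ∞) {f : S → ℝ} (hf : Measurable f)
    (hint : IntegrableOn f B m) : ∀ᵐ ω ∂P, IntegrableOn f B (N ω) := by
  have h1 := h.lintegral_lintegral hB hfin hf.enorm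
  have h2 : Measurable fun ω => ∫⁻ p in B, ‖f p‖ₑ ∂(N ω) :=
    (Measure.measurable_lintegral hf.enorm).comp
      ((measurable_restrict_measure hB).comp h.measurable)
  filter_upwards [MeasureTheory.ae_lt_top h2 (h1.trans_lt hint.2).ne] with ω hω
  exact ⟨hf.aestronglyMeasurable, hω⟩

theorem setIntegral_setIntegral_eq_sub (h : IsPoissonRandomMeasure P m N)
    {B : Set S} (hB : MeasurableSet B) (hfin : m B < ∞) {f : S → ℝ} (hf : Measurable f)
    (hint : IntegrableOn f B m) (A : Set Ω) :
    ∫⁻ ω in A, ∫⁻ p in B, ENNReal.ofReal (f p) ∂(N ω) ∂P < ∞ ∧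
    ∫⁻ ω in A, ∫⁻ p in B, ENNReal.ofReal (-f p) ∂(N ω) ∂P < ∞ ∧
    ∫ ω in A, ∫ p in B, f p ∂(N ω) ∂P
      = (∫⁻ ω in A, ∫⁻ p in B, ENNReal.ofReal (f p) ∂(N ω) ∂P).toReal
        - (∫⁻ ω in A, ∫⁻ p in B, ENNReal.ofReal (-f p) ∂(N ω) ∂P).toReal := by
  have hmeas : ∀ {g : S → ℝ}, Measurable g →
      Measurable fun ω => ∫⁻ p in B, ENNReal.ofReal (g p) ∂(N ω) := fun hg =>
    (Measure.measurable_lintegral hg.ennreal_ofReal).comp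
      ((measurable_restrict_measure hB).comp h.measurable)
  have hfinite : ∀ {g : S → ℝ}, Measurable g → IntegrableOn g B m →
      ∫⁻ ω in A, ∫⁻ p in B, ENNReal.ofReal (g p) ∂(N ω) ∂P < ∞ := by
    intro g hg hgi
    refine (setLIntegral_le_lintegral _ _).trans_lt ?_
    rw [h.lintegral_lintegral hB hfin hg.ennreal_ofReal]
    exact hgi.lintegral_lt_top
  have h1 := hfinite hf hint
  have h2 : ∫⁻ ω in A, ∫⁻ p in B, ENNReal.ofReal (-f p) ∂(N ω) ∂P < ∞ := hfinite hf.neg hint.neg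
  have h3 := hmeas hf
  have h4 : Measurable fun ω => ∫⁻ p in B, ENNReal.ofReal (-f p) ∂(N ω) := hmeas hf.neg
  refine ⟨h1, h2, ?_⟩
  rw [← integral_toReal h3.aemeasurable (MeasureTheory.ae_lt_top h3 h1.ne),
    ← integral_toReal h4.aemeasurable (MeasureTheory.ae_lt_top h4 h2.ne),
    ← integral_sub (integrable_toReal_of_lintegral_ne_top h3.aemeasurable h1.ne)
      (integrable_toReal_of_lintegral_ne_top h4.aemeasurable h2.ne)]
  refine integral_congr_ae ?_
  filter_upwards [ae_restrict_of_ae (h.ae_integrableOn hB hfin hf hint)] with ω hω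
  exact integral_eq_lintegral_pos_part_sub_lintegral_neg_part hω

theorem toReal_sub_toReal_eq_iff {a b c d : ℝ≥0∞} (ha : a ≠ ∞) (hb : b ≠ ∞) (hc : c ≠ ∞)
    (hd : d ≠ ∞) : a.toReal - b.toReal = c.toReal - d.toReal ↔ a + d = c + b := by
  rw [← ENNReal.toReal_eq_toReal_iff' (ENNReal.add_ne_top.2 ⟨ha, hd⟩)
    (ENNReal.add_ne_top.2 ⟨hc, hb⟩), ENNReal.toReal_add ha hd, ENNReal.toReal_add hc hb]
  constructor <;> intro h <;> linarith

/-- Sums over the points of a Poisson random measure of two functions with the same projections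
under `q` have the same mean on the events that are determined by the image under `q` and an
independent random variable. -/
theorem IsPoissonRandomMeasure.setIntegral_congr_of_indepFun {S' : Type*} [MeasurableSpace S']
    (h : IsPoissonRandomMeasure P m N)
    {B : Set S} (hB : MeasurableSet B) (hfin : m B < ∞) {q : S → S'} (hq : Measurable q)
    {f g : S → ℝ} (hf : Measurable f) (hg : Measurable g) (hfi : IntegrableOn f B m)
    (hgi : IntegrableOn g B m)
    (hfg : ∀ D, MeasurableSet D → ∫ p in q ⁻¹' D ∩ B, f p ∂m = ∫ p in q ⁻¹' D ∩ B, g p ∂m)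
    {θ : Ω → Θ} (hθ : Measurable θ) (hind : IndepFun θ N P)
    {V : Set (Θ × Measure S')} (hV : MeasurableSet V) :
    ∫ ω in {ω | (θ ω, (N ω).map q) ∈ V}, ∫ p in B, f p ∂(N ω) ∂P
      = ∫ ω in {ω | (θ ω, (N ω).map q) ∈ V}, ∫ p in B, g p ∂(N ω) ∂P := by
  set A := {ω | (θ ω, (N ω).map q) ∈ V}
  obtain ⟨f1, f2, f3⟩ := setIntegral_setIntegral_eq_sub h hB hfin hf hfi A
  obtain ⟨g1, g2, g3⟩ := setIntegral_setIntegral_eq_sub h hB hfin hg hgi A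
  -- Rearranged without subtraction, this compares the non-negative functions `f⁺ + g⁻` and `g⁺ +
  -- f⁻`, to which the non-negative version applies.
  rw [f3, g3, toReal_sub_toReal_eq_iff f1.ne f2.ne g1.ne g2.ne]
  have hmeas : ∀ {g : S → ℝ}, Measurable g →
      Measurable fun ω => ∫⁻ p in B, ENNReal.ofReal (g p) ∂(N ω) := fun hg =>
    (Measure.measurable_lintegral hg.ennreal_ofReal).comp
      ((measurable_restrict_measure hB).comp h.measurable)
  rw [← lintegral_add_left (hmeas hf), ← lintegral_add_left (hmeas hg)]
  simp_rw [← lintegral_add_left hf.ennreal_ofReal, ← lintegral_add_left hg.ennreal_ofReal]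
  have hneg : ∀ {g : S → ℝ}, Measurable g → Measurable fun p => ENNReal.ofReal (-g p) :=
    fun hg => hg.neg.ennreal_ofReal
  have hnegi : ∀ {g : S → ℝ}, IntegrableOn g B m → ∫⁻ p in B, ENNReal.ofReal (-g p) ∂m < ∞ :=
    fun hg => hg.neg.lintegral_lt_top
  refine h.setLIntegral_congr_of_indepFun hB hfin hq (hf.ennreal_ofReal.add (hneg hg))
    (hg.ennreal_ofReal.add (hneg hf)) ?_ ?_ hθ hind hV
  · simp only [Pi.add_apply]
    rw [lintegral_add_left hf.ennreal_ofReal]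
    exact (ENNReal.add_lt_top.2 ⟨hfi.lintegral_lt_top, hnegi hgi⟩).ne
  · ext D hD
    rw [Measure.map_apply hq hD, Measure.map_apply hq hD, withDensity_apply _ (hq hD),
      withDensity_apply _ (hq hD), Measure.restrict_restrict (hq hD)]
    simp only [Pi.add_apply]
    rw [lintegral_add_left hf.ennreal_ofReal, lintegral_add_left hg.ennreal_ofReal]
    have hsub : ∀ {g : S → ℝ}, IntegrableOn g B m → IntegrableOn g (q ⁻¹' D ∩ B) m :=
      fun hg => hg.mono_set inter_subset_right
    have e := hfg D hD
    rw [integral_eq_lintegral_pos_part_sub_lintegral_neg_part (hsub hfi),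
      integral_eq_lintegral_pos_part_sub_lintegral_neg_part (hsub hgi)] at e
    exact (toReal_sub_toReal_eq_iff (hsub hfi).lintegral_lt_top.ne
      (hsub hfi).neg.lintegral_lt_top.ne (hsub hgi).lintegral_lt_top.ne
      (hsub hgi).neg.lintegral_lt_top.ne).1 e

end PoissonIntegral

/-! ### Random measures observed on a time interval -/

section Observed

variable {Ω S : Type*} [MeasurableSpace S]

/-- The rectangles `Iic s ×ˢ A` form a generating π-system. The π-system argument is for finite
measures, hence the replacement by zero where the mass up to `T` is infinite. -/
theorem exists_measurable_restrict {G : MeasurableSpace Ω} {n : Ω → Measure (ℝ≥0 × S)} {T : ℝ≥0}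
    (hn : ∀ s ≤ T, ∀ A, MeasurableSet A → Measurable[G] fun ω => n ω (Iic s ×ˢ A)) :
    ∃ n' : Ω → Measure (ℝ≥0 × S), Measurable[G] n' ∧
      ∀ ω, n ω (Iic T ×ˢ univ) < ∞ → n' ω = (n ω).restrict (Iic T ×ˢ univ) := by
  classical
  have hT : Measurable[G] fun ω => n ω (Iic T ×ˢ univ) := hn T le_rfl univ .univ
  let n' : Ω → Measure (ℝ≥0 × S) := fun ω =>
    if n ω (Iic T ×ˢ univ) < ∞ then (n ω).restrict (Iic T ×ˢ univ) else 0
  have hfin : ∀ ω, IsFiniteMeasure (n' ω) := by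
    intro ω
    simp only [n']
    split_ifs with h
    · exact ⟨by rwa [Measure.restrict_apply_univ]⟩
    · infer_instance
  have hC : MeasurableSpace.generateFrom (range (Iic : ℝ≥0 → Set ℝ≥0))
      = (inferInstance : MeasurableSpace ℝ≥0) :=
    (borel_eq_generateFrom_Iic ℝ≥0).symm.trans (BorelSpace.measurable_eq (α := ℝ≥0)).symm
  have hCs : IsCountablySpanning (range (Iic : ℝ≥0 → Set ℝ≥0)) := by
    refine ⟨fun k : ℕ => Iic (k : ℝ≥0), fun k => mem_range_self _, ?_⟩
    refine eq_univ_of_forall fun s => ?_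
    obtain ⟨k, hk⟩ := exists_nat_ge s
    exact mem_iUnion.2 ⟨k, hk⟩
  have happ : ∀ s A, MeasurableSet A → Measurable[G] fun ω => n' ω (Iic s ×ˢ A) := by
    intro s A hA
    have e : (fun ω => n' ω (Iic s ×ˢ A)) = fun ω =>
        if n ω (Iic T ×ˢ univ) < ∞ then n ω (Iic (min s T) ×ˢ A) else 0 := by
      funext ω
      simp only [n']
      split_ifs with h
      · rw [Measure.restrict_apply (measurableSet_Iic.prod hA), prod_inter_prod, Iic_inter_Iic,
          inter_univ]
      · rfl
    rw [e]
    exact Measurable.ite (measurableSet_lt hT measurable_const)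
      (hn _ (min_le_right _ _) A hA) measurable_const
  refine ⟨n', ?_, fun ω h => if_pos h⟩
  refine @Measurable.measure_of_isPiSystem Ω (ℝ≥0 × S) G _ n' hfin _
    (generateFrom_eq_prod hC MeasurableSpace.generateFrom_measurableSet hCs
      isCountablySpanning_measurableSet).symm
    (IsPiSystem.prod isPiSystem_Iic MeasurableSpace.isPiSystem_measurableSet) ?_ ?_
  · rintro _ ⟨_, ⟨s, rfl⟩, A, hA, rfl⟩
    exact happ s A hA
  · have e : ∀ ω, n' ω univ = n' ω (Iic T ×ˢ univ) := by
      intro ω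
      simp only [n']
      split_ifs with h
      · rw [Measure.restrict_apply_univ, Measure.restrict_apply_self]
      · rfl
    simp_rw [e]
    exact happ T univ .univ

theorem aestronglyMeasurable_setIntegral {G m0 : MeasurableSpace Ω} {P : @Measure Ω m0}
    {n : Ω → Measure (ℝ≥0 × S)} {t T : ℝ≥0} (ht : t ≤ T)
    (hn : ∀ s ≤ T, ∀ A, MeasurableSet A → Measurable[G] fun ω => n ω (Iic s ×ˢ A))
    (hfin : ∀ᵐ ω ∂P, n ω (Iic T ×ˢ univ) < ∞) {f : ℝ≥0 × S → ℝ} (hf : Measurable f)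
    (hint : ∀ᵐ ω ∂P, IntegrableOn f (Iic t ×ˢ univ) (n ω)) :
    AEStronglyMeasurable[G] (fun ω => ∫ p in Iic t ×ˢ univ, f p ∂(n ω)) P := by
  obtain ⟨n', hn', he⟩ := exists_measurable_restrict hn
  have hm : ∀ {g : ℝ≥0 × S → ℝ≥0∞}, Measurable g →
      Measurable[G] fun ω => ∫⁻ p in Iic t ×ˢ univ, g p ∂(n' ω) := fun hg =>
    ((Measure.measurable_lintegral hg).comp
      (measurable_restrict_measure (measurableSet_Iic.prod .univ))).comp hn'
  refine ⟨fun ω => (∫⁻ p in Iic t ×ˢ univ, ENNReal.ofReal (f p) ∂(n' ω)).toReal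
    - (∫⁻ p in Iic t ×ˢ univ, ENNReal.ofReal (-f p) ∂(n' ω)).toReal,
    (Measurable.sub (hm hf.ennreal_ofReal).ennreal_toReal
      (hm hf.neg.ennreal_ofReal).ennreal_toReal).stronglyMeasurable, ?_⟩
  filter_upwards [hfin, hint] with ω h1 h2
  rw [he ω h1, Measure.restrict_restrict_of_subset (prod_mono (Iic_subset_Iic.2 ht) subset_rfl)]
  exact integral_eq_lintegral_pos_part_sub_lintegral_neg_part h2

end Observed

/-! ### Projection to the common marks -/

section Projection

variable {Ec Ei : Type*} [MeasurableSpace Ec] [MeasurableSpace Ei] {lam : ℝ≥0}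
  {νc : Measure Ec} {νi : Measure Ei} [IsProbabilityMeasure νc] [IsProbabilityMeasure νi]

theorem integrableOn_comp_snd {E : Type*} [MeasurableSpace E] {ν : Measure E} [IsFiniteMeasure ν]
    {F : E → ℝ} (hF : Integrable F ν) (t : ℝ≥0) :
    IntegrableOn (fun p : ℝ≥0 × E => F p.2) (Iic t ×ˢ univ) (timeMeasure.prod ν) := by
  rw [IntegrableOn, ← Measure.prod_restrict, Measure.restrict_univ]
  exact hF.comp_snd _

theorem setIntegral_preimage_common {F : Ec × Ei → ℝ}
    (hF : Integrable F (jumpIntensity lam νc νi)) (t : ℝ≥0) (D : Set (ℝ≥0 × Ec)) :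
    ∫ p in (fun p : ℝ≥0 × (Ec × Ei) => (p.1, p.2.1)) ⁻¹' D ∩ Iic t ×ˢ univ, F p.2
        ∂(timeMeasure.prod (jumpIntensity lam νc νi))
      = ∫ r in D ∩ Iic t ×ˢ univ, ∫ i, F (r.2, i) ∂νi ∂(timeMeasure.prod (lam • νc)) := by
  have hν : jumpIntensity lam νc νi = (lam • νc).prod νi := (Measure.prod_smul_left lam).symm
  have hF' := integrableOn_comp_snd hF t
  rw [hν] at hF' ⊢
  have hmp := measurePreserving_prodAssoc timeMeasure (lam • νc) νi
  have hemb := (MeasurableEquiv.prodAssoc : (ℝ≥0 × Ec) × Ei ≃ᵐ ℝ≥0 × (Ec × Ei)).measurableEmbedding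
  rw [← hmp.setIntegral_preimage_emb hemb]
  have hset : (MeasurableEquiv.prodAssoc : (ℝ≥0 × Ec) × Ei ≃ᵐ ℝ≥0 × (Ec × Ei)) ⁻¹'
      ((fun p : ℝ≥0 × (Ec × Ei) => (p.1, p.2.1)) ⁻¹' D ∩ Iic t ×ˢ univ)
        = (D ∩ Iic t ×ˢ univ) ×ˢ univ := by
    ext ⟨⟨s, c⟩, i⟩
    simp [MeasurableEquiv.prodAssoc]
  rw [hset, setIntegral_prod]
  · simp only [Measure.restrict_univ]
    rfl
  · rw [← hset]
    exact (hmp.integrableOn_comp_preimage hemb).2 (hF'.mono_set inter_subset_right)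

/-- Averaging over the idiosyncratic mark keeps the density projected to time and common mark, which
is the input for the Poisson averaging argument. -/
theorem setIntegral_preimage_common_congr {F : Ec × Ei → ℝ} {h : Ec → ℝ}
    (hF : Integrable F (jumpIntensity lam νc νi)) (hh : Integrable h νc)
    (hFh : ∀ᵐ c ∂νc, ∫ i, F (c, i) ∂νi = h c) (t : ℝ≥0) (D : Set (ℝ≥0 × Ec)) :
    ∫ p in (fun p : ℝ≥0 × (Ec × Ei) => (p.1, p.2.1)) ⁻¹' D ∩ Iic t ×ˢ univ, F p.2
        ∂(timeMeasure.prod (jumpIntensity lam νc νi))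
      = ∫ p in (fun p : ℝ≥0 × (Ec × Ei) => (p.1, p.2.1)) ⁻¹' D ∩ Iic t ×ˢ univ, h p.2.1
        ∂(timeMeasure.prod (jumpIntensity lam νc νi)) := by
  have hh' : Integrable (fun e : Ec × Ei => h e.1) (jumpIntensity lam νc νi) :=
    (hh.comp_fst νi).smul_measure_nnreal
  rw [setIntegral_preimage_common hF t D,
    setIntegral_preimage_common (F := fun e => h e.1) hh' t D]
  refine integral_congr_ae (ae_restrict_of_ae ?_)
  have h1 : ∀ᵐ c ∂(lam • νc), ∫ i, F (c, i) ∂νi = h c := Measure.ae_smul_measure hFh lam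
  filter_upwards [Measure.quasiMeasurePreserving_snd.ae h1] with r hr
  rw [hr]
  simp

end Projection

/-! ### The conditional mean of the logarithm of the wealth given the common noise -/

theorem comap_comp_le {α β γ : Type*} [MeasurableSpace β] [MeasurableSpace γ] {f : β → γ}
    (hf : Measurable f) (g : α → β) :
    MeasurableSpace.comap (fun a => f (g a)) inferInstance
      ≤ MeasurableSpace.comap g inferInstance := by
  rw [← Function.comp_def, ← MeasurableSpace.comap_comp]
  exact MeasurableSpace.comap_mono hf.comap_le

theorem measurable_map_common {Ec Ei : Type*} [MeasurableSpace Ec] [MeasurableSpace Ei] :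
    Measurable fun n : Measure (ℝ≥0 × (Ec × Ei)) => n.map (fun p => (p.1, p.2.1)) :=
  Measure.measurable_map _ (by fun_prop)

theorem measurable_path {Ω : Type*} [MeasurableSpace Ω] {P : Measure Ω} {W₀ : ℝ≥0 → Ω → ℝ}
    (h : IsBM P W₀) : Measurable fun ω t => W₀ t ω :=
  measurable_pi_lambda _ h.measurable

theorem setIntegral_commonPart {Ω Ec Ei : Type*} [MeasurableSpace Ec] [MeasurableSpace Ei]
    {N : Ω → Measure (ℝ≥0 × (Ec × Ei))} {h : Ec → ℝ} (hh : Measurable h) (t : ℝ≥0) (ω : Ω) :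
    ∫ p in Iic t ×ˢ univ, h p.2 ∂(commonPart N ω)
      = ∫ p in Iic t ×ˢ univ, h p.2.1 ∂(N ω) := by
  have hm : Measurable fun p : ℝ≥0 × (Ec × Ei) => (p.1, p.2.1) := by fun_prop
  unfold commonPart
  rw [setIntegral_map (f := fun p : ℝ≥0 × Ec => h p.2) (measurableSet_Iic.prod .univ)
    (hh.comp measurable_snd).aestronglyMeasurable hm.aemeasurable]
  congr 2

section CommonNoise

variable {Ω Ec Ei : Type*} [MeasurableSpace Ω] [MeasurableSpace Ec] [MeasurableSpace Ei]
  {Ty : Set (InvestorType (Ec × Ei))} [MeasurableSpace Ty] {TT : Measure Ty}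
  {P : Measure Ω} {W W₀ : ℝ≥0 → Ω → ℝ}
  {N : Ω → Measure (ℝ≥0 × (Ec × Ei))} {lam : ℝ≥0} {νc : Measure Ec} {νi : Measure Ei}
  {π : Ty → ℝ → ℝ}

theorem measurable_commonPart (hN : Measurable N) : Measurable (commonPart N) :=
  measurable_map_common.comp hN

theorem commonInfo_le (hW₀ : ∀ t, Measurable (W₀ t)) (hN : Measurable N) (T : ℝ≥0) :
    commonInfo TT P W₀ N T ≤ (inferInstance : MeasurableSpace (Ty × Ω)) :=
  informationAt_le bot_le (fun _ t => (hW₀ t).comp measurable_snd)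
    ((measurable_commonPart hN).comp measurable_snd) T

/-- The generators of the common information lie in the completion of the `σ`-field of `θ`. Although
`θ` also knows the noise after `T`, only this inclusion is needed. -/
theorem exists_ae_eq_preimage_of_commonInfo {T : ℝ≥0} {A : Set (Ty × Ω)}
    (hA : MeasurableSet[commonInfo TT P W₀ N T] A) :
    ∃ V : Set ((ℝ≥0 → ℝ) × Measure (ℝ≥0 × Ec)), MeasurableSet V ∧
      A =ᵐ[TT.prod P] Prod.snd ⁻¹' {ω | (fun t => W₀ t ω, commonPart N ω) ∈ V} := by
  let θ : Ty × Ω → (ℝ≥0 → ℝ) × Measure (ℝ≥0 × Ec) :=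
    fun q => (fun t => W₀ t q.2, commonPart N q.2)
  have hle : MeasurableSpace.comap θ inferInstance
      ≤ eventuallyMeasurableSpace (MeasurableSpace.comap θ inferInstance) (ae (TT.prod P)) :=
    fun s hs => ⟨s, hs, EventuallyEq.rfl⟩
  have key : commonInfo TT P W₀ N T
      ≤ eventuallyMeasurableSpace (MeasurableSpace.comap θ inferInstance) (ae (TT.prod P)) := by
    refine sup_le (sup_le (sup_le bot_le ?_) ?_) ?_
    · refine iSup₂_le fun _ s => le_trans ?_ hle
      exact comap_comp_le (f := fun x : (ℝ≥0 → ℝ) × Measure (ℝ≥0 × Ec) => x.1 s) (by fun_prop) θ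
    · refine iSup₂_le fun s B => le_trans ?_ hle
      exact comap_comp_le ((Measure.measurable_coe (measurableSet_Iic.prod B.2)).comp
        measurable_snd) θ
    · refine MeasurableSpace.generateFrom_le fun s hs => ?_
      exact ⟨∅, @MeasurableSet.empty _ (MeasurableSpace.comap θ inferInstance),
        ae_eq_empty.2 hs.2⟩
  obtain ⟨_, ⟨V, hV, rfl⟩, h2⟩ := key A hA
  exact ⟨V, hV, h2⟩

theorem IsNoise.indepFun_path (h : IsNoise P (jumpIntensity lam νc νi) W W₀ N) :
    IndepFun (fun ω t => W₀ t ω) N P := by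
  rw [IndepFun_iff_Indep]
  exact h.indep.indep (i := 1) (j := 2) (by decide)

variable [IsProbabilityMeasure P]

theorem IsNoise.setIntegral_brownian (h : IsNoise P (jumpIntensity lam νc νi) W W₀ N) (t : ℝ≥0)
    {V : Set ((ℝ≥0 → ℝ) × Measure (ℝ≥0 × Ec))} (hV : MeasurableSet V) :
    ∫ ω in {ω | (fun t => W₀ t ω, commonPart N ω) ∈ V}, W t ω ∂P = 0 := by
  have hθ : Measurable fun ω => ((fun t => W₀ t ω : ℝ≥0 → ℝ), commonPart N ω) :=
    (measurable_path h.bm₀).prodMk (measurable_commonPart h.poisson.measurable)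
  have hle : ∀ i, ![processSigma W, processSigma W₀, randomMeasureSigma N] i
      ≤ (inferInstance : MeasurableSpace Ω) := by
    intro i
    fin_cases i
    · exact (measurable_path h.bm).comap_le
    · exact (measurable_path h.bm₀).comap_le
    · exact h.poisson.measurable.comap_le
  have hind : Indep (processSigma W)
      (MeasurableSpace.comap (fun ω => ((fun t => W₀ t ω : ℝ≥0 → ℝ), commonPart N ω))
        inferInstance) P := by
    have h1 := indep_iSup_of_disjoint hle h.indep (S := {0}) (T := {1, 2}) (by simp)
    refine indep_of_indep_of_le_left (indep_of_indep_of_le_right h1 ?_) ?_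
    · refine (MeasurableSpace.comap_prodMk _ _).le.trans (sup_le ?_ ?_)
      · exact le_iSup₂_of_le (f := fun i (_ : i ∈ ({1, 2} : Set (Fin 3))) =>
          ![processSigma W, processSigma W₀, randomMeasureSigma N] i) 1 (by simp) le_rfl
      · refine le_trans ?_ (le_iSup₂_of_le (f := fun i (_ : i ∈ ({1, 2} : Set (Fin 3))) =>
          ![processSigma W, processSigma W₀, randomMeasureSigma N] i) 2 (by simp) le_rfl)
        exact comap_comp_le measurable_map_common N
    · exact le_iSup₂_of_le (f := fun i (_ : i ∈ ({0} : Set (Fin 3))) =>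
          ![processSigma W, processSigma W₀, randomMeasureSigma N] i) 0 (by simp) le_rfl
  have hce := condExp_indep_eq (μ := P) (hle 0) hθ.comap_le
    (measurable_processSigma W t).stronglyMeasurable hind
  have hVm : MeasurableSet[MeasurableSpace.comap (fun ω => ((fun t => W₀ t ω : ℝ≥0 → ℝ),
      commonPart N ω)) inferInstance] {ω | (fun t => W₀ t ω, commonPart N ω) ∈ V} := ⟨V, hV, rfl⟩
  rw [← setIntegral_condExp hθ.comap_le (h.bm.brownian.integrable_eval t) hVm,
    setIntegral_congr_ae (s := {ω | (fun t => W₀ t ω, commonPart N ω) ∈ V})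
      (g := fun _ => (0 : ℝ)) (hV.preimage hθ)]
  · simp
  · filter_upwards [hce] with ω hω _
    rw [hω]
    exact h.bm.brownian.integral_eval t

theorem measurable_logJump (hTy : MeasurableTypes Ty)
    (hπm : Measurable (fun p : Ty × ℝ => π p.1 p.2)) :
    Measurable fun p : Ty × (Ec × Ei) => logJump π p.1 p.2 := measurable_log_jump hTy hπm

/-- The geometric mean of the returns from a jump, on a logarithmic scale. -/
noncomputable def meanLogJump (TT : Measure Ty) (νi : Measure Ei) (π : Ty → ℝ → ℝ) (ec : Ec) : ℝ :=
  ∫ p : Ty × Ei, logJump π p.1 (ec, p.2) ∂(TT.prod νi)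

variable [IsProbabilityMeasure TT] [IsProbabilityMeasure νi]

theorem measurable_meanLogJump (hTy : MeasurableTypes Ty)
    (hπm : Measurable (fun p : Ty × ℝ => π p.1 p.2)) :
    Measurable (meanLogJump TT νi π : Ec → ℝ) := by
  have hg : Measurable fun p : Ec × (Ty × Ei) => ((p.2.1, (p.1, p.2.2)) : Ty × (Ec × Ei)) := by
    fun_prop
  exact (((measurable_logJump hTy hπm).comp hg).stronglyMeasurable.integral_prod_right').measurable

/-- The standing integrability of the jump returns. -/
structure IntegrableJumps (TT : Measure Ty) (lam : ℝ≥0) (νc : Measure Ec) (νi : Measure Ei)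
    (π : Ty → ℝ → ℝ) : Prop where
  measurable : Measurable fun p : Ty × (Ec × Ei) => logJump π p.1 p.2
  measurable_mean : Measurable (meanLogJump TT νi π : Ec → ℝ)
  integrable : Integrable (fun p : Ty × (Ec × Ei) => logJump π p.1 p.2)
    (TT.prod (jumpIntensity lam νc νi))
  integrable_common : Integrable (fun p : Ec × (Ty × Ei) => logJump π p.2.1 (p.1, p.2.2))
    (νc.prod (TT.prod νi))

theorem IntegrableJumps.integrable_mean (h : IntegrableJumps TT lam νc νi π) :
    Integrable (meanLogJump TT νi π) νc :=
  h.integrable_common.integral_prod_left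

variable [IsProbabilityMeasure νc]

theorem IntegrableJumps.integrableOn_prod (h : IntegrableJumps TT lam νc νi π) (t : ℝ≥0) :
    Integrable (fun q : Ty × (ℝ≥0 × (Ec × Ei)) => logJump π q.1 q.2.2)
      (TT.prod ((timeMeasure.prod (jumpIntensity lam νc νi)).restrict (Iic t ×ˢ univ))) := by
  rw [← Measure.prod_restrict, Measure.restrict_univ]
  have hmp := measurePreserving_prod_left_comm TT (timeMeasure.restrict (Iic t))
    (jumpIntensity lam νc νi)
  have h1 := (h.integrable.comp_snd (timeMeasure.restrict (Iic t)))
  rw [← hmp.integrable_comp h1.aestronglyMeasurable] at h1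
  exact h1

theorem IntegrableJumps.integrableOn_mean (h : IntegrableJumps TT lam νc νi π) (t : ℝ≥0) :
    IntegrableOn (fun p : ℝ≥0 × (Ec × Ei) => meanLogJump TT νi π p.2.1) (Iic t ×ˢ univ)
      (timeMeasure.prod (jumpIntensity lam νc νi)) :=
  integrableOn_comp_snd (ν := jumpIntensity lam νc νi) (F := fun e => meanLogJump TT νi π e.1)
    ((h.integrable_mean.comp_fst νi).smul_measure_nnreal) t

/-- The type is independent of the noise and is integrated out first, leaving `F`. On events of the
common noise `F` may then be replaced by its mean over the idiosyncratic mark. -/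
theorem IntegrableJumps.setIntegral_jump (h : IntegrableJumps TT lam νc νi π)
    (hn : IsNoise P (jumpIntensity lam νc νi) W W₀ N) (t : ℝ≥0)
    {V : Set ((ℝ≥0 → ℝ) × Measure (ℝ≥0 × Ec))} (hV : MeasurableSet V) :
    ∫ q in Prod.snd ⁻¹' {ω | (fun t => W₀ t ω, commonPart N ω) ∈ V},
        ∫ p in Iic t ×ˢ univ, logJump π q.1 p.2 ∂(N q.2) ∂(TT.prod P)
      = ∫ q in Prod.snd ⁻¹' {ω | (fun t => W₀ t ω, commonPart N ω) ∈ V},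
        ∫ p in Iic t ×ˢ univ, meanLogJump TT νi π p.2 ∂(commonPart N q.2) ∂(TT.prod P) := by
  have hB : MeasurableSet (Iic t ×ˢ univ : Set (ℝ≥0 × (Ec × Ei))) := measurableSet_Iic.prod .univ
  have hfin := timeMeasure_prod_Iic_lt_top (jumpIntensity lam νc νi) t
  have hfm : Measurable fun q : Ty × (ℝ≥0 × (Ec × Ei)) => logJump π q.1 q.2.2 :=
    h.measurable.comp (measurable_fst.prodMk (measurable_snd.comp measurable_snd))
  obtain ⟨h1, h2⟩ := hn.poisson.integrable_prod_setIntegral hB hfin hfm (h.integrableOn_prod t)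
  set A : Set Ω := {ω | (fun t => W₀ t ω, commonPart N ω) ∈ V} with hA
  have hset : (TT.prod P).restrict (Prod.snd ⁻¹' A) = TT.prod (P.restrict A) := by
    rw [← univ_prod, ← Measure.prod_restrict, Measure.restrict_univ]
  have h1' := h1.restrict (s := Prod.snd ⁻¹' A)
  rw [hset] at h1' ⊢
  rw [integral_prod_symm _ h1', integral_fun_snd (fun ω =>
    ∫ p in Iic t ×ˢ univ, meanLogJump TT νi π p.2 ∂(commonPart N ω))]
  simp only [probReal_univ, one_smul]
  set F : Ec × Ei → ℝ := fun e => ∫ u, logJump π u e ∂TT with hF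
  have hFm : Measurable F := h.measurable.stronglyMeasurable.integral_prod_left'.measurable
  have hFi : Integrable F (jumpIntensity lam νc νi) := h.integrable.integral_prod_right
  have hFh : ∀ᵐ c ∂νc, ∫ i, F (c, i) ∂νi = meanLogJump TT νi π c := by
    filter_upwards [h.integrable_common.prod_right_ae] with c hc
    exact (integral_prod_symm _ hc).symm
  have e1 : ∫ ω in A, ∫ u, ∫ p in Iic t ×ˢ univ, logJump π u p.2 ∂(N ω) ∂TT ∂P
      = ∫ ω in A, ∫ p in Iic t ×ˢ univ, F p.2 ∂(N ω) ∂P := by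
    refine integral_congr_ae (ae_restrict_of_ae ?_)
    filter_upwards [h2, hn.poisson.ae_lt_top hB hfin] with ω h3 h4
    have : IsFiniteMeasure ((N ω).restrict (Iic t ×ˢ univ)) :=
      ⟨by rwa [Measure.restrict_apply_univ]⟩
    exact integral_integral_swap (f := fun u (p : ℝ≥0 × (Ec × Ei)) => logJump π u p.2) h3
  rw [e1]
  simp_rw [setIntegral_commonPart h.measurable_mean]
  refine hn.poisson.setIntegral_congr_of_indepFun (q := fun p => (p.1, p.2.1)) hB hfin
    (by fun_prop) (hFm.comp measurable_snd)
    (h.measurable_mean.comp (measurable_fst.comp measurable_snd))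
    (integrableOn_comp_snd hFi t) (h.integrableOn_mean t) (fun D _ =>
      setIntegral_preimage_common_congr hFi h.integrable_mean hFh t D)
    (measurable_path hn.bm₀) hn.indepFun_path hV

end CommonNoise

theorem measurable_count_informationAt {Ω S ι : Type*} {G : MeasurableSpace Ω} [MeasurableSpace Ω]
    [MeasurableSpace S] {P : Measure Ω} {B : ι → ℝ≥0 → Ω → ℝ} {N : Ω → Measure (ℝ≥0 × S)}
    {s t : ℝ≥0} (hst : s ≤ t) {A : Set S} (hA : MeasurableSet A) :
    Measurable[informationAt G P B N t] fun ω => N ω (Iic s ×ˢ A) := by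
  rw [measurable_iff_comap_le]
  refine le_trans ?_ (le_sup_of_le_left le_sup_right)
  exact le_iSup₂_of_le (f := fun (s : Iic t) (A : {A : Set S // MeasurableSet A}) =>
    MeasurableSpace.comap (fun ω => N ω (Iic (s : ℝ≥0) ×ˢ (A : Set S))) inferInstance)
    ⟨s, hst⟩ ⟨A, hA⟩ le_rfl

theorem AdmissibleSignalDriven.integrableJumps {Ec Ei : Type*} [MeasurableSpace Ec]
    [MeasurableSpace Ei] {Ty : Set (InvestorType (Ec × Ei))} [MeasurableSpace Ty] {TT : Measure Ty}
    [IsProbabilityMeasure TT] {lam : ℝ≥0} {νc : Measure Ec} {νi : Measure Ei}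
    [IsProbabilityMeasure νc] [IsProbabilityMeasure νi] {a b : Ty → ℝ} {π : Ty → ℝ → ℝ}
    (hπ : AdmissibleSignalDriven (jumpIntensity lam νc νi) TT a b π) (hlam : 0 < lam)
    (hTy : MeasurableTypes Ty) (hTT : StandingAssumption (jumpIntensity lam νc νi) TT)
    (hab : SafetyMargins TT a b) : IntegrableJumps TT lam νc νi π where
  measurable := measurable_logJump hTy hπ.measurable
  measurable_mean := measurable_meanLogJump hTy hπ.measurable
  integrable := hπ.integrable_log_jump hTy hTT hab
  integrable_common := hπ.integrable_logJump hlam hTy hTT hab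

/-! ### The mean wealth on a logarithmic scale -/

section LogMeanWealth

variable {Ec Ei : Type*} [MeasurableSpace Ec] [MeasurableSpace Ei]
  {Ty : Set (InvestorType (Ec × Ei))} [MeasurableSpace Ty] {TT : Measure Ty} {νi : Measure Ei}
  {π : Ty → ℝ → ℝ}

/-- The logarithm of the mean wealth. -/
noncomputable def logMeanWealth (TT : Measure Ty) (νi : Measure Ei) (π : Ty → ℝ → ℝ) (t : ℝ≥0)
    (w : ℝ) (Nc : Measure (ℝ≥0 × Ec)) : ℝ :=
  ((∫ u : Ty, Real.log u.1.x₀ ∂TT) + (∫ u, logDrift π u ∂TT) * t)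
    + (∫ u : Ty, u.1.σ₀ * π u 0 ∂TT) * w + ∫ p in Iic t ×ˢ univ, meanLogJump TT νi π p.2 ∂Nc

theorem exp_logMeanWealth (t : ℝ≥0) (w : ℝ) (Nc : Measure (ℝ≥0 × Ec)) :
    Real.exp (logMeanWealth TT νi π t w Nc) = meanWealth TT νi π t w Nc := by
  unfold logMeanWealth meanWealth meanInitialWealth meanJump
  simp_rw [Real.log_exp]
  rw [← Real.exp_add]
  congr 1
  unfold meanLogJump
  ring

end LogMeanWealth

/-! ### The representative investor and the conditional expectation -/

section Representative

variable {Ω Ec Ei : Type*} [MeasurableSpace Ω] [MeasurableSpace Ec] [MeasurableSpace Ei]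
  {Ty : Set (InvestorType (Ec × Ei))} [MeasurableSpace Ty] {TT : Measure Ty}
  {P : Measure Ω} [IsProbabilityMeasure P] [IsProbabilityMeasure TT] {W W₀ : ℝ≥0 → Ω → ℝ}
  {N : Ω → Measure (ℝ≥0 × (Ec × Ei))} {lam : ℝ≥0} {νc : Measure Ec} {νi : Measure Ei}
  [IsProbabilityMeasure νc] [IsProbabilityMeasure νi] {a b : Ty → ℝ} {π : Ty → ℝ → ℝ} {T : ℝ≥0}

theorem measurableSet_ruin (hTy : MeasurableTypes Ty)
    (hπm : Measurable (fun p : Ty × ℝ => π p.1 p.2)) :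
    MeasurableSet {p : Ty × (Ec × Ei) | ¬ 0 < 1 + π p.1 (p.1.1.ζ p.2) * p.1.1.η p.2} := by
  have h1 : Measurable fun p : Ty × (Ec × Ei) => π p.1 (p.1.1.ζ p.2) :=
    hπm.comp (measurable_fst.prodMk hTy.ζ)
  exact (measurableSet_lt measurable_const ((h1.mul hTy.η).const_add 1)).compl

theorem IsRepresentativeWealth.ae_log_eq [MeasurableSingletonClass (Ec × Ei)]
    (hn : IsNoise P (jumpIntensity lam νc νi) W W₀ N)
    (hTy : MeasurableTypes Ty) (hTT : StandingAssumption (jumpIntensity lam νc νi) TT)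
    (hab : SafetyMargins TT a b)
    (hπ : AdmissibleSignalDriven (jumpIntensity lam νc νi) TT a b π) {X : ℝ≥0 → Ty × Ω → ℝ}
    (hX : IsRepresentativeWealth TT P T W W₀ N π X) :
    ∀ᵐ q ∂(TT.prod P), ∀ t ≤ T, 0 < X t q ∧ Real.log (X t q) =
      Real.log q.1.1.x₀ + logDrift π q.1 * t + (q.1.1.σ * π q.1 0) * W t q.2
        + (q.1.1.σ₀ * π q.1 0) * W₀ t q.2
        + ∫ p in Iic t ×ˢ univ, logJump π q.1 p.2 ∂(N q.2) := by
  have hB : MeasurableSet (Iic T ×ˢ univ : Set (ℝ≥0 × (Ec × Ei))) := measurableSet_Iic.prod .univ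
  have hfin := timeMeasure_prod_Iic_lt_top (jumpIntensity lam νc νi) T
  have hF : ∀ t, fullInfo TT P W W₀ N t ≤ (inferInstance : MeasurableSpace (Ty × Ω)) := by
    refine informationAt_le measurable_fst.comap_le (fun i t => ?_)
      (hn.poisson.measurable.comp measurable_snd)
    fin_cases i
    · exact (hn.bm.measurable t).comp measurable_snd
    · exact (hn.bm₀.measurable t).comp measurable_snd
  have hG : ∀ {f : Ty → ℝ}, Measurable f →
      Measurable[fullInfo TT P W W₀ N 0] fun q : Ty × Ω => f q.1 := fun hf =>
    (hf.comp (comap_measurable Prod.fst)).mono (le_informationAt 0) le_rfl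
  have hπ0 : Measurable fun t => π t 0 := hπ.measurable.comp (measurable_id.prodMk measurable_const)
  refine IsWealthProcess.log_eq (F := fullInfo TT P W W₀ N) monotone_informationAt hF
    (fun t => measurable_informationAt 0 t) (fun t => measurable_informationAt 1 t) hX
    (hG hTy.r) (hG hTy.κ) (hG hTy.σ) (hG hTy.σ₀) (hG hπ0)
    (Measure.quasiMeasurePreserving_snd.ae
      (ae_isDrivingPath hn.bm hn.bm₀ (hn.indep.indep (i := 0) (j := 1) (by decide)) T))
    (fun q => q.1.1.x₀_pos)
    (Measure.quasiMeasurePreserving_snd.ae (hn.poisson.ae_hasAtoms T)) ?_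
  have hbad : MeasurableSet {q : Ty × (ℝ≥0 × (Ec × Ei)) |
      ¬ 0 < 1 + π q.1 (q.1.1.ζ q.2.2) * q.1.1.η q.2.2} :=
    (measurableSet_ruin hTy hπ.measurable).preimage
      (measurable_fst.prodMk (measurable_snd.comp measurable_snd))
  -- Ruinous marks are negligible for almost every type, so no point of `N` is ruinous.
  have h1 := hn.poisson.ae_prod_null hB hfin TT hbad (by
    filter_upwards [hπ.ae_pos hTT hab] with t ht
    filter_upwards [Measure.quasiMeasurePreserving_snd.ae ht] with p hp
    exact not_not.2 hp)
  filter_upwards [h1] with q hq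
  filter_upwards [hq] with p hp
  exact not_not.1 hp

theorem IsRepresentativeWealth.condExp_log [MeasurableSingletonClass (Ec × Ei)] (hlam : 0 < lam)
    (hn : IsNoise P (jumpIntensity lam νc νi) W W₀ N)
    (hTy : MeasurableTypes Ty) (hTT : StandingAssumption (jumpIntensity lam νc νi) TT)
    (hab : SafetyMargins TT a b)
    (hπ : AdmissibleSignalDriven (jumpIntensity lam νc νi) TT a b π) {X : ℝ≥0 → Ty × Ω → ℝ}
    (hX : IsRepresentativeWealth TT P T W W₀ N π X) {t : ℝ≥0} (ht : t ≤ T) :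
    Integrable (fun q => Real.log (X t q)) (TT.prod P) ∧
      (fun q : Ty × Ω => logMeanWealth TT νi π t (W₀ t q.2) (commonPart N q.2))
        =ᵐ[TT.prod P] (TT.prod P)[fun q => Real.log (X t q) | commonInfo TT P W₀ N T] := by
  have hJ := hπ.integrableJumps hlam hTy hTT hab
  obtain ⟨hDi, hσi, hσ₀i⟩ := hπ.integrable_parameters hTy hTT hab
  have hDi' : Integrable (logDrift π) TT := hDi
  have hB : MeasurableSet (Iic t ×ˢ univ : Set (ℝ≥0 × (Ec × Ei))) := measurableSet_Iic.prod .univ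
  have hfin := timeMeasure_prod_Iic_lt_top (jumpIntensity lam νc νi) t
  have hfm : Measurable fun q : Ty × (ℝ≥0 × (Ec × Ei)) => logJump π q.1 q.2.2 :=
    hJ.measurable.comp (measurable_fst.prodMk (measurable_snd.comp measurable_snd))
  have hgm : Measurable fun p : ℝ≥0 × (Ec × Ei) => meanLogJump TT νi π p.2.1 :=
    hJ.measurable_mean.comp (measurable_fst.comp measurable_snd)
  let Y₁ : Ty × Ω → ℝ := fun q => Real.log q.1.1.x₀ + logDrift π q.1 * t
  let Y₂ : Ty × Ω → ℝ := fun q => (q.1.1.σ * π q.1 0) * W t q.2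
  let Y₃ : Ty × Ω → ℝ := fun q => (q.1.1.σ₀ * π q.1 0) * W₀ t q.2
  let Y₄ : Ty × Ω → ℝ := fun q => ∫ p in Iic t ×ˢ univ, logJump π q.1 p.2 ∂(N q.2)
  let Z₁ : Ty × Ω → ℝ := fun _ =>
    (∫ u : Ty, Real.log u.1.x₀ ∂TT) + (∫ u, logDrift π u ∂TT) * t
  let Z₃ : Ty × Ω → ℝ := fun q => (∫ u : Ty, u.1.σ₀ * π u 0 ∂TT) * W₀ t q.2
  let Z₄ : Ty × Ω → ℝ := fun q =>
    ∫ p in Iic t ×ˢ univ, meanLogJump TT νi π p.2 ∂(commonPart N q.2)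
  have hai : Integrable (fun u : Ty => Real.log u.1.x₀ + logDrift π u * t) TT :=
    hTT.integrable_log_x₀.add (hDi'.mul_const _)
  have hY₁ : Integrable Y₁ (TT.prod P) := hai.comp_fst P
  have hY₂ : Integrable Y₂ (TT.prod P) := hσi.mul_prod (hn.bm.brownian.integrable_eval t)
  have hY₃ : Integrable Y₃ (TT.prod P) := hσ₀i.mul_prod (hn.bm₀.brownian.integrable_eval t)
  have hY₄ : Integrable Y₄ (TT.prod P) :=
    (hn.poisson.integrable_prod_setIntegral hB hfin hfm (hJ.integrableOn_prod t)).1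
  have hZ₁ : Integrable Z₁ (TT.prod P) := integrable_const _
  have hZ₃ : Integrable Z₃ (TT.prod P) :=
    ((hn.bm₀.brownian.integrable_eval t).const_mul _).comp_snd TT
  have hZ₄ : Integrable Z₄ (TT.prod P) := by
    have hg : Integrable (fun q : Ty × (ℝ≥0 × (Ec × Ei)) => meanLogJump TT νi π q.2.2.1)
        (TT.prod ((timeMeasure.prod (jumpIntensity lam νc νi)).restrict (Iic t ×ˢ univ))) := by
      have : IsFiniteMeasure ((timeMeasure.prod (jumpIntensity lam νc νi)).restrict
        (Iic t ×ˢ univ)) := ⟨by rwa [Measure.restrict_apply_univ]⟩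
      exact (hJ.integrableOn_mean t).comp_snd TT
    have h1 := (hn.poisson.integrable_prod_setIntegral hB hfin (hgm.comp measurable_snd) hg).1
    refine h1.congr (Eventually.of_forall fun q => ?_)
    exact (setIntegral_commonPart hJ.measurable_mean t q.2).symm
  have hlog : (fun q => Real.log (X t q)) =ᵐ[TT.prod P] Y₁ + Y₂ + Y₃ + Y₄ := by
    filter_upwards [hX.ae_log_eq hn hTy hTT hab hπ] with q hq
    exact (hq t ht).2
  have hYi : Integrable (Y₁ + Y₂ + Y₃ + Y₄) (TT.prod P) := ((hY₁.add hY₂).add hY₃).add hY₄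
  have hlogi : Integrable (fun q => Real.log (X t q)) (TT.prod P) := hYi.congr hlog.symm
  have hZi : Integrable (Z₁ + Z₃ + Z₄) (TT.prod P) := (hZ₁.add hZ₃).add hZ₄
  have hle := commonInfo_le (TT := TT) (P := P) hn.bm₀.measurable hn.poisson.measurable T
  refine ⟨hlogi, ae_eq_condExp_of_forall_setIntegral_eq (g := Z₁ + Z₃ + Z₄) hle hlogi
    (fun _ _ _ => hZi.integrableOn) (fun A hA _ => ?_) ?_⟩
  -- Test events depend on the noise only. The type averages out of each product, the `W` term has
  -- mean zero, and the jump terms agree by `setIntegral_jump`.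
  · obtain ⟨V, hV, hAV⟩ := exists_ae_eq_preimage_of_commonInfo hA
    set A' : Set Ω := {ω | (fun t => W₀ t ω, commonPart N ω) ∈ V} with hA'
    have e4 : ∫ q in Prod.snd ⁻¹' A', Y₄ q ∂(TT.prod P) = ∫ q in Prod.snd ⁻¹' A', Z₄ q ∂(TT.prod P) :=
      hJ.setIntegral_jump hn t hV
    have hset : (TT.prod P).restrict (Prod.snd ⁻¹' A') = TT.prod (P.restrict A') := by
      rw [← univ_prod, ← Measure.prod_restrict, Measure.restrict_univ]
    rw [setIntegral_congr_set hAV, setIntegral_congr_set hAV,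
      integral_congr_ae (ae_restrict_of_ae hlog)]
    have hr : ∀ {Y : Ty × Ω → ℝ}, Integrable Y (TT.prod P) →
        Integrable Y ((TT.prod P).restrict (Prod.snd ⁻¹' A')) := fun h => h.restrict
    rw [integral_add' ((hr hZ₁).add (hr hZ₃)) (hr hZ₄), integral_add' (hr hZ₁) (hr hZ₃),
      integral_add' (((hr hY₁).add (hr hY₂)).add (hr hY₃)) (hr hY₄),
      integral_add' ((hr hY₁).add (hr hY₂)) (hr hY₃), integral_add' (hr hY₁) (hr hY₂), e4, hset]
    have e1 : ∫ q, Z₁ q ∂(TT.prod (P.restrict A')) = ∫ q, Y₁ q ∂(TT.prod (P.restrict A')) := by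
      have h1 := integral_fun_fst (μ := TT) (ν := P.restrict A')
        (fun u : Ty => Real.log u.1.x₀ + logDrift π u * t)
      rw [h1, integral_add hTT.integrable_log_x₀ (hDi'.mul_const _), integral_mul_const]
      simp only [Z₁, integral_const]
      congr 1
      rw [← univ_prod_univ, measureReal_prod_prod, probReal_univ, one_mul]
    have e2 : ∫ q, Y₂ q ∂(TT.prod (P.restrict A')) = 0 := by
      have h1 := integral_prod_mul (μ := TT) (ν := P.restrict A')
        (fun u : Ty => u.1.σ * π u 0) (W t)
      rw [hn.setIntegral_brownian t hV, mul_zero] at h1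
      exact h1
    have e3 : ∫ q, Z₃ q ∂(TT.prod (P.restrict A')) = ∫ q, Y₃ q ∂(TT.prod (P.restrict A')) := by
      have h1 := integral_prod_mul (μ := TT) (ν := P.restrict A')
        (fun u : Ty => u.1.σ₀ * π u 0) (W₀ t)
      have h2 := integral_fun_snd (μ := TT) (ν := P.restrict A')
        (fun ω => (∫ u : Ty, u.1.σ₀ * π u 0 ∂TT) * W₀ t ω)
      rw [probReal_univ, one_smul] at h2
      rw [← integral_const_mul] at h1
      exact h2.trans h1.symm
    rw [e1, e2, e3]
    ring
  -- The candidate is determined by the common information up to null events: `W₀` at time `t ≤ T`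
  -- and counts of the common part up to `T` suffice.
  · have hfinT := timeMeasure_prod_Iic_lt_top (jumpIntensity lam νc νi) T
    have hBT : MeasurableSet (Iic T ×ˢ univ : Set (ℝ≥0 × (Ec × Ei))) :=
      measurableSet_Iic.prod .univ
    have hproj : Measurable fun p : ℝ≥0 × (Ec × Ei) => (p.1, p.2.1) := by fun_prop
    have hpre : ∀ s : ℝ≥0, (fun p : ℝ≥0 × (Ec × Ei) => (p.1, p.2.1)) ⁻¹' (Iic s ×ˢ univ)
        = Iic s ×ˢ univ := by
      intro s
      ext p
      simp
    have hW₀m : Measurable[commonInfo TT P W₀ N T] fun q : Ty × Ω => W₀ t q.2 :=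
      (measurable_informationAt (G := ⊥) (P := TT.prod P)
        (B := fun (_ : Unit) s (q : Ty × Ω) => W₀ s q.2) (N := fun q => commonPart N q.2)
        () t).mono (monotone_informationAt ht) le_rfl
    refine AEStronglyMeasurable.add (AEStronglyMeasurable.add aestronglyMeasurable_const
      (Measurable.stronglyMeasurable (Measurable.const_mul hW₀m _)).aestronglyMeasurable) ?_
    refine aestronglyMeasurable_setIntegral ht
      (fun s hs A hA => measurable_count_informationAt hs hA) ?_
      (hJ.measurable_mean.comp measurable_snd) ?_
    · filter_upwards [Measure.quasiMeasurePreserving_snd.ae (hn.poisson.ae_lt_top hBT hfinT)]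
        with q hq
      unfold commonPart
      rwa [Measure.map_apply hproj (measurableSet_Iic.prod .univ), hpre]
    · filter_upwards [Measure.quasiMeasurePreserving_snd.ae
        (hn.poisson.ae_integrableOn hB hfin hgm (hJ.integrableOn_mean t))] with q hq
      unfold commonPart
      rw [IntegrableOn, Measure.restrict_map hproj (measurableSet_Iic.prod .univ), hpre,
        integrable_map_measure (g := fun p : ℝ≥0 × Ec => meanLogJump TT νi π p.2)
          (hJ.measurable_mean.comp measurable_snd).aestronglyMeasurable
          hproj.aemeasurable]
      exact hq

end Representative

/-! ### The law of large numbers for pairs -/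

section LargeNumbers

theorem measurePreserving_prod_prod_comm {A B C D : Type*} [MeasurableSpace A] [MeasurableSpace B]
    [MeasurableSpace C] [MeasurableSpace D] (α : Measure A) (β : Measure B) (γ : Measure C)
    (δ : Measure D) [SFinite α] [SFinite β] [SFinite γ] [SFinite δ] :
    MeasurePreserving (fun p : (A × B) × (C × D) => ((p.1.1, p.2.1), (p.1.2, p.2.2)))
      ((α.prod β).prod (γ.prod δ)) ((α.prod γ).prod (β.prod δ)) := by
  have h1 := measurePreserving_prodAssoc α β (γ.prod δ)
  have h2 := (MeasurePreserving.id α).prod (measurePreserving_prod_left_comm β γ δ)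
  have h3 : MeasurePreserving (MeasurableEquiv.prodAssoc :
      (A × C) × (B × D) ≃ᵐ A × (C × (B × D))).symm
      (α.prod (γ.prod (β.prod δ))) ((α.prod γ).prod (β.prod δ)) :=
    (measurePreserving_prodAssoc α γ (β.prod δ)).symm _
  exact h3.comp (h2.comp h1)

variable {Ω A B : Type*} [MeasurableSpace Ω] [MeasurableSpace A] [MeasurableSpace B]
  {P : Measure Ω} [IsProbabilityMeasure P] {α : Measure A} {β : Measure B}
  {f : ℕ → Ω → A} {g : ℕ → Ω → B}

theorem map_pair_eq_prod (hf : ∀ j, Measurable (f j)) (hg : ∀ j, Measurable (g j))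
    (hfα : ∀ j, P.map (f j) = α) (hgβ : ∀ j, P.map (g j) = β)
    (hfg : IndepFun (fun ω j => f j ω) (fun ω j => g j ω) P) (j : ℕ) :
    P.map (fun ω => (f j ω, g j ω)) = α.prod β := by
  have h1 : IndepFun (f j) (g j) P := hfg.comp (measurable_pi_apply j) (measurable_pi_apply j)
  rw [(indepFun_iff_map_prod_eq_prod_map_map (hf j).aemeasurable (hg j).aemeasurable).1 h1, hfα,
    hgβ]

/-- The joint law of the four variables is a product, and regrouping its factors preserves this. -/
theorem indepFun_pair (hf : ∀ j, Measurable (f j)) (hg : ∀ j, Measurable (g j))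
    (hfα : ∀ j, P.map (f j) = α) (hgβ : ∀ j, P.map (g j) = β)
    (hfi : iIndepFun f P) (hgi : iIndepFun g P)
    (hfg : IndepFun (fun ω j => f j ω) (fun ω j => g j ω) P) {i j : ℕ} (hij : i ≠ j) :
    IndepFun (fun ω => (f i ω, g i ω)) (fun ω => (f j ω, g j ω)) P := by
  have : IsProbabilityMeasure α := hfα 0 ▸ Measure.isProbabilityMeasure_map (hf 0).aemeasurable
  have : IsProbabilityMeasure β := hgβ 0 ▸ Measure.isProbabilityMeasure_map (hg 0).aemeasurable
  have hff := (indepFun_iff_map_prod_eq_prod_map_map (hf i).aemeasurable (hf j).aemeasurable).1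
    (hfi.indepFun hij)
  have hgg := (indepFun_iff_map_prod_eq_prod_map_map (hg i).aemeasurable (hg j).aemeasurable).1
    (hgi.indepFun hij)
  have hind : IndepFun (fun ω => (f i ω, f j ω)) (fun ω => (g i ω, g j ω)) P :=
    hfg.comp (φ := fun x : ℕ → A => (x i, x j)) (ψ := fun y : ℕ → B => (y i, y j))
      (by fun_prop) (by fun_prop)
  have h4 := (indepFun_iff_map_prod_eq_prod_map_map ((hf i).prodMk (hf j)).aemeasurable
    ((hg i).prodMk (hg j)).aemeasurable).1 hind
  rw [hff, hgg, hfα, hfα, hgβ, hgβ] at h4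
  refine (indepFun_iff_map_prod_eq_prod_map_map ((hf i).prodMk (hg i)).aemeasurable
    ((hf j).prodMk (hg j)).aemeasurable).2 ?_
  rw [map_pair_eq_prod hf hg hfα hgβ hfg, map_pair_eq_prod hf hg hfα hgβ hfg,
    ← (measurePreserving_prod_prod_comm α α β β).map_eq, ← h4,
    Measure.map_map (by fun_prop) (((hf i).prodMk (hf j)).prodMk ((hg i).prodMk (hg j)))]
  rfl

/-- Pairwise independence of the pairs is enough for the strong law. -/
theorem strong_law_pairs (hf : ∀ j, Measurable (f j)) (hg : ∀ j, Measurable (g j))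
    (hfα : ∀ j, P.map (f j) = α) (hgβ : ∀ j, P.map (g j) = β)
    (hfi : iIndepFun f P) (hgi : iIndepFun g P)
    (hfg : IndepFun (fun ω j => f j ω) (fun ω j => g j ω) P) {φ : A × B → ℝ} (hφ : Measurable φ)
    (hint : Integrable φ (α.prod β)) :
    ∀ᵐ ω ∂P, Tendsto (fun n : ℕ => (∑ j ∈ Finset.range n, φ (f j ω, g j ω)) / n) atTop
      (𝓝 (∫ p, φ p ∂(α.prod β))) := by
  have hm : ∀ j, Measurable fun ω => (f j ω, g j ω) := fun j => (hf j).prodMk (hg j)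
  have hlaw := map_pair_eq_prod hf hg hfα hgβ hfg
  have h := strong_law_ae_real (μ := P) (fun j ω => φ (f j ω, g j ω)) ?_ ?_ ?_
  · have e : ∫ ω, φ (f 0 ω, g 0 ω) ∂P = ∫ p, φ p ∂(α.prod β) := by
      rw [← hlaw 0, integral_map (hm 0).aemeasurable hφ.aestronglyMeasurable]
    rw [e] at h
    exact h
  · rw [← hlaw 0] at hint
    exact (integrable_map_measure hφ.aestronglyMeasurable (hm 0).aemeasurable).1 hint
  · intro i j hij
    exact (indepFun_pair hf hg hfα hgβ hfi hgi hfg hij).comp hφ hφ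
  · intro j
    have h1 : IdentDistrib (fun ω => (f j ω, g j ω)) (fun ω => (f 0 ω, g 0 ω)) P P :=
      ⟨(hm j).aemeasurable, (hm 0).aemeasurable, by rw [hlaw, hlaw]⟩
    exact h1.comp hφ

theorem strong_law_infinitePi (α : Measure A) (β : Measure B) [IsProbabilityMeasure α]
    [IsProbabilityMeasure β] {φ : A × B → ℝ} (hφ : Measurable φ)
    (hint : Integrable φ (α.prod β)) :
    ∀ᵐ q ∂((Measure.infinitePi fun _ : ℕ => α).prod (Measure.infinitePi fun _ : ℕ => β)),
      Tendsto (fun n : ℕ => (∑ j ∈ Finset.range n, φ (q.1 j, q.2 j)) / n) atTop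
        (𝓝 (∫ p, φ p ∂(α.prod β))) := by
  set Q := (Measure.infinitePi fun _ : ℕ => α).prod (Measure.infinitePi fun _ : ℕ => β) with hQ
  have h1 : Q.map (fun q j => q.1 j) = Measure.infinitePi fun _ : ℕ => α :=
    (measurePreserving_fst (μ := Measure.infinitePi fun _ : ℕ => α)
      (ν := Measure.infinitePi fun _ : ℕ => β)).map_eq
  have h2 : Q.map (fun q j => q.2 j) = Measure.infinitePi fun _ : ℕ => β :=
    (measurePreserving_snd (μ := Measure.infinitePi fun _ : ℕ => α)
      (ν := Measure.infinitePi fun _ : ℕ => β)).map_eq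
  have hf : ∀ j, Measurable fun q : (ℕ → A) × (ℕ → B) => q.1 j := fun j => by fun_prop
  have hg : ∀ j, Measurable fun q : (ℕ → A) × (ℕ → B) => q.2 j := fun j => by fun_prop
  have h3 : ∀ j, Q.map (fun q => q.1 j) = α := by
    intro j
    rw [← Measure.infinitePi_map_eval (fun _ : ℕ => α) j, ← h1,
      Measure.map_map (by fun_prop) (by fun_prop)]
    rfl
  have h4 : ∀ j, Q.map (fun q => q.2 j) = β := by
    intro j
    rw [← Measure.infinitePi_map_eval (fun _ : ℕ => β) j, ← h2,
      Measure.map_map (by fun_prop) (by fun_prop)]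
    rfl
  refine strong_law_pairs (P := Q) (f := fun j q => q.1 j) (g := fun j q => q.2 j) hf hg h3 h4
    ?_ ?_ ?_ hφ hint
  · rw [iIndepFun_iff_map_fun_eq_infinitePi_map hf, h1]
    simp_rw [h3]
  · rw [iIndepFun_iff_map_fun_eq_infinitePi_map hg, h2]
    simp_rw [h4]
  · exact indepFun_prod (X := id) (Y := id) measurable_id measurable_id

end LargeNumbers

/-- Averages over `n` of the `n + 1` first terms without the `i`-th have the same limit. -/
theorem tendsto_average_erase {u : ℕ → ℝ} {L : ℝ} (i : ℕ)
    (h : Tendsto (fun n : ℕ => (∑ j ∈ Finset.range n, u j) / n) atTop (𝓝 L)) :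
    Tendsto (fun n : ℕ => (∑ j ∈ (Finset.range (n + 1)).erase i, u j) / n) atTop (𝓝 L) := by
  have h1 := (tendsto_add_atTop_iff_nat 1).2 h
  have h2 : Tendsto (fun n : ℕ => 1 + 1 / (n : ℝ)) atTop (𝓝 (1 + 0)) :=
    tendsto_one_div_atTop_nhds_zero_nat.const_add 1
  -- The average over `n + 1` terms is rescaled by `(n + 1) / n`, and the omitted term divided by
  -- `n` vanishes.
  have h3 := (h1.mul h2).sub (tendsto_const_div_atTop_nhds_zero_nat (u i))
  rw [add_zero, mul_one, sub_zero] at h3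
  refine h3.congr' ?_
  filter_upwards [eventually_ge_atTop i, eventually_gt_atTop 0] with n hi hn
  have hn' : (n : ℝ) ≠ 0 := by positivity
  have h4 := Finset.sum_erase_add (Finset.range (n + 1)) u
    (Finset.mem_range.2 (Nat.lt_succ_of_le hi))
  rw [← h4]
  push_cast
  have hn'' : (n : ℝ) + 1 ≠ 0 := by positivity
  field_simp
  ring

theorem tendsto_peerAverage {Ω : Type*} {X : ℕ → ℝ≥0 → Ω → ℝ} {t : ℝ≥0} {ω : Ω} {L : ℝ}
    (hpos : ∀ j, 0 < X j t ω) (i : ℕ)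
    (h : Tendsto (fun n : ℕ => (∑ j ∈ Finset.range n, Real.log (X j t ω)) / n) atTop (𝓝 L)) :
    Tendsto (fun n => peerAverage X i n t ω) atTop (𝓝 (Real.exp L)) := by
  refine ((Real.continuous_exp.tendsto L).comp (tendsto_average_erase i h)).congr fun n => ?_
  unfold peerAverage
  rw [Real.rpow_def_of_pos (Finset.prod_pos fun j _ => hpos j),
    Real.log_prod fun j _ => (hpos j).ne', mul_one_div]
  rfl

/-! ### The population -/

section Population

variable {Ω Ec Ei : Type*} [m0 : MeasurableSpace Ω] [MeasurableSpace Ec] [MeasurableSpace Ei]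
  {Ty : Set (InvestorType (Ec × Ei))} [MeasurableSpace Ty] {TT : Measure Ty}
  {P : Measure Ω} {lam : ℝ≥0} {νc : Measure Ec}
  {νi : Measure Ei} {τ : ℕ → Ω → Ty} {W : ℕ → ℝ≥0 → Ω → ℝ} {W₀ : ℝ≥0 → Ω → ℝ}
  {N : Ω → Measure (ℝ≥0 × (Ec × (ℕ → Ei)))} {a b : Ty → ℝ} {π : Ty → ℝ → ℝ} {T : ℝ≥0}

theorem measurable_iSup_comap {ι α β : Type*} [MeasurableSpace β] (f : ι → α → β) :
    Measurable[⨆ j, MeasurableSpace.comap (f j) inferInstance] fun a j => f j a := by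
  refine @measurable_pi_lambda _ _ _ (⨆ j, MeasurableSpace.comap (f j) inferInstance) _ _
    fun j => ?_
  exact measurable_iff_comap_le.2 (le_iSup (fun j => MeasurableSpace.comap (f j) inferInstance) j)

theorem IsPopulationNoise.indepFun_types (h : IsPopulationNoise P lam νc νi TT τ W W₀ N) :
    IndepFun (fun ω j => τ j ω) N P := by
  rw [IndepFun_iff_Indep]
  exact indep_of_indep_of_le_left (h.indep.indep (i := 0) (j := 3) (by decide))
    (measurable_iSup_comap τ).comap_le

theorem IsPopulationNoise.indepFun_types_brownian
    (h : IsPopulationNoise P lam νc νi TT τ W W₀ N) (t : ℝ≥0) :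
    IndepFun (fun ω j => τ j ω) (fun ω j => W j t ω) P := by
  rw [IndepFun_iff_Indep]
  refine indep_of_indep_of_le_left (indep_of_indep_of_le_right
    (h.indep.indep (i := 0) (j := 1) (by decide)) ?_) (measurable_iSup_comap τ).comap_le
  refine (measurable_iSup_comap fun j ω => W j t ω).comap_le.trans (iSup_mono fun j => ?_)
  exact (measurable_processSigma (W j) t).comap_le

theorem IsPopulationNoise.iIndepFun_brownian (h : IsPopulationNoise P lam νc νi TT τ W W₀ N)
    (t : ℝ≥0) : iIndepFun (fun j => W j t) P := by
  rw [iIndepFun_iff_iIndep]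
  exact iIndep_of_iIndep_of_le h.indep_bm fun j => (measurable_processSigma (W j) t).comap_le

theorem IsPopulationNoise.indep_brownian (h : IsPopulationNoise P lam νc νi TT τ W W₀ N) (j : ℕ) :
    Indep (processSigma (W j)) (processSigma W₀) P :=
  indep_of_indep_of_le_left (h.indep.indep (i := 1) (j := 2) (by decide))
    (le_iSup (fun j => processSigma (W j)) j)

variable [IsProbabilityMeasure νi]

theorem measurePreserving_coordinate [IsProbabilityMeasure νc] (j : ℕ) :
    MeasurePreserving (fun e : Ec × (ℕ → Ei) => (e.1, e.2 j))
      (jumpIntensity lam νc (Measure.infinitePi fun _ : ℕ => νi)) (jumpIntensity lam νc νi) := by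
  have h1 := (MeasurePreserving.id νc).prod
    (measurePreserving_eval_infinitePi (fun _ : ℕ => νi) j)
  exact h1.smul_measure lam

variable [IsProbabilityMeasure P] [IsProbabilityMeasure νc]

theorem IsInvestorWealth.ae_log_eq [MeasurableSingletonClass (Ec × (ℕ → Ei))]
    (hn : IsPopulationNoise P lam νc νi TT τ W W₀ N)
    (hTy : MeasurableTypes Ty) (hTT : StandingAssumption (jumpIntensity lam νc νi) TT)
    (hab : SafetyMargins TT a b)
    (hπ : AdmissibleSignalDriven (jumpIntensity lam νc νi) TT a b π) {j : ℕ} {X : ℝ≥0 → Ω → ℝ}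
    (hX : IsInvestorWealth P T τ W W₀ N π j X) :
    ∀ᵐ ω ∂P, ∀ t ≤ T, 0 < X t ω ∧ Real.log (X t ω) =
      Real.log (τ j ω).1.x₀ + logDrift π (τ j ω) * t + ((τ j ω).1.σ * π (τ j ω) 0) * W j t ω
        + ((τ j ω).1.σ₀ * π (τ j ω) 0) * W₀ t ω
        + ∫ p in Iic t ×ˢ univ, logJump π (τ j ω) (p.2.1, p.2.2 j) ∂(N ω) := by
  have hB : MeasurableSet (Iic T ×ˢ univ : Set (ℝ≥0 × (Ec × (ℕ → Ei)))) :=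
    measurableSet_Iic.prod .univ
  have hfin := timeMeasure_prod_Iic_lt_top
    (jumpIntensity lam νc (Measure.infinitePi fun _ : ℕ => νi)) T
  have hF : ∀ t, populationInfo P τ W W₀ N t ≤ m0 := by
    refine informationAt_le (iSup_le fun j => (hn.measurable_type j).comap_le) (fun i t => ?_)
      hn.poisson.measurable
    rcases i with _ | i
    · exact hn.bm₀.measurable t
    · exact (hn.bm i).measurable t
  have hG : ∀ {f : Ty → ℝ}, Measurable f →
      Measurable[populationInfo P τ W W₀ N 0] fun ω => f (τ j ω) := by
    intro f hf
    rw [measurable_iff_comap_le]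
    refine (comap_comp_le hf (τ j)).trans (le_trans ?_ (le_informationAt 0))
    exact le_iSup (fun j => MeasurableSpace.comap (τ j) inferInstance) j
  have hπ0 : Measurable fun t => π t 0 := hπ.measurable.comp (measurable_id.prodMk measurable_const)
  refine IsWealthProcess.log_eq (F := populationInfo P τ W W₀ N) monotone_informationAt hF
    (fun t => measurable_informationAt (some j) t) (fun t => measurable_informationAt none t) hX
    (hG hTy.r) (hG hTy.κ) (hG hTy.σ) (hG hTy.σ₀) (hG hπ0)
    (ae_isDrivingPath (hn.bm j) hn.bm₀ (hn.indep_brownian j) T)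
    (fun ω => (τ j ω).1.x₀_pos) (hn.poisson.ae_hasAtoms T) ?_
  have hcoord : Measurable fun q : Ty × (ℝ≥0 × (Ec × (ℕ → Ei))) =>
      ((q.1, (q.2.2.1, q.2.2.2 j)) : Ty × (Ec × Ei)) := by fun_prop
  have hbad := (measurableSet_ruin hTy hπ.measurable).preimage hcoord
  have hτ : IndepFun (τ j) N P :=
    hn.indepFun_types.comp (measurable_pi_apply j) measurable_id
  -- Type and noise live on the same space, so independence takes over the role of the product
  -- measure.
  have h1 := hn.poisson.ae_null_of_indepFun hB hfin (hn.measurable_type j) hτ hbad (by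
    rw [hn.law_type j]
    filter_upwards [hπ.ae_pos hTT hab] with t ht
    have h2 := (measurePreserving_coordinate (lam := lam) (νc := νc) (νi := νi)
      j).quasiMeasurePreserving.ae ht
    filter_upwards [Measure.quasiMeasurePreserving_snd.ae h2] with p hp
    exact not_not.2 hp)
  filter_upwards [h1] with ω hω
  filter_upwards [hω] with p hp
  exact not_not.1 hp

variable [IsProbabilityMeasure TT]

/-- At each jump all investors share the common mark while their types and idiosyncratic marks are
i.i.d., so the average logarithmic return converges jump by jump. The finitely many jumps are then
summed, for all `t ≤ T` on one event. -/
theorem IsPopulationNoise.ae_tendsto_jump [MeasurableSingletonClass (Ec × (ℕ → Ei))]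
    (hn : IsPopulationNoise P lam νc νi TT τ W W₀ N) (hJ : IntegrableJumps TT lam νc νi π)
    (T : ℝ≥0) :
    ∀ᵐ ω ∂P, ∀ t ≤ T, Tendsto (fun n : ℕ => (∑ j ∈ Finset.range n,
        ∫ p in Iic t ×ˢ univ, logJump π (τ j ω) (p.2.1, p.2.2 j) ∂(N ω)) / n) atTop
      (𝓝 (∫ p in Iic t ×ˢ univ, meanLogJump TT νi π p.2 ∂(commonPart N ω))) := by
  set I : Measure (ℕ → Ei) := Measure.infinitePi fun _ : ℕ => νi with hI
  set Q : Measure (ℕ → Ty) := Measure.infinitePi fun _ : ℕ => TT with hQ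
  have hB : MeasurableSet (Iic T ×ˢ univ : Set (ℝ≥0 × (Ec × (ℕ → Ei)))) :=
    measurableSet_Iic.prod .univ
  have hfin := timeMeasure_prod_Iic_lt_top (jumpIntensity lam νc I) T
  have hτm : Measurable fun ω j => τ j ω := measurable_pi_lambda _ hn.measurable_type
  have hτlaw : P.map (fun ω j => τ j ω) = Q := by
    rw [(iIndepFun_iff_map_fun_eq_infinitePi_map hn.measurable_type).1 hn.indep_type]
    simp_rw [hn.law_type]
    rfl
  let good : Set (Ec × ((ℕ → Ty) × (ℕ → Ei))) := {x | Tendsto (fun n : ℕ =>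
    (∑ j ∈ Finset.range n, logJump π (x.2.1 j) (x.1, x.2.2 j)) / n) atTop
      (𝓝 (meanLogJump TT νi π x.1))}
  have hgood : MeasurableSet good := by
    refine measurableSet_tendsto_fun (fun n => ?_) (hJ.measurable_mean.comp measurable_fst)
    refine Measurable.div_const (Finset.measurable_fun_sum _ fun j _ => ?_) _
    exact hJ.measurable.comp (by fun_prop : Measurable fun x : Ec × ((ℕ → Ty) × (ℕ → Ei)) =>
      ((x.2.1 j, (x.1, x.2.2 j)) : Ty × (Ec × Ei)))
  -- The strong law is applied for a fixed common mark; Fubini then reorders the variables so that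
  -- the type sequence becomes the frozen parameter.
  have h1 : ∀ᵐ x ∂(νc.prod (Q.prod I)), x ∈ good := by
    refine (Measure.ae_prod_iff_ae_ae hgood).2 ?_
    filter_upwards [hJ.integrable_common.prod_right_ae] with c hc
    exact strong_law_infinitePi TT νi (φ := fun p : Ty × Ei => logJump π p.1 (c, p.2))
      (hJ.measurable.comp (by fun_prop : Measurable fun p : Ty × Ei =>
        ((p.1, (c, p.2)) : Ty × (Ec × Ei)))) hc
  have h2 := (measurePreserving_prod_left_comm Q νc I).quasiMeasurePreserving.ae h1
  have h3 : ∀ᵐ θ ∂Q, ∀ᵐ p ∂(timeMeasure.prod (jumpIntensity lam νc I)),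
      (p.2.1, (θ, p.2.2)) ∈ good := by
    filter_upwards [Measure.ae_ae_of_ae_prod h2] with θ hθ
    exact Measure.quasiMeasurePreserving_snd.ae (Measure.ae_smul_measure hθ lam)
  have hreorder : Measurable fun q : (ℕ → Ty) × (ℝ≥0 × (Ec × (ℕ → Ei))) =>
      ((q.2.2.1, (q.1, q.2.2.2)) : Ec × ((ℕ → Ty) × (ℕ → Ei))) := by fun_prop
  have h4 := hn.poisson.ae_null_of_indepFun hB hfin hτm hn.indepFun_types
    (hgood.compl.preimage hreorder) (by
      rw [hτlaw]
      filter_upwards [h3] with θ hθ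
      filter_upwards [hθ] with p hp
      exact not_not.2 hp)
  filter_upwards [h4, hn.poisson.ae_hasAtoms T] with ω hω ⟨K, p, hK⟩ t ht
  have hk := hK.forall_of_ae hω
  simp_rw [setIntegral_commonPart hJ.measurable_mean, hK.setIntegral ht]
  have h5 : ∀ n : ℕ, (∑ j ∈ Finset.range n, ∑ k ∈ K with (p k).1 ≤ t,
      logJump π (τ j ω) ((p k).2.1, (p k).2.2 j)) / n
        = ∑ k ∈ K with (p k).1 ≤ t, (∑ j ∈ Finset.range n,
          logJump π (τ j ω) ((p k).2.1, (p k).2.2 j)) / n := by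
    intro n
    rw [Finset.sum_comm, Finset.sum_div]
  simp_rw [h5]
  refine tendsto_finsetSum _ fun k hkt => ?_
  exact not_not.1 (hk k (Finset.mem_filter.1 hkt).1)

/-- On the logarithmic scale the geometric average is arithmetic. The idiosyncratic Brownian terms
average to zero, while the common value `W₀ t` factors out of the average of its coefficients. -/
theorem tendsto_peerAverage_meanWealth [MeasurableSingletonClass (Ec × (ℕ → Ei))]
    (hlam : 0 < lam) (hn : IsPopulationNoise P lam νc νi TT τ W W₀ N)
    (hTy : MeasurableTypes Ty) (hTT : StandingAssumption (jumpIntensity lam νc νi) TT)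
    (hab : SafetyMargins TT a b)
    (hπ : AdmissibleSignalDriven (jumpIntensity lam νc νi) TT a b π) {X : ℕ → ℝ≥0 → Ω → ℝ}
    (hX : ∀ j, IsInvestorWealth P T τ W W₀ N π j (X j)) (i : ℕ) {t : ℝ≥0} (ht : t ≤ T) :
    ∀ᵐ ω ∂P, Tendsto (fun n => peerAverage X i n t ω) atTop
      (𝓝 (meanWealth TT νi π t (W₀ t ω) (commonPart N ω))) := by
  have hJ := hπ.integrableJumps hlam hTy hTT hab
  obtain ⟨hDi, hσi, hσ₀i⟩ := hπ.integrable_parameters hTy hTT hab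
  have hDi' : Integrable (logDrift π) TT := hDi
  have hπ0 : Measurable fun t => π t 0 := hπ.measurable.comp (measurable_id.prodMk measurable_const)
  have hr := hTy.r
  have hκ := hTy.κ
  have hσ := hTy.σ
  have hσ₀ := hTy.σ₀
  have hDm : Measurable (logDrift π) := by unfold logDrift; fun_prop
  have hx₀ : Measurable fun u : Ty => Real.log u.1.x₀ := Real.measurable_log.comp hTy.x₀
  set γ : Measure ℝ := gaussianReal 0 t with hγ
  have hWlaw : ∀ j, P.map (W j t) = γ := fun j => ((hn.bm j).brownian.hasLaw_eval t).map_eq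
  have hlaw : ∀ {φ : Ty × ℝ → ℝ}, Measurable φ → Integrable φ (TT.prod γ) →
      ∀ᵐ ω ∂P, Tendsto (fun n : ℕ => (∑ j ∈ Finset.range n, φ (τ j ω, W j t ω)) / n) atTop
        (𝓝 (∫ q, φ q ∂(TT.prod γ))) := fun hφ hi =>
    strong_law_pairs hn.measurable_type (fun j => (hn.bm j).measurable t) hn.law_type hWlaw
      hn.indep_type (hn.iIndepFun_brownian t) (hn.indepFun_types_brownian t) hφ hi
  have hai : Integrable (fun u : Ty => Real.log u.1.x₀ + logDrift π u * t) TT :=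
    hTT.integrable_log_x₀.add (hDi'.mul_const _)
  have h1 := hlaw (φ := fun q => Real.log q.1.1.x₀ + logDrift π q.1 * t)
    ((hx₀.add (hDm.mul_const _)).comp measurable_fst) (hai.comp_fst γ)
  have h2 := hlaw (φ := fun q => (q.1.1.σ * π q.1 0) * q.2)
    (((hσ.mul hπ0).comp measurable_fst).mul measurable_snd)
    (hσi.mul_prod (f := fun u : Ty => u.1.σ * π u 0) (g := id)
      ((memLp_id_gaussianReal 1).integrable le_rfl))
  have h3 := hlaw (φ := fun q => q.1.1.σ₀ * π q.1 0) ((hσ₀.mul hπ0).comp measurable_fst)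
    (hσ₀i.comp_fst γ)
  have e1 : ∫ q : Ty × ℝ, (Real.log q.1.1.x₀ + logDrift π q.1 * t) ∂(TT.prod γ)
      = (∫ u : Ty, Real.log u.1.x₀ ∂TT) + (∫ u, logDrift π u ∂TT) * t := by
    rw [integral_fun_fst (fun u : Ty => Real.log u.1.x₀ + logDrift π u * t), probReal_univ,
      one_smul, integral_add hTT.integrable_log_x₀ (hDi'.mul_const _), integral_mul_const]
  have e2 : ∫ q : Ty × ℝ, (q.1.1.σ * π q.1 0) * q.2 ∂(TT.prod γ) = 0 := by
    rw [integral_prod_mul (fun u : Ty => u.1.σ * π u 0) (fun x : ℝ => x), hγ,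
      integral_id_gaussianReal, mul_zero]
  have e3 : ∫ q : Ty × ℝ, q.1.1.σ₀ * π q.1 0 ∂(TT.prod γ) = ∫ u : Ty, u.1.σ₀ * π u 0 ∂TT := by
    rw [integral_fun_fst (fun u : Ty => u.1.σ₀ * π u 0), probReal_univ, one_smul]
  rw [e1] at h1
  rw [e2] at h2
  rw [e3] at h3
  have hlog : ∀ᵐ ω ∂P, ∀ j, 0 < X j t ω ∧ Real.log (X j t ω) =
      Real.log (τ j ω).1.x₀ + logDrift π (τ j ω) * t + ((τ j ω).1.σ * π (τ j ω) 0) * W j t ω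
        + ((τ j ω).1.σ₀ * π (τ j ω) 0) * W₀ t ω
        + ∫ p in Iic t ×ˢ univ, logJump π (τ j ω) (p.2.1, p.2.2 j) ∂(N ω) := by
    refine ae_all_iff.2 fun j => ?_
    filter_upwards [(hX j).ae_log_eq hn hTy hTT hab hπ] with ω hω
    exact hω t ht
  filter_upwards [h1, h2, h3, hn.ae_tendsto_jump hJ T, hlog] with ω h1 h2 h3 h4 h5
  rw [← exp_logMeanWealth]
  refine tendsto_peerAverage (fun j => (h5 j).1) i ?_
  have h6 := ((h1.add h2).add (h3.mul_const (W₀ t ω))).add (h4 t ht)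
  rw [add_zero] at h6
  refine h6.congr fun n => ?_
  simp_rw [fun j => (h5 j).2]
  simp only [Finset.sum_add_distrib, ← Finset.sum_mul]
  ring

end Population

end MeanFieldJumpSignals

/-! ### Closed form of the mean wealth and large population limit -/

open MeanFieldJumpSignals in
theorem lemma3p6 {Ec Ei : Type*}
    [TopologicalSpace Ec] [PolishSpace Ec] [MeasurableSpace Ec] [BorelSpace Ec]
    [TopologicalSpace Ei] [PolishSpace Ei] [MeasurableSpace Ei] [BorelSpace Ei]
    (lam : ℝ≥0) (hlam : 0 < lam)
    (νc : Measure Ec) [IsProbabilityMeasure νc] (νi : Measure Ei) [IsProbabilityMeasure νi]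
    (T : ℝ≥0) (hT : 0 < T)
    -- the distribution of types
    (Ty : Set (InvestorType (Ec × Ei))) [MeasurableSpace Ty] (hTy : MeasurableTypes Ty)
    (TT : Measure Ty) [IsProbabilityMeasure TT]
    (hTT : StandingAssumption (jumpIntensity lam νc νi) TT)
    -- an admissible signal-driven strategy
    (a b : Ty → ℝ) (hab : SafetyMargins TT a b)
    (π : Ty → ℝ → ℝ) (hπ : AdmissibleSignalDriven (jumpIntensity lam νc νi) TT a b π) :
    -- the coefficients of the closed form are well defined
    (Integrable (logDrift π) TT ∧ Integrable (fun t : Ty => t.1.σ₀ * π t 0) TT ∧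
      ∀ᵐ ec ∂νc, Integrable (fun p : Ty × Ei => logJump π p.1 (ec, p.2)) (TT.prod νi)) ∧
    -- the closed form of the conditional geometric mean wealth
    (∀ (Ω : Type*) [MeasurableSpace Ω] (P : Measure Ω) [IsProbabilityMeasure P]
      (W W₀ : ℝ≥0 → Ω → ℝ) (N : Ω → Measure (ℝ≥0 × (Ec × Ei))),
      IsNoise P (jumpIntensity lam νc νi) W W₀ N →
      ∀ X : ℝ≥0 → Ty × Ω → ℝ, IsRepresentativeWealth TT P T W W₀ N π X →
      ∀ t ≤ T,
        (∀ᵐ ω ∂(TT.prod P), 0 < X t ω) ∧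
        Integrable (fun ω => Real.log (X t ω)) (TT.prod P) ∧
        (fun ω => Real.exp
            (((TT.prod P)[fun ω' => Real.log (X t ω') | commonInfo TT P W₀ N T]) ω))
          =ᵐ[TT.prod P] fun ω => meanWealth TT νi π t (W₀ t ω.2) (commonPart N ω.2)) ∧
    -- the same functional of the common noise is the limit of the peers' average wealth
    (∀ (Ω : Type*) [MeasurableSpace Ω] (P : Measure Ω) [IsProbabilityMeasure P]
      (τ : ℕ → Ω → Ty) (W : ℕ → ℝ≥0 → Ω → ℝ) (W₀ : ℝ≥0 → Ω → ℝ)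
      (N : Ω → Measure (ℝ≥0 × (Ec × (ℕ → Ei)))),
      IsPopulationNoise P lam νc νi TT τ W W₀ N →
      ∀ X : ℕ → ℝ≥0 → Ω → ℝ, (∀ j, IsInvestorWealth P T τ W W₀ N π j (X j)) →
      ∀ (i : ℕ), ∀ t ≤ T, ∀ᵐ ω ∂P,
        Tendsto (fun n => peerAverage X i n t ω) atTop
          (𝓝 (meanWealth TT νi π t (W₀ t ω) (commonPart N ω)))) := by
  have hpar := hπ.integrable_parameters hTy hTT hab
  refine ⟨⟨hpar.1, hpar.2.2,
    (hπ.integrableJumps hlam hTy hTT hab).integrable_common.prod_right_ae⟩, ?_, ?_⟩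
  · intro Ω _ P _ W W₀ N hn X hX t ht
    obtain ⟨hint, hcond⟩ := hX.condExp_log hlam hn hTy hTT hab hπ ht
    refine ⟨?_, hint, ?_⟩
    · filter_upwards [hX.ae_log_eq hn hTy hTT hab hπ] with q hq
      exact (hq t ht).1
    · filter_upwards [hcond] with q hq
      rw [← hq, exp_logMeanWealth]
  · intro Ω _ P _ τ W W₀ N hn X hX i t ht
    exact tendsto_peerAverage_meanWealth hlam hn hTy hTT hab hπ hX i ht
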